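/- Let $\alpha=(\alpha_i)_{i\in\mathbb Z}$ be i.i.d. random variables with values in $(0,1)$ on a probability space $(\Omega_1,\mathcal F_1,Q)$, and put $\epsilon_i=\log\frac{1-\alpha_i}{\alpha_i}$. Assume that $E_Q[\epsilon_0]=0$, that $\mathrm{Var}_Q[\epsilon_0]>0$, and that there is $0<\eta_0<1/2$ with $$\sup\{x: Q[\alpha_0\ge x]=1\}=\sup\{x: Q[\alpha_0\le 1-x]=1\}\ge\eta_0 .$$ For a fixed environment $\alpha$, let $P^\alpha_a$ (expectation $E^\alpha_a$) be the law of the Markov chain $(X_k)_{k\ge 0}$ on $\mathbb Z$ with $X_0=a$ that jumps from $i$ to $i+1$ with probability $\alpha_i$ and from $i$ to $i-1$ with probability $1-\alpha_i$. Let $T_x=\inf\{k\ge 1: X_k=x\}\in\mathbb N\cup\{\infty\}$ and, for a finite $V\subset\mathbb Z$, $\mathcal L(V,T)=\sum_{j\in V}\sum_{i=1}^{T}\mathbf 1_{\{X_i=j\}}$. Let $(S_k)_{k\in\mathbb Z}$ be the potential: $S_0=0$ and $S_k-S_j=\sum_{i=j+1}^{k}\epsilon_i$ for $j<k$. For integers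 $M'\le m\le M''$, the triple $\{M',m,M''\}$ is a valley if $S_{M'}=\max_{[M',m]}S$, $S_{M''}=\max_{[m,M'']}S$ and $S_m=\min_{[M',M'']}S$, where $m$ has the smallest absolute value among the minimizers of $S$ on $[M',M'']$; its depth is $\min(S_{M'}-S_m,\,S_{M''}-S_m)$. For $\gamma>0$ and an integer $n>3$ write $\log_2 n=\log\log n$ and $\Gamma_n=\log n+\gamma\log_2 n$. A valley $\{M',m,M''\}$ contains $0$ and is of depth larger than $\Gamma_n$ if $0\in[M',M'']$, its depth is at least $\Gamma_n$, and $$S_{M''}-\max_{[m,0]}S\ge\gamma\log_2 n\ \text{ if } m<0,\qquad S_{M'}-\max_{[0,m]}S\ge\gamma\log_2 n\ \text{ if } m>0 .$$ Let $m_n$ be the bottom of the smallest such valley, that is, of one whose interval $[M',M'']$ contains the interval of no other such valley (if both $q>0$ and $-q$ are bottoms of smallest valleys, $m_n=q$). Let $M_n'$ be the largest integer $l\le 0$, $l<m_n$, such that $S_l-S_{m_n}\ge\Gamma_n$ and, if $m_n>0$, also $S_l-\max_{[0,m_n]}S\ge\gamma\log_2 n$. Let $M_n$ be the smallest integer $l\ge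 0$, $l>m_n$, such that $S_l-S_{m_n}\ge\Gamma_n$ and, if $m_n<0$, also $S_l-\max_{[m_n,0]}S\ge\gamma\log_2 n$. Put $W_n=\{M_n',M_n'+1,\dots,M_n\}$. Then there is a constant $c_1=c_1(Q)>0$, depending neither on $n$ nor on $\gamma$, such that for every $\gamma>0$ and every integer $n>3$: a smallest valley exists $Q$-almost surely, the map $\alpha\mapsto E^\alpha_{m_n}[\mathcal L(W_n,T_{m_n})]\in[0,\infty]$ is $Q$-measurable (that is, measurable up to a $Q$-null set), and $$1\le E_Q\big[E^\alpha_{m_n}[\mathcal L(W_n,T_{m_n})]\big]\le c_1 .$$ In particular, for every positive increasing sequence $(\theta(n))_n$, $$Q\big[E^\alpha_{m_n}[\mathcal L(W_n,T_{m_n})]>\theta(n)\big]\le\frac{c_1}{\theta(n)} .$$ -/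

import Mathlib

open MeasureTheory ProbabilityTheory
open scoped ENNReal

namespace SinaiWalk

/-- An environment: `α i ∈ (0,1)` is the probability of a jump from `i` to `i + 1`. -/
abbrev Environment : Type := ℤ → Set.Ioo (0 : ℝ) 1

/-! ### The walk in a fixed environment -/

/-- One step of the walk: from `i` to `i + 1` with probability `α i`, and to `i - 1` with
probability `1 - α i`. -/
noncomputable def stepKernel (α : Environment) : Kernel ℤ ℤ :=
  Kernel.ofFunOfCountable fun i =>
    ENNReal.ofReal (α i : ℝ) • Measure.dirac (i + 1) +
      ENNReal.ofReal (1 - (α i : ℝ)) • Measure.dirac (i - 1)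

instance (α : Environment) : IsMarkovKernel (stepKernel α) where
  isProbabilityMeasure i := by
    have h0 : (0 : ℝ) ≤ (α i : ℝ) := (α i).2.1.le
    have h1 : (0 : ℝ) ≤ 1 - (α i : ℝ) := sub_nonneg.2 (α i).2.2.le
    constructor
    change (ENNReal.ofReal (α i : ℝ) • Measure.dirac (i + 1) +
      ENNReal.ofReal (1 - (α i : ℝ)) • Measure.dirac (i - 1)) Set.univ = 1
    simp [← ENNReal.ofReal_add h0 h1]

/-- The transition from the history `(X_0, …, X_n)` to `X_{n+1}`: it uses `X_n` only. -/
noncomputable def historyKernel (α : Environment) (n : ℕ) :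
    Kernel (Finset.Iic n → ℤ) ℤ :=
  (stepKernel α).comap (fun x => x ⟨n, Finset.mem_Iic.2 le_rfl⟩) (measurable_pi_apply _)

instance (α : Environment) (n : ℕ) : IsMarkovKernel (historyKernel α n) := by
  unfold historyKernel; infer_instance

/-- `P^α_a`: the law on `ℤ^ℕ` of the Markov chain `(X_n)` in the environment `α` with `X_0 = a`. -/
noncomputable def walkLaw (α : Environment) (a : ℤ) : Measure (ℕ → ℤ) :=
  Kernel.traj (X := fun _ => ℤ) (historyKernel α) 0 (fun _ => a)

/-- `T_x = inf {k ≥ 1 : X_k = x}`, which is `∞` if there is no such `k`. -/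
noncomputable def returnTime (X : ℕ → ℤ) (x : ℤ) : ℕ∞ :=
  ⨅ k ∈ {k : ℕ | 1 ≤ k ∧ X k = x}, (k : ℕ∞)

/-- `ℒ(k, T) = ∑_{i=1}^T 1_{X_i = k}`, for a finite or infinite time `T`. -/
noncomputable def localTime (X : ℕ → ℤ) (k : ℤ) (T : ℕ∞) : ℝ≥0∞ :=
  ∑' i : ℕ, {i : ℕ | 1 ≤ i ∧ (i : ℕ∞) ≤ T ∧ X i = k}.indicator (fun _ => (1 : ℝ≥0∞)) i

/-- `ℒ(V, T) = ∑_{j ∈ V} ℒ(j, T)`. -/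
noncomputable def localTimeOn (X : ℕ → ℤ) (V : Finset ℤ) (T : ℕ∞) : ℝ≥0∞ :=
  ∑ j ∈ V, localTime X j T

/-! ### The random potential and its valleys -/

/-- `ε_i = log ((1 - α_i) / α_i)`. -/
noncomputable def logRatio (α : Environment) (i : ℤ) : ℝ :=
  Real.log ((1 - (α i : ℝ)) / (α i : ℝ))

/-- The potential: `S_0 = 0` and `S_k - S_j = ∑_{j < i ≤ k} ε_i` for `j < k`. -/
noncomputable def potential (α : Environment) (k : ℤ) : ℝ :=
  ∑ i ∈ Finset.Ioc 0 k, logRatio α i - ∑ i ∈ Finset.Ioc k 0, logRatio α i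

/-- `{M', m, M''}` is a valley of `S`. The last clause says that among the minimizers of `S` on
`[M', M'']` the bottom `m` has the smallest absolute value. -/
structure IsValley (S : ℤ → ℝ) (M' m M'' : ℤ) : Prop where
  left_le : M' ≤ m
  le_right : m ≤ M''
  left_max : ∀ t ∈ Set.Icc M' m, S t ≤ S M'
  right_max : ∀ t ∈ Set.Icc m M'', S t ≤ S M''
  bottom_min : ∀ t ∈ Set.Icc M' M'', S m ≤ S t
  bottom_abs : ∀ t ∈ Set.Icc M' M'', S t = S m → |m| ≤ |t|

/-- The depth of the valley `{M', m, M''}`. -/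
noncomputable def depth (S : ℤ → ℝ) (M' m M'' : ℤ) : ℝ :=
  min (S M' - S m) (S M'' - S m)

/-- The iterated logarithm `log_2 n = log log n`. -/
noncomputable def logTwo (n : ℕ) : ℝ := Real.log (Real.log n)

/-- `Γ_n = log n + γ log_2 n`. -/
noncomputable def depthLevel (γ : ℝ) (n : ℕ) : ℝ := Real.log n + γ * logTwo n

/-- `{M', m, M''}` is a valley of `S` that contains `0` and is of depth larger than `Γ_n`. -/
structure IsDeepValley (γ : ℝ) (n : ℕ) (S : ℤ → ℝ) (M' m M'' : ℤ) : Prop where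
  isValley : IsValley S M' m M''
  zero_mem : (0 : ℤ) ∈ Set.Icc M' M''
  depth_ge : depthLevel γ n ≤ depth S M' m M''
  margin_right : m < 0 → ∀ t ∈ Set.Icc m 0, γ * logTwo n ≤ S M'' - S t
  margin_left : 0 < m → ∀ t ∈ Set.Icc 0 m, γ * logTwo n ≤ S M' - S t

/-- `{M', m, M''}` is the smallest valley that contains `0` and is of depth larger than `Γ_n`:
no such valley sits on a strictly smaller interval. -/
structure IsSmallestDeepValley (γ : ℝ) (n : ℕ) (S : ℤ → ℝ) (M' m M'' : ℤ) : Prop where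
  isDeepValley : IsDeepValley γ n S M' m M''
  minimal : ∀ a b c : ℤ, IsDeepValley γ n S a b c → M' ≤ a → c ≤ M'' → a = M' ∧ c = M''

/-- The bottom `m_n` of the smallest valley. Two bottoms are possible only if they are opposite
minimizers `-q` and `q`; then `q` is taken. -/
noncomputable def bottom (γ : ℝ) (n : ℕ) (S : ℤ → ℝ) : ℤ :=
  sSup {m : ℤ | ∃ M' M'' : ℤ, IsSmallestDeepValley γ n S M' m M''}

/-- The left end `M_n'` of the basic valley with bottom `m`. -/
noncomputable def leftEnd (γ : ℝ) (n : ℕ) (S : ℤ → ℝ) (m : ℤ) : ℤ :=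
  sSup {l : ℤ | l ≤ 0 ∧ l < m ∧ depthLevel γ n ≤ S l - S m ∧
    (0 < m → ∀ k ∈ Set.Icc 0 m, γ * logTwo n ≤ S l - S k)}

/-- The right end `M_n` of the basic valley with bottom `m`. -/
noncomputable def rightEnd (γ : ℝ) (n : ℕ) (S : ℤ → ℝ) (m : ℤ) : ℤ :=
  sInf {l : ℤ | 0 ≤ l ∧ m < l ∧ depthLevel γ n ≤ S l - S m ∧
    (m < 0 → ∀ k ∈ Set.Icc m 0, γ * logTwo n ≤ S l - S k)}

/-- `W_n = {M_n', …, M_n}`. -/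
noncomputable def basicValley (γ : ℝ) (n : ℕ) (α : Environment) : Finset ℤ :=
  Finset.Icc (leftEnd γ n (potential α) (bottom γ n (potential α)))
    (rightEnd γ n (potential α) (bottom γ n (potential α)))

/-- `E^α_{m_n}[ℒ(W_n, T_{m_n})]`. -/
noncomputable def meanExcursionTime (γ : ℝ) (n : ℕ) (α : Environment) : ℝ≥0∞ :=
  ∫⁻ X, localTimeOn X (basicValley γ n α) (returnTime X (bottom γ n (potential α)))
    ∂(walkLaw α (bottom γ n (potential α)))

end SinaiWalk

/-!
Write `S` for the potential, `m` for the selected bottom and `W` for the basic valley. The measure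
`π(k) = exp (-S_k) + exp (-S_{k-1})` is invariant for the walk, so an excursion from `m` visits `j`
at most `π(j) / π(m)` times in the mean (`tsum_tabooProb_le`). Ellipticity bounds the steps of `S`
by some `L`, and the mean excursion time in `W` is therefore at most
`(1 + exp L) * ∑ j ∈ W, exp (-(S_j - S_m))`. It is at least `1`, since the first step leads to a
neighbour of `m`, which belongs to `W`. What remains is to bound the mean of that sum uniformly in
the depth of the valley, and to show that a deep valley exists almost surely.

**The sum.** By reflection at the origin one may suppose `m ≥ 0`. The only consequence of minimality
that is used is that `m` is the first nonnegative bottom of a deep valley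
(`IsSmallestDeepValley.isFirstBottom`). The two halves of the potential are independent, and the two
parts of the sum are bounded separately: each time one half is explored step by step from the
origin, while the other one is frozen.

* On the side of `m`, the exploration ends when the path has climbed by `Γ_n` from a strict record
  minimum for which the frozen side has a high enough wall. Whether it has one depends on the height
  of the minimum only through a threshold, which decreases as the maximum of the explored path grows
  (`wallThreshold`).
* On the other side, the candidates for `m` are the record minima of the frozen path from which it
  climbs by `Γ_n`. A candidate is discarded when the explored path gets below it, and the exploration
  ends when the explored path is a high enough wall for the current candidate. Later candidates need
  deeper walls (`wallDepth_mono`).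

In both cases the first end of the exploration is at the end of the basic valley (`le_run_near`,
`le_run_far`), and the payoff is the weight `U = ∑ exp (-S_j)` collected so far, times `exp (S_m)`.
Its mean is bounded by the initial value of a supermartingale (`lintegral_run_le`). At height `u`
above the current minimum `s`, a path reaches `s + Γ` before it gets below `s` with a probability of
order `(u + L + 1) / (Γ + L + 1)`. Thus the weight collected so far is worth
`U * exp s * (u + L + 1) / (Γ + L + 1)`, and the new weight at that height adds
`exp (-u) * (u + L + 1) / (Γ + L + 1)`, which is compensated by the strict convexity of
`u ↦ exp (-u / 2)`: the steps have mean `0` and `E[exp (-ε / 2)] > 1` because they do not vanish.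
The number of steps near the minimum before a climb by `Γ` is of order `Γ`, which cancels the
denominator, so the bounds (`lintegral_run_near_le`, `lintegral_run_far_le`) depend on the law of
the steps only.

**Existence.** For `h ≥ Γ_n` let each half of the path run until it exceeds `h + γ log_2 n`, which
it does almost surely. If neither half makes a new minimum after it has reached `h`, then the
minimum between the two passage times is the bottom of a deep valley (`exists_isDeepValley`). A new
minimum means that the path crosses an interval longer than `h` before it gains the height
`γ log_2 n`; by the martingale property its probability tends to `0` as `h → ∞`
(`measure_exists_hasRelapse_le`). Among the deep valleys one of the shortest length is a smallest
one.
-/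


namespace SinaiWalk

/-! ### The walk in a fixed environment -/

lemma stepKernel_singleton (α : Environment) (l k : ℤ) :
    stepKernel α l {k} = (if l = k - 1 then ENNReal.ofReal (α (k - 1)) else 0) +
      (if l = k + 1 then ENNReal.ofReal (1 - α (k + 1)) else 0) := by
  change (ENNReal.ofReal (α l : ℝ) • Measure.dirac (l + 1) +
      ENNReal.ofReal (1 - (α l : ℝ)) • Measure.dirac (l - 1)) {k} = _
  have h1 : l + 1 = k ↔ l = k - 1 := by omega
  have h2 : l - 1 = k ↔ l = k + 1 := by omega
  simp only [Measure.coe_add, Measure.coe_smul, Pi.add_apply, Pi.smul_apply,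
    Measure.dirac_apply' _ (measurableSet_singleton k), Set.indicator_apply,
    Set.mem_singleton_iff, h1, h2, smul_eq_mul, Pi.one_apply, mul_ite, mul_one, mul_zero]
  congr 1
  · split_ifs with h
    · rw [h]
    · rfl
  · split_ifs with h
    · rw [h]
    · rfl

instance (α : Environment) (a : ℤ) : IsProbabilityMeasure (walkLaw α a) := by
  unfold walkLaw; infer_instance

lemma measurableSet_eval_eq (n : ℕ) (j : ℤ) : MeasurableSet {X : ℕ → ℤ | X n = j} :=
  measurableSet_eq_fun (measurable_pi_apply n) measurable_const

/-- The Markov property at time `n`, for an event of the history up to `n`. -/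
lemma walkLaw_step (α : Environment) (a : ℤ) (n : ℕ) (E : Set (Finset.Iic n → ℤ)) (k : ℤ) :
    walkLaw α a {X | Preorder.frestrictLe n X ∈ E ∧ X (n + 1) = k} =
      walkLaw α a {X | Preorder.frestrictLe n X ∈ E ∧ X n = k - 1} * ENNReal.ofReal (α (k - 1)) +
      walkLaw α a {X | Preorder.frestrictLe n X ∈ E ∧ X n = k + 1} *
        ENNReal.ofReal (1 - α (k + 1)) := by
  have hE : MeasurableSet E := MeasurableSet.of_discrete
  set x₀ : Finset.Iic 0 → ℤ := fun _ => a
  have h := Kernel.partialTraj_compProd_eq_map_traj (X := fun _ => ℤ) (κ := historyKernel α)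
    (Nat.zero_le n) (x₀ := x₀)
  have h2 := congrArg (fun μ => μ (E ×ˢ {k})) h
  beta_reduce at h2
  rw [Measure.map_apply (by fun_prop) (hE.prod (measurableSet_singleton k)),
    Measure.compProd_apply (hE.prod (measurableSet_singleton k)),
    ← Kernel.traj_map_frestrictLe_apply, lintegral_map
      (Kernel.measurable_kernel_prodMk_left (hE.prod (measurableSet_singleton k)))
      (by fun_prop)] at h2
  have hs : walkLaw α a {X | Preorder.frestrictLe n X ∈ E ∧ X (n + 1) = k} =
      Kernel.traj (X := fun _ => ℤ) (historyKernel α) 0 x₀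
        ((fun x : ℕ → ℤ => (Preorder.frestrictLe n x, x (n + 1))) ⁻¹' E ×ˢ {k}) := by
    rfl
  rw [hs, ← h2]
  change ∫⁻ X : ℕ → ℤ, _ ∂(walkLaw α a) = _
  have hm : ∀ j : ℤ, MeasurableSet {X : ℕ → ℤ | Preorder.frestrictLe n X ∈ E ∧ X n = j} :=
    fun j => ((Preorder.measurable_frestrictLe n) hE).inter
      (measurableSet_eval_eq n j)
  rw [mul_comm, mul_comm (walkLaw α a {X | Preorder.frestrictLe n X ∈ E ∧ X n = k + 1}),
    ← lintegral_indicator_const (hm _), ← lintegral_indicator_const (hm _),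
    ← lintegral_add_left (measurable_const.indicator (hm _))]
  refine lintegral_congr fun X => ?_
  change stepKernel α (X n) (Prod.mk (Preorder.frestrictLe n X) ⁻¹' E ×ˢ {k}) = _
  by_cases hX : Preorder.frestrictLe n X ∈ E
  · rw [Set.mk_preimage_prod_right hX, stepKernel_singleton]
    simp only [Set.indicator, Set.mem_ofPred_eq, hX, true_and]
  · rw [Set.mk_preimage_prod_right_eq_empty hX]
    simp [hX]

lemma walkLaw_zero (α : Environment) (a : ℤ) : walkLaw α a {X | X 0 = a} = 1 := by
  have h := Kernel.traj_map_frestrictLe_apply (X := fun _ => ℤ) (κ := historyKernel α) 0 0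
    (fun _ => a)
  rw [Kernel.partialTraj_self] at h
  have h2 := congrArg (fun μ => μ {x | x ⟨0, by simp⟩ = a}) h
  beta_reduce at h2
  rw [Measure.map_apply (by fun_prop) MeasurableSet.of_discrete, Kernel.id_apply,
    Measure.dirac_apply' _ MeasurableSet.of_discrete] at h2
  simpa [walkLaw] using h2

/-- The law of the walk started at `m` and killed at its return to `m`: the probability that
`X_{i+1} = k` and that `m` is not visited at the times `1, …, i`. -/
noncomputable def tabooProb (α : Environment) (m : ℤ) : ℕ → ℤ → ℝ≥0∞
  | 0, k => (if k - 1 = m then 1 else 0) * ENNReal.ofReal (α (k - 1)) +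
      (if k + 1 = m then 1 else 0) * ENNReal.ofReal (1 - α (k + 1))
  | i + 1, k => (if k - 1 = m then 0 else tabooProb α m i (k - 1)) * ENNReal.ofReal (α (k - 1)) +
      (if k + 1 = m then 0 else tabooProb α m i (k + 1)) * ENNReal.ofReal (1 - α (k + 1))

lemma walkLaw_taboo (α : Environment) (m : ℤ) (i : ℕ) (k : ℤ) :
    walkLaw α m {X | (∀ l, 1 ≤ l → l ≤ i → X l ≠ m) ∧ X (i + 1) = k} = tabooProb α m i k := by
  induction i generalizing k with
  | zero =>
    have h := walkLaw_step α m 0 Set.univ k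
    have h0 : ∀ j : ℤ, walkLaw α m {X | X 0 = j} = if j = m then 1 else 0 := by
      intro j
      split_ifs with hj
      · rw [hj, walkLaw_zero]
      · refine measure_mono_null (t := {X : ℕ → ℤ | X 0 = m}ᶜ) ?_ ?_
        · intro X hX hX'
          exact hj (hX.symm.trans hX')
        · rw [prob_compl_eq_zero_iff (measurableSet_eval_eq 0 m),
            walkLaw_zero]
    simp only [Set.mem_univ, true_and, h0] at h
    rw [tabooProb, ← h]
    congr 1
    ext X
    simp only [Set.mem_ofPred_eq, and_iff_right_iff_imp]
    intro _ l hl hl'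
    omega
  | succ i ih =>
    have h := walkLaw_step α m (i + 1)
      {x | ∀ l, 1 ≤ l → ∀ h : l ≤ i + 1, x ⟨l, Finset.mem_Iic.2 h⟩ ≠ m} k
    have h0 : ∀ j : ℤ, walkLaw α m {X | Preorder.frestrictLe (i + 1) X ∈
        {x : Finset.Iic (i + 1) → ℤ | ∀ l, 1 ≤ l → ∀ h : l ≤ i + 1,
          x ⟨l, Finset.mem_Iic.2 h⟩ ≠ m} ∧ X (i + 1) = j} =
        if j = m then 0 else tabooProb α m i j := by
      intro j
      split_ifs with hj
      · convert measure_empty (μ := walkLaw α m)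
        ext X
        simp only [Set.mem_ofPred_eq, Set.mem_empty_iff_false, iff_false]
        rintro ⟨h1, h2⟩
        exact h1 (i + 1) (by omega) le_rfl (h2.trans hj)
      · rw [← ih]
        congr 1
        ext X
        simp only [Set.mem_ofPred_eq]
        refine ⟨fun h => ⟨fun l h1 h2 => h.1 l h1 (by omega), h.2⟩,
          fun h => ⟨fun l h1 h2 => ?_, h.2⟩⟩
        rcases Nat.lt_or_ge i l with h3 | h3
        · have : l = i + 1 := by omega
          subst this
          change X (i + 1) ≠ m
          rw [h.2]; exact hj
        · exact h.1 l h1 h3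
    simp only [h0] at h
    rw [tabooProb, ← h]
    rfl

lemma le_returnTime_iff (X : ℕ → ℤ) (m : ℤ) (i : ℕ) :
    (i : ℕ∞) ≤ returnTime X m ↔ ∀ l, 1 ≤ l → l < i → X l ≠ m := by
  simp only [returnTime, le_iInf_iff, Set.mem_ofPred_eq, and_imp, Nat.cast_le]
  refine forall_congr' fun l => forall_congr' fun _ => ?_
  constructor
  · intro h h1 h2
    have := h h2
    omega
  · intro h h2
    by_contra h3
    exact h (by omega) h2

/-- The mean number of visits to `V` before the return to `m`. -/
noncomputable def excursionGreen (α : Environment) (m : ℤ) (V : Finset ℤ) : ℝ≥0∞ :=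
  ∑ j ∈ V, ∑' i : ℕ, tabooProb α m i j

lemma lintegral_localTimeOn (α : Environment) (m : ℤ) (V : Finset ℤ) :
    ∫⁻ X, localTimeOn X V (returnTime X m) ∂(walkLaw α m) = excursionGreen α m V := by
  have key : ∀ (X : ℕ → ℤ) (j : ℤ), localTime X j (returnTime X m) =
      ∑' i : ℕ, {X : ℕ → ℤ | (∀ l, 1 ≤ l → l ≤ i → X l ≠ m) ∧ X (i + 1) = j}.indicator
        (fun _ => (1 : ℝ≥0∞)) X := by
    intro X j
    rw [localTime, tsum_eq_zero_add' ENNReal.summable]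
    simp only [Set.indicator_apply, Set.mem_ofPred_eq, le_returnTime_iff]
    simp
  have hm : ∀ (i : ℕ) (j : ℤ), MeasurableSet
      {X : ℕ → ℤ | (∀ l, 1 ≤ l → l ≤ i → X l ≠ m) ∧ X (i + 1) = j} := by
    intro i j
    have : {X : ℕ → ℤ | (∀ l, 1 ≤ l → l ≤ i → X l ≠ m) ∧ X (i + 1) = j} =
        (⋂ l, ⋂ (_ : 1 ≤ l), ⋂ (_ : l ≤ i), {X : ℕ → ℤ | X l = m}ᶜ) ∩
          {X : ℕ → ℤ | X (i + 1) = j} := by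
      ext; simp
    rw [this]
    exact (MeasurableSet.iInter fun l => MeasurableSet.iInter fun _ => MeasurableSet.iInter fun _ =>
      (measurableSet_eval_eq l m).compl).inter (measurableSet_eval_eq (i + 1) j)
  simp only [localTimeOn, key]
  rw [lintegral_finsetSum]
  · refine Finset.sum_congr rfl fun j _ => ?_
    rw [lintegral_tsum fun i => (measurable_const.indicator (hm i j)).aemeasurable]
    refine tsum_congr fun i => ?_
    rw [lintegral_indicator_const (hm i j), one_mul, walkLaw_taboo]
  · intro j _
    exact Measurable.tsum fun i => measurable_const.indicator (hm i j)

lemma one_le_excursionGreen (α : Environment) (m : ℤ) (V : Finset ℤ) (h1 : m - 1 ∈ V)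
    (h2 : m + 1 ∈ V) : 1 ≤ excursionGreen α m V := by
  have hsub : ({m - 1, m + 1} : Finset ℤ) ⊆ V := by
    intro x hx
    simp only [Finset.mem_insert, Finset.mem_singleton] at hx
    rcases hx with rfl | rfl <;> assumption
  calc (1 : ℝ≥0∞) = ENNReal.ofReal (1 - α m) + ENNReal.ofReal (α m) := by
        rw [← ENNReal.ofReal_add (sub_nonneg.2 (α m).2.2.le) (α m).2.1.le]
        simp
    _ = ∑ j ∈ ({m - 1, m + 1} : Finset ℤ), tabooProb α m 0 j := by
        rw [Finset.sum_pair (by omega)]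
        have h3 : m - 1 - 1 ≠ m := by omega
        have h4 : m + 1 + 1 ≠ m := by omega
        simp [tabooProb, h3, h4]
    _ ≤ ∑ j ∈ ({m - 1, m + 1} : Finset ℤ), ∑' i : ℕ, tabooProb α m i j :=
        Finset.sum_le_sum fun j _ => ENNReal.le_tsum 0
    _ ≤ excursionGreen α m V := Finset.sum_le_sum_of_subset hsub

lemma potential_zero (α : Environment) : potential α 0 = 0 := by simp [potential]

lemma potential_sub_one (α : Environment) (k : ℤ) :
    potential α k - potential α (k - 1) = logRatio α k := by
  unfold potential
  rcases le_or_gt 1 k with hk | hk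
  · have h1 : Finset.Ioc 0 k = insert k (Finset.Ioc 0 (k - 1)) := by
      ext x; simp only [Finset.mem_Ioc, Finset.mem_insert]; omega
    have h2 : Finset.Ioc k 0 = ∅ := by ext x; simp; omega
    have h3 : Finset.Ioc (k - 1) 0 = ∅ := by ext x; simp; omega
    rw [h1, h2, h3, Finset.sum_insert (by simp)]
    simp
  · have h1 : Finset.Ioc (k - 1) 0 = insert k (Finset.Ioc k 0) := by
      ext x; simp only [Finset.mem_Ioc, Finset.mem_insert]; omega
    have h2 : Finset.Ioc 0 k = ∅ := by ext x; simp; omega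
    have h3 : Finset.Ioc 0 (k - 1) = ∅ := by ext x; simp; omega
    rw [h1, h2, h3, Finset.sum_insert (by simp)]
    simp

/-- The reversible measure of the walk. -/
noncomputable def revMeasure (α : Environment) (k : ℤ) : ℝ :=
  Real.exp (-potential α k) + Real.exp (-potential α (k - 1))

lemma revMeasure_pos (α : Environment) (k : ℤ) : 0 < revMeasure α k := by
  unfold revMeasure; positivity

lemma exp_logRatio (α : Environment) (k : ℤ) :
    Real.exp (logRatio α k) = (1 - α k) / α k :=
  Real.exp_log (div_pos (sub_pos.2 (α k).2.2) (α k).2.1)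

lemma revMeasure_mul_right (α : Environment) (k : ℤ) :
    revMeasure α k * (α k : ℝ) = Real.exp (-potential α k) := by
  have h0 : (α k : ℝ) ≠ 0 := (α k).2.1.ne'
  have h : Real.exp (-potential α (k - 1)) =
      Real.exp (-potential α k) * ((1 - α k) / α k) := by
    rw [← exp_logRatio, ← potential_sub_one, ← Real.exp_add]
    congr 1; ring
  rw [revMeasure, h]
  field_simp
  ring

lemma revMeasure_mul_left (α : Environment) (k : ℤ) :
    revMeasure α k * (1 - (α k : ℝ)) = Real.exp (-potential α (k - 1)) := by
  have h := revMeasure_mul_right α k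
  rw [mul_sub, h, revMeasure]; ring

/-- The mean number of visits to `k` in an excursion from `m` is at most `π(k) / π(m)`, because
`π` is invariant. -/
lemma tsum_tabooProb_le (α : Environment) (m k : ℤ) :
    ∑' i : ℕ, tabooProb α m i k ≤ ENNReal.ofReal (revMeasure α k / revMeasure α m) := by
  have hinv : ∀ k : ℤ, ENNReal.ofReal (revMeasure α (k - 1) / revMeasure α m) *
        ENNReal.ofReal (α (k - 1)) +
      ENNReal.ofReal (revMeasure α (k + 1) / revMeasure α m) * ENNReal.ofReal (1 - α (k + 1)) =
      ENNReal.ofReal (revMeasure α k / revMeasure α m) := by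
    intro k
    have hm := revMeasure_pos α m
    have h1 := revMeasure_pos α (k - 1)
    have h2 := revMeasure_pos α (k + 1)
    have h3 := (α (k - 1)).2.1
    have h4 := sub_pos.2 (α (k + 1)).2.2
    rw [← ENNReal.ofReal_mul (by positivity), ← ENNReal.ofReal_mul (by positivity),
      ← ENNReal.ofReal_add (by positivity) (by positivity), div_mul_eq_mul_div,
      div_mul_eq_mul_div, revMeasure_mul_right, revMeasure_mul_left, ← add_div, add_sub_cancel_right,
      add_comm, ← revMeasure]
  rw [ENNReal.tsum_eq_iSup_nat]
  refine iSup_le fun N => ?_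
  induction N generalizing k with
  | zero => simp
  | succ N ih =>
    rw [Finset.sum_range_succ', ← hinv k]
    have h1 : ENNReal.ofReal (revMeasure α m / revMeasure α m) = 1 := by
      rw [div_self (revMeasure_pos α m).ne', ENNReal.ofReal_one]
    simp only [tabooProb, Finset.sum_add_distrib, ← Finset.sum_mul]
    rw [add_add_add_comm, ← add_mul, ← add_mul]
    gcongr
    · by_cases h : k - 1 = m
      · simp only [h, if_true, Finset.sum_const_zero, zero_add, h1, le_refl]
      · simpa only [h, if_false, add_zero] using ih (k - 1)
    · by_cases h : k + 1 = m
      · simp only [h, if_true, Finset.sum_const_zero, zero_add, h1, le_refl]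
      · simpa only [h, if_false, add_zero] using ih (k + 1)

lemma excursionGreen_le (α : Environment) (m : ℤ) (V : Finset ℤ) (L : ℝ)
    (hL : ∀ k, |logRatio α k| ≤ L) :
    excursionGreen α m V ≤ ENNReal.ofReal (1 + Real.exp L) *
      ∑ j ∈ V, ENNReal.ofReal (Real.exp (-(potential α j - potential α m))) := by
  rw [Finset.mul_sum]
  refine Finset.sum_le_sum fun j _ => (tsum_tabooProb_le α m j).trans ?_
  rw [← ENNReal.ofReal_mul (by positivity)]
  refine ENNReal.ofReal_le_ofReal ?_
  rw [div_le_iff₀ (revMeasure_pos α m)]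
  have h1 : Real.exp (-potential α (j - 1)) ≤ Real.exp (-potential α j) * Real.exp L := by
    rw [← Real.exp_add]
    refine Real.exp_le_exp.2 ?_
    have := potential_sub_one α j
    have := (abs_le.1 (hL j)).2
    linarith
  have h2 : Real.exp (-potential α m) ≤ revMeasure α m := by
    unfold revMeasure
    have := Real.exp_pos (-potential α (m - 1))
    linarith
  calc revMeasure α j ≤ (1 + Real.exp L) * Real.exp (-potential α j) := by
        unfold revMeasure; linarith
    _ = (1 + Real.exp L) * Real.exp (-(potential α j - potential α m)) *
        Real.exp (-potential α m) := by
        rw [mul_assoc, ← Real.exp_add]; congr 2; ring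
    _ ≤ _ := by gcongr

lemma measurable_tabooProb (m : ℤ) (i : ℕ) (k : ℤ) :
    Measurable fun α : Environment => tabooProb α m i k := by
  have h1 : ∀ j : ℤ, Measurable fun α : Environment => ENNReal.ofReal (α j) := fun j =>
    (measurable_subtype_coe.comp (measurable_pi_apply j)).ennreal_ofReal
  have h2 : ∀ j : ℤ, Measurable fun α : Environment => ENNReal.ofReal (1 - α j) := fun j =>
    ((measurable_subtype_coe.comp (measurable_pi_apply j)).const_sub 1).ennreal_ofReal
  induction i generalizing k with
  | zero => exact ((h1 _).const_mul _).add ((h2 _).const_mul _)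
  | succ i ih =>
    refine (Measurable.mul ?_ (h1 _)).add (Measurable.mul ?_ (h2 _))
    · split_ifs
      · exact measurable_const
      · exact ih _
    · split_ifs
      · exact measurable_const
      · exact ih _

lemma measurable_excursionGreen (m : ℤ) (V : Finset ℤ) :
    Measurable fun α : Environment => excursionGreen α m V :=
  Finset.measurable_sum _ fun j _ => Measurable.tsum fun i => measurable_tabooProb m i j

/-! ### Supermartingale bounds for explorations of an i.i.d. sequence -/

/-- The law of a bounded centred step `e`, with `E[exp (-e / 2)] > 1`. -/
structure IsCenteredStep (ν : Measure ℝ) (L φ : ℝ) : Prop where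
  bound_pos : 0 < L
  bounded : ∀ᵐ e ∂ν, |e| ≤ L
  mean : ∫ e, e ∂ν = 0
  exp_moment : ∫ e, Real.exp (-e / 2) ∂ν = φ
  one_lt : 1 < φ

lemma IsCenteredStep.integrable_id {ν : Measure ℝ} [IsProbabilityMeasure ν] {L φ : ℝ}
    (h : IsCenteredStep ν L φ) : Integrable (fun e : ℝ => e) ν :=
  Integrable.of_bound measurable_id.aestronglyMeasurable L h.bounded

lemma IsCenteredStep.integrable_exp {ν : Measure ℝ} {L φ : ℝ}
    (h : IsCenteredStep ν L φ) : Integrable (fun e : ℝ => Real.exp (-e / 2)) ν := by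
  by_contra hi
  have h1 := h.exp_moment
  rw [integral_undef hi] at h1
  linarith [h.one_lt]

lemma IsCenteredStep.lintegral_le {ν : Measure ℝ} [IsProbabilityMeasure ν] {L φ : ℝ}
    (h : IsCenteredStep ν L φ) (F : ℝ → ℝ) (p q b : ℝ)
    (hF : ∀ e, |e| ≤ L → 0 ≤ F e ∧ F e ≤ p + q * e - b * Real.exp (-e / 2)) :
    ∫⁻ e, ENNReal.ofReal (F e) ∂ν ≤ ENNReal.ofReal (p - b * φ) := by
  have hi1 : Integrable (fun e : ℝ => p + q * e) ν :=
    (integrable_const p).add (h.integrable_id.const_mul q)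
  have hi2 := h.integrable_exp.const_mul b
  have hint : ∫ e, (p + q * e - b * Real.exp (-e / 2)) ∂ν = p - b * φ := by
    rw [integral_sub hi1 hi2, integral_add (integrable_const p) (h.integrable_id.const_mul q),
      integral_const_mul, integral_const_mul, h.mean, h.exp_moment]
    simp
  have hi : Integrable (fun e : ℝ => p + q * e - b * Real.exp (-e / 2)) ν := hi1.sub hi2
  rw [← hint, ofReal_integral_eq_lintegral_ofReal hi]
  · refine lintegral_mono_ae ?_
    filter_upwards [h.bounded] with e he
    exact ENNReal.ofReal_le_ofReal (hF e he).2
  · filter_upwards [h.bounded] with e he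
    exact (hF e he).1.trans (hF e he).2

/-- The law of an i.i.d. sequence with marginal `ν`. -/
noncomputable abbrev iidLaw (ν : Measure ℝ) [IsProbabilityMeasure ν] : Measure (ℕ → ℝ) :=
  Measure.infinitePi fun _ : ℕ => ν

/-- A sequence is its first term followed by the other ones. -/
def consEquiv : ℝ × (ℕ → ℝ) ≃ᵐ (ℕ → ℝ) where
  toFun p i := Nat.casesOn i p.1 p.2
  invFun f := (f 0, fun i => f (i + 1))
  left_inv p := rfl
  right_inv f := by
    funext i
    cases i <;> rfl
  measurable_toFun := by
    refine measurable_pi_lambda _ fun i => ?_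
    cases i with
    | zero => exact measurable_fst
    | succ i => exact (measurable_pi_apply i).comp measurable_snd
  measurable_invFun :=
    (measurable_pi_apply 0).prodMk (measurable_pi_lambda _ fun i => measurable_pi_apply (i + 1))

lemma iidLaw_eq_map_cons (ν : Measure ℝ) [IsProbabilityMeasure ν] :
    iidLaw ν = (ν.prod (iidLaw ν)).map consEquiv := by
  classical
  symm
  refine Measure.eq_infinitePi _ fun s t ht => ?_
  rw [consEquiv.map_apply]
  have h1 : (consEquiv ⁻¹' (Set.pi s t) : Set (ℝ × (ℕ → ℝ))) =
      (if 0 ∈ s then t 0 else Set.univ) ×ˢ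
        (Set.pi (s.preimage Nat.succ (Nat.succ_injective.injOn) : Finset ℕ)
          fun i => t (i + 1)) := by
    ext ⟨x, f⟩
    simp only [Set.mem_preimage, Set.mem_pi, Finset.mem_coe, Set.mem_prod, Finset.mem_preimage]
    constructor
    · intro h
      refine ⟨?_, fun i hi => h (i + 1) hi⟩
      split_ifs with h0
      · exact h 0 h0
      · trivial
    · rintro ⟨h2, h3⟩ i hi
      cases i with
      | zero => rw [if_pos hi] at h2; exact h2
      | succ i => exact h3 i hi
  rw [h1, Measure.prod_prod, Measure.infinitePi_pi _ (fun i _ => ht (i + 1)),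
    Finset.prod_preimage' Nat.succ s Nat.succ_injective.injOn fun i => ν (t i)]
  by_cases h0 : 0 ∈ s
  · rw [if_pos h0, ← Finset.mul_prod_erase s _ h0]
    congr 1
    refine Finset.prod_congr ?_ fun _ _ => rfl
    ext i
    cases i <;> simp
  · rw [if_neg h0, measure_univ, one_mul]
    refine Finset.prod_congr ?_ fun _ _ => rfl
    ext i
    cases i with
    | zero => simp [h0]
    | succ i => simp

lemma lintegral_iidLaw_le (ν : Measure ℝ) [IsProbabilityMeasure ν] (F : (ℕ → ℝ) → ℝ≥0∞) :
    ∫⁻ e, F e ∂(iidLaw ν) ≤ ∫⁻ x, ∫⁻ e, F (consEquiv (x, e)) ∂(iidLaw ν) ∂ν := by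
  conv_lhs => rw [iidLaw_eq_map_cons]
  rw [lintegral_map_equiv]
  exact lintegral_prod_le _

/-- An exploration: from the state `z` one moves to `step z e`, where `e` is the next term of the
sequence, until `halt` holds; then `pay` is received. Nothing is received if `halt` does not occur
before time `N`. -/
noncomputable def run {σ : Type*} (halt : σ → Prop) (pay : σ → ℝ≥0∞) (step : σ → ℝ → σ) :
    ℕ → σ → (ℕ → ℝ) → ℝ≥0∞
  | 0, _, _ => 0
  | N + 1, z, e => open Classical in
      if halt z then pay z else run halt pay step N (step z (e 0)) fun i => e (i + 1)

/-- The supermartingale principle for explorations. The hypothesis `hstep` says that the mean of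
`Φ (step z e)` is at most `Φ z`, by way of a majorant `p + q * e - b * exp (-e / 2)` whose mean is
`p - b * φ`; in this form no measurability in the state is needed. -/
theorem lintegral_run_le {σ : Type*} {ν : Measure ℝ} [IsProbabilityMeasure ν] {L φ : ℝ}
    (hν : IsCenteredStep ν L φ) (halt : σ → Prop) (pay : σ → ℝ≥0∞) (step : σ → ℝ → σ)
    (Inv : σ → Prop) (Φ : σ → ℝ) (hnonneg : ∀ z, Inv z → 0 ≤ Φ z)
    (hhalt : ∀ z, Inv z → halt z → pay z ≤ ENNReal.ofReal (Φ z))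
    (hstep : ∀ z, Inv z → ¬ halt z → (∀ e, |e| ≤ L → Inv (step z e)) ∧
      ∃ p q b : ℝ, p - b * φ ≤ Φ z ∧
        ∀ e, |e| ≤ L → Φ (step z e) ≤ p + q * e - b * Real.exp (-e / 2))
    (N : ℕ) (z : σ) (hz : Inv z) :
    ∫⁻ e, run halt pay step N z e ∂(iidLaw ν) ≤ ENNReal.ofReal (Φ z) := by
  induction N generalizing z with
  | zero => simp [run]
  | succ N ih =>
    by_cases hs : halt z
    · simpa [run, hs] using hhalt z hz hs
    · simp only [run, hs, if_false]
      obtain ⟨hinv, p, q, b, hpb, hext⟩ := hstep z hz hs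
      refine (lintegral_iidLaw_le ν _).trans ?_
      calc ∫⁻ x, ∫⁻ e, run halt pay step N (step z x) e ∂(iidLaw ν) ∂ν
          ≤ ∫⁻ x, ENNReal.ofReal (Φ (step z x)) ∂ν := by
            refine lintegral_mono_ae ?_
            filter_upwards [hν.bounded] with x hx
            exact ih _ (hinv x hx)
        _ ≤ ENNReal.ofReal (p - b * φ) := by
            exact hν.lintegral_le _ p q b fun e he => ⟨hnonneg _ (hinv e he), hext e he⟩
        _ ≤ ENNReal.ofReal (Φ z) := ENNReal.ofReal_le_ofReal hpb

/-- The state of an exploration at time `k`. -/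
def stateAt {σ : Type*} (step : σ → ℝ → σ) (z : σ) (e : ℕ → ℝ) : ℕ → σ
  | 0 => z
  | k + 1 => step (stateAt step z e k) (e k)

lemma stateAt_succ' {σ : Type*} (step : σ → ℝ → σ) (z : σ) (e : ℕ → ℝ) (k : ℕ) :
    stateAt step z e (k + 1) = stateAt step (step z (e 0)) (fun i => e (i + 1)) k := by
  induction k with
  | zero => rfl
  | succ k ih => rw [stateAt, ih]; rfl

lemma run_eq_pay {σ : Type*} (halt : σ → Prop) (pay : σ → ℝ≥0∞) (step : σ → ℝ → σ)
    (N M : ℕ) (hM : M < N) (z : σ) (e : ℕ → ℝ) (h1 : ∀ k < M, ¬ halt (stateAt step z e k))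
    (h2 : halt (stateAt step z e M)) :
    run halt pay step N z e = pay (stateAt step z e M) := by
  induction N generalizing M z e with
  | zero => omega
  | succ N ih =>
    cases M with
    | zero =>
      have : halt z := h2
      simp [run, this, stateAt]
    | succ M =>
      have h0 : ¬ halt z := h1 0 (by omega)
      simp only [run, h0, if_false]
      rw [stateAt_succ']
      refine ih M (by omega) _ _ (fun k hk => ?_) ?_
      · rw [← stateAt_succ']
        exact h1 (k + 1) (by omega)
      · rwa [← stateAt_succ']

/-! ### Valleys of a fixed potential -/

lemma logTwo_pos {n : ℕ} (hn : 3 < n) : 0 < logTwo n := by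
  have h4 : (4 : ℝ) ≤ n := by exact_mod_cast hn
  refine Real.log_pos ?_
  rw [Real.lt_log_iff_exp_lt (by linarith)]
  linarith [Real.exp_one_lt_d9]

lemma margin_lt_depthLevel {n : ℕ} (hn : 3 < n) (γ : ℝ) : γ * logTwo n < depthLevel γ n := by
  have h4 : (4 : ℝ) ≤ n := by exact_mod_cast hn
  have : 0 < Real.log n := Real.log_pos (by linarith)
  unfold depthLevel; linarith

/-- The maximum of `R 0, …, R m`. -/
noncomputable def runMax (R : ℕ → ℝ) : ℕ → ℝ
  | 0 => R 0
  | m + 1 => max (runMax R m) (R (m + 1))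

lemma le_runMax (R : ℕ → ℝ) {i m : ℕ} (h : i ≤ m) : R i ≤ runMax R m := by
  induction m with
  | zero => obtain rfl : i = 0 := by omega
            exact le_rfl
  | succ m ih =>
    rcases Nat.lt_or_ge m i with h1 | h1
    · obtain rfl : i = m + 1 := by omega
      exact le_max_right _ _
    · exact (ih h1).trans (le_max_left _ _)

lemma exists_eq_runMax (R : ℕ → ℝ) (m : ℕ) : ∃ i ≤ m, R i = runMax R m := by
  induction m with
  | zero => exact ⟨0, le_rfl, rfl⟩
  | succ m ih =>
    rcases max_choice (runMax R m) (R (m + 1)) with h | h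
    · obtain ⟨i, hi, h1⟩ := ih
      exact ⟨i, by omega, h1.trans h.symm⟩
    · exact ⟨m + 1, le_rfl, h.symm⟩

lemma runMax_mono (R : ℕ → ℝ) {i m : ℕ} (h : i ≤ m) : runMax R i ≤ runMax R m := by
  obtain ⟨j, hj, h1⟩ := exists_eq_runMax R i
  rw [← h1]; exact le_runMax R (hj.trans h)

/-- The half of `S` to the right of the origin. -/
def rightHalf (S : ℤ → ℝ) (k : ℕ) : ℝ := S k

/-- The half of `S` to the left of the origin, read from the origin. -/
def leftHalf (S : ℤ → ℝ) (k : ℕ) : ℝ := S (-k)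

/-- The height which the left wall of a deep valley with bottom `m ≥ 0` has to reach. -/
noncomputable def wallLevel (Γ g : ℝ) (R : ℕ → ℝ) (m : ℕ) : ℝ :=
  max (R m + Γ) (runMax R m + g)

/-- Seen from the origin, the path `l` reaches a wall that is adequate for a bottom at distance
`m` on the other side, at height `s` and separated from the origin by a pass of height `h`; it does
so before it gets below `s` (or down to `s`, at a time smaller than `m`). -/
def HasWall (Γ g : ℝ) (l : ℕ → ℝ) (s h : ℝ) (m : ℕ) : Prop :=
  ∃ k, (∀ i ≤ k, s ≤ l i ∧ (i < m → s < l i)) ∧ max (s + Γ) (h + g) ≤ l k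

/-- `m` is the bottom of a deep valley that contains `0`. -/
def HasDeepBottom (γ : ℝ) (n : ℕ) (S : ℤ → ℝ) (m : ℤ) : Prop :=
  ∃ a c, IsDeepValley γ n S a m c

/-- `m` is the smallest nonnegative bottom of a deep valley. -/
def IsFirstBottom (γ : ℝ) (n : ℕ) (S : ℤ → ℝ) (m : ℕ) : Prop :=
  HasDeepBottom γ n S m ∧ ∀ i < m, ¬ HasDeepBottom γ n S i

/-- `m` is a strict record minimum from which `R` climbs by `Γ`. -/
def IsRise (Γ : ℝ) (R : ℕ → ℝ) (m : ℕ) : Prop :=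
  (∀ i < m, R m < R i) ∧ ∃ c, m < c ∧ R m + Γ ≤ R c ∧ ∀ i, m ≤ i → i ≤ c → R m ≤ R i

lemma IsDeepValley.lt_and_lt {γ : ℝ} (hγ : 0 < γ) {n : ℕ} (hn : 3 < n) {S : ℤ → ℝ} {a m c : ℤ}
    (h : IsDeepValley γ n S a m c) : a < m ∧ m < c := by
  have h1 := h.depth_ge
  have h2 := margin_lt_depthLevel hn γ
  have h3 := mul_pos hγ (logTwo_pos hn)
  rw [depth, le_min_iff] at h1
  refine ⟨lt_of_le_of_ne h.isValley.left_le ?_, lt_of_le_of_ne h.isValley.le_right ?_⟩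
  · rintro rfl; linarith
  · rintro rfl; linarith

/-- A smallest deep valley with nonnegative bottom `m` has no deep bottom between `0` and `m`:
together with the left wall of the given valley, it would make a smaller valley. -/
lemma IsSmallestDeepValley.isFirstBottom {γ : ℝ} {n : ℕ} {S : ℤ → ℝ} {a c : ℤ} {m : ℕ}
    (h : IsSmallestDeepValley γ n S a m c) : IsFirstBottom γ n S m := by
  refine ⟨⟨a, c, h.isDeepValley⟩, fun i hi ⟨a1, c1, h1⟩ => ?_⟩
  have hv := h.isDeepValley
  have ha := hv.zero_mem.1
  have hmc := hv.isValley.le_right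
  have hi' : (i : ℤ) < m := by exact_mod_cast hi
  have hlt : S m < S i := by
    refine lt_of_le_of_ne (hv.isValley.bottom_min i ⟨by omega, by omega⟩) fun he => ?_
    have := hv.isValley.bottom_abs i ⟨by omega, by omega⟩ he.symm
    simp only [Nat.abs_cast, Nat.cast_le] at this
    omega
  have hc1 : c1 < m := by
    by_contra hcon
    have := h1.isValley.bottom_min m ⟨by have := h1.isValley.left_le; omega, by omega⟩
    linarith
  have hic1 := h1.isValley.le_right
  rcases le_or_gt a a1 with ha1 | ha1
  · have := (h.minimal _ _ _ h1 ha1 (by omega)).2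
    omega
  · have hsub : ∀ t ∈ Set.Icc a c1, t ∈ Set.Icc a1 c1 := fun t ht => ⟨by have := ht.1; omega, ht.2⟩
    have hd : IsDeepValley γ n S a i c1 :=
      { isValley :=
          { left_le := by omega
            le_right := hic1
            left_max := fun t ht => hv.isValley.left_max t ⟨ht.1, by have := ht.2; omega⟩
            right_max := h1.isValley.right_max
            bottom_min := fun t ht => h1.isValley.bottom_min t (hsub t ht)
            bottom_abs := fun t ht => h1.isValley.bottom_abs t (hsub t ht) }
        zero_mem := ⟨ha, h1.zero_mem.2⟩
        depth_ge := by
          have h2 := h1.depth_ge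
          rw [depth, le_min_iff] at h2 ⊢
          have h3 := hv.isValley.left_max c1 ⟨by omega, by omega⟩
          exact ⟨by linarith [h2.2], h2.2⟩
        margin_right := fun hneg => by omega
        margin_left := fun _ t ht => hv.margin_left (by omega) t ⟨ht.1, by have := ht.2; omega⟩ }
    have := (h.minimal _ _ _ hd le_rfl (by omega)).2
    omega

lemma hasDeepBottom_of_hasWall {γ : ℝ} (hγ : 0 < γ) {n : ℕ} (hn : 3 < n) {S : ℤ → ℝ} {m : ℕ}
    (hrise : IsRise (depthLevel γ n) (rightHalf S) m)
    (hwall : HasWall (depthLevel γ n) (γ * logTwo n) (leftHalf S) (S m)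
      (runMax (rightHalf S) m) m) :
    HasDeepBottom γ n S m := by
  classical
  have hg := mul_pos hγ (logTwo_pos hn)
  have hΓ := margin_lt_depthLevel hn γ
  obtain ⟨hrec, hc⟩ := hrise
  set Γ := depthLevel γ n
  set g := γ * logTwo n
  set K := max (S m + Γ) (runMax (rightHalf S) m + g) with hK
  obtain ⟨k, ⟨hk1, hk2⟩, hk3⟩ : ∃ k, ((∀ i ≤ k, S m ≤ leftHalf S i ∧ (i < m → S m < leftHalf S i)) ∧
      K ≤ leftHalf S k) ∧ ∀ i < k, leftHalf S i < K := by
    have hex : ∃ k, (∀ i ≤ k, S m ≤ leftHalf S i ∧ (i < m → S m < leftHalf S i)) ∧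
      K ≤ leftHalf S k := hwall
    refine ⟨Nat.find hex, Nat.find_spec hex, fun i hi => ?_⟩
    by_contra hcon
    exact Nat.find_min hex hi ⟨fun j hj => (Nat.find_spec hex).1 j (by omega), not_lt.1 hcon⟩
  obtain ⟨c, ⟨hc1, hc2, hc3⟩, hc4⟩ : ∃ c, (m < c ∧ S m + Γ ≤ rightHalf S c ∧
      ∀ i, m ≤ i → i ≤ c → S m ≤ rightHalf S i) ∧ ∀ i, m ≤ i → i < c → rightHalf S i < S m + Γ := by
    have hex : ∃ c, m < c ∧ S m + Γ ≤ rightHalf S c ∧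
      ∀ i, m ≤ i → i ≤ c → S m ≤ rightHalf S i := hc
    refine ⟨Nat.find hex, Nat.find_spec hex, fun i hi1 hi2 => ?_⟩
    by_contra hcon
    rcases Nat.eq_or_lt_of_le hi1 with rfl | hi1
    · simp only [rightHalf] at hcon; linarith
    · exact Nat.find_min hex hi2
        ⟨hi1, not_lt.1 hcon, fun j hj hj' => (Nat.find_spec hex).2.2 j hj (by omega)⟩
  have hKS : S m + Γ ≤ S (-k : ℤ) := (le_max_left _ _).trans hk2
  have hKm : ∀ i : ℕ, i ≤ m → S i + g ≤ S (-k : ℤ) := fun i hi => by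
    have h1 := le_runMax (rightHalf S) hi
    have h2 : runMax (rightHalf S) m + g ≤ S (-k : ℤ) := (le_max_right _ _).trans hk2
    simp only [rightHalf] at h1 ⊢
    linarith
  have hneg : ∀ t : ℤ, t ≤ 0 → -(k : ℤ) ≤ t → ∃ j : ℕ, j ≤ k ∧ t = -(j : ℤ) := fun t h1 h2 =>
    ⟨(-t).toNat, by omega, by omega⟩
  refine ⟨-(k : ℤ), c, ⟨by omega, by omega, ?_, ?_, ?_, ?_⟩, ⟨by omega, by omega⟩, ?_, ?_, ?_⟩
  · rintro t ⟨ht1, ht2⟩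
    rcases le_or_gt 0 t with h0 | h0
    · lift t to ℕ using h0
      have := hKm t (by omega)
      linarith
    · obtain ⟨j, hj, rfl⟩ := hneg t h0.le ht1
      rcases Nat.eq_or_lt_of_le hj with rfl | hj
      · exact le_rfl
      · exact ((hk3 j hj).trans_le hk2).le
  · rintro t ⟨ht1, ht2⟩
    lift t to ℕ using (by omega)
    rcases Nat.eq_or_lt_of_le (show t ≤ c by omega) with rfl | hj
    · exact le_rfl
    · exact ((hc4 t (by omega) hj).trans_le hc2).le
  · rintro t ⟨ht1, ht2⟩
    rcases le_or_gt 0 t with h0 | h0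
    · lift t to ℕ using h0
      rcases Nat.lt_or_ge t m with h1 | h1
      · exact (hrec t h1).le
      · exact hc3 t h1 (by omega)
    · obtain ⟨j, hj, rfl⟩ := hneg t h0.le ht1
      exact (hk1 j hj).1
  · rintro t ⟨ht1, ht2⟩ heq
    rcases le_or_gt 0 t with h0 | h0
    · lift t to ℕ using h0
      rcases Nat.lt_or_ge t m with h1 | h1
      · exact absurd (hrec t h1) (by simp [rightHalf, heq])
      · simpa using h1
    · obtain ⟨j, hj, rfl⟩ := hneg t h0.le ht1
      rcases Nat.lt_or_ge j m with h1 | h1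
      · exact absurd ((hk1 j hj).2 h1) (by simp [leftHalf, heq])
      · simpa using h1
  · rw [depth, le_min_iff]
    have : S m + Γ ≤ S c := hc2
    exact ⟨by linarith, by linarith⟩
  · intro h; omega
  · rintro h t ⟨ht1, ht2⟩
    lift t to ℕ using ht1
    have := hKm t (by omega)
    linarith

lemma HasDeepBottom.hasWall {γ : ℝ} {n : ℕ} (hn : 3 < n) {S : ℤ → ℝ} {m : ℕ}
    (h : HasDeepBottom γ n S m) :
    HasWall (depthLevel γ n) (γ * logTwo n) (leftHalf S) (S m) (runMax (rightHalf S) m) m := by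
  obtain ⟨a, c, h⟩ := h
  have ha := h.zero_mem.1
  have hmc := h.isValley.le_right
  have hd := h.depth_ge
  rw [depth, le_min_iff] at hd
  refine ⟨(-a).toNat, fun i hi => ?_, ?_⟩
  · have hmem : (-(i : ℤ)) ∈ Set.Icc a c := ⟨by omega, by omega⟩
    have hle := h.isValley.bottom_min _ hmem
    refine ⟨hle, fun him => lt_of_le_of_ne hle fun he => ?_⟩
    have := h.isValley.bottom_abs _ hmem he.symm
    simp only [Nat.abs_cast, abs_neg, Nat.cast_le] at this
    omega
  · have haa : leftHalf S (-a).toNat = S a := by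
      unfold leftHalf; congr 1; omega
    rw [haa]
    refine max_le (by linarith [hd.1]) ?_
    obtain ⟨i, hi, hmax⟩ := exists_eq_runMax (rightHalf S) m
    rw [← hmax, rightHalf]
    rcases Nat.eq_zero_or_pos m with rfl | hm
    · obtain rfl : i = 0 := by omega
      linarith [hd.1, margin_lt_depthLevel hn γ]
    · have := h.margin_left (by omega) i ⟨by omega, by omega⟩
      linarith

lemma HasDeepBottom.record {γ : ℝ} {n : ℕ} {S : ℤ → ℝ} {m : ℕ}
    (h : HasDeepBottom γ n S m) : ∀ i < m, rightHalf S m < rightHalf S i := by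
  obtain ⟨a, c, h⟩ := h
  have ha := h.zero_mem.1
  have hmc := h.isValley.le_right
  intro i hi
  have hmem : (i : ℤ) ∈ Set.Icc a c := ⟨by omega, by omega⟩
  refine lt_of_le_of_ne (h.isValley.bottom_min i hmem) fun he => ?_
  have := h.isValley.bottom_abs i hmem he.symm
  simp only [Nat.abs_cast, Nat.cast_le] at this
  omega

/-- `c` is the first time after `m` at which `R` is higher than `R m` by `Γ`. -/
def IsFirstRise (Γ : ℝ) (R : ℕ → ℝ) (m c : ℕ) : Prop :=
  m < c ∧ R m + Γ ≤ R c ∧ ∀ i, m < i → i < c → R i < R m + Γ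

lemma HasDeepBottom.le_of_isFirstRise {γ : ℝ} (hγ : 0 < γ) {n : ℕ} (hn : 3 < n) {S : ℤ → ℝ} {m : ℕ}
    (h : HasDeepBottom γ n S m) {M : ℕ} (hM : IsFirstRise (depthLevel γ n) (rightHalf S) m M) :
    ∀ i, m ≤ i → i ≤ M → rightHalf S m ≤ rightHalf S i := by
  obtain ⟨a, c, h⟩ := h
  have hmc := (h.lt_and_lt hγ hn).2
  have ham := (h.lt_and_lt hγ hn).1
  have hMc : (M : ℤ) ≤ c := by
    by_contra hcon
    have h1 := hM.2.2 c.toNat (by omega) (by omega)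
    have hd := h.depth_ge
    rw [depth, le_min_iff] at hd
    have : rightHalf S c.toNat = S c := by unfold rightHalf; congr 1; omega
    rw [this, rightHalf] at h1
    linarith [hd.2]
  intro i hi hi'
  exact h.isValley.bottom_min i ⟨by omega, by omega⟩

/-- The possible positions of the left end of the basic valley with bottom `m`. -/
def leftSet (γ : ℝ) (n : ℕ) (S : ℤ → ℝ) (m : ℤ) : Set ℤ :=
  {l : ℤ | l ≤ 0 ∧ l < m ∧ depthLevel γ n ≤ S l - S m ∧
    (0 < m → ∀ k ∈ Set.Icc 0 m, γ * logTwo n ≤ S l - S k)}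

/-- The possible positions of the right end of the basic valley with bottom `m`. -/
def rightSet (γ : ℝ) (n : ℕ) (S : ℤ → ℝ) (m : ℤ) : Set ℤ :=
  {l : ℤ | 0 ≤ l ∧ m < l ∧ depthLevel γ n ≤ S l - S m ∧
    (m < 0 → ∀ k ∈ Set.Icc m 0, γ * logTwo n ≤ S l - S k)}

lemma IsDeepValley.left_mem {γ : ℝ} (hγ : 0 < γ) {n : ℕ} (hn : 3 < n) {S : ℤ → ℝ} {a m c : ℤ}
    (h : IsDeepValley γ n S a m c) : a ∈ leftSet γ n S m := by
  have hd := h.depth_ge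
  rw [depth, le_min_iff] at hd
  exact ⟨h.zero_mem.1, (h.lt_and_lt hγ hn).1, hd.1, fun hm => h.margin_left hm⟩

lemma IsDeepValley.right_mem {γ : ℝ} (hγ : 0 < γ) {n : ℕ} (hn : 3 < n) {S : ℤ → ℝ} {a m c : ℤ}
    (h : IsDeepValley γ n S a m c) : c ∈ rightSet γ n S m := by
  have hd := h.depth_ge
  rw [depth, le_min_iff] at hd
  exact ⟨h.zero_mem.2, (h.lt_and_lt hγ hn).2, hd.2, fun hm => h.margin_right hm⟩

lemma isFirstRise_of_isLeast {γ : ℝ} {n : ℕ} {S : ℤ → ℝ} {m : ℕ} {M : ℤ}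
    (h : IsLeast (rightSet γ n S m) M) :
    IsFirstRise (depthLevel γ n) (rightHalf S) m M.toNat := by
  obtain ⟨⟨h1, h2, h3, h4⟩, h5⟩ := h
  lift M to ℕ using h1
  simp only [Int.toNat_natCast]
  refine ⟨by omega, by simp only [rightHalf]; linarith, fun i hi hi' => ?_⟩
  by_contra hcon
  have : (i : ℤ) ∈ rightSet γ n S m :=
    ⟨by omega, by omega, by simp only [rightHalf] at hcon; linarith, fun h => by omega⟩
  have := h5 this
  omega

lemma mem_leftSet_iff {γ : ℝ} (hγ : 0 < γ) {n : ℕ} (hn : 3 < n) {S : ℤ → ℝ} {m k : ℕ} :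
    -(k : ℤ) ∈ leftSet γ n S m ↔
      wallLevel (depthLevel γ n) (γ * logTwo n) (rightHalf S) m ≤ leftHalf S k := by
  have hg := mul_pos hγ (logTwo_pos hn)
  have hΓ := margin_lt_depthLevel hn γ
  rw [wallLevel, max_le_iff]
  constructor
  · rintro ⟨h1, h2, h3, h4⟩
    refine ⟨by simp only [rightHalf, leftHalf]; linarith, ?_⟩
    obtain ⟨i, hi, hmax⟩ := exists_eq_runMax (rightHalf S) m
    rw [← hmax, rightHalf, leftHalf]
    rcases Nat.eq_zero_or_pos m with rfl | hm
    · obtain rfl : i = 0 := by omega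
      linarith
    · have := h4 (by omega) i ⟨by omega, by omega⟩
      linarith
  · rintro ⟨h1, h2⟩
    simp only [rightHalf, leftHalf] at h1
    refine ⟨by omega, ?_, by linarith, ?_⟩
    · by_contra hcon
      obtain rfl : k = 0 := by omega
      obtain rfl : m = 0 := by omega
      simp only [Nat.cast_zero, neg_zero] at h1
      linarith
    · rintro hm i ⟨hi, hi'⟩
      lift i to ℕ using hi
      have := le_runMax (rightHalf S) (show i ≤ m by omega)
      simp only [rightHalf, leftHalf] at this h2
      linarith

/-- `k` is the first time at which `l` reaches the level `K`. -/
def IsFirstPassage (K : ℝ) (l : ℕ → ℝ) (k : ℕ) : Prop := K ≤ l k ∧ ∀ i < k, l i < K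

lemma isFirstPassage_of_isGreatest {γ : ℝ} (hγ : 0 < γ) {n : ℕ} (hn : 3 < n) {S : ℤ → ℝ} {m : ℕ}
    {M' : ℤ} (h : IsGreatest (leftSet γ n S m) M') :
    IsFirstPassage (wallLevel (depthLevel γ n) (γ * logTwo n) (rightHalf S) m) (leftHalf S)
      (-M').toNat := by
  obtain ⟨h1, h2⟩ := h
  have h0 : M' = -((-M').toNat : ℤ) := by have := h1.1; omega
  refine ⟨(mem_leftSet_iff hγ hn).1 (h0 ▸ h1), fun i hi => ?_⟩
  by_contra hcon
  have := h2 ((mem_leftSet_iff hγ hn).2 (not_lt.1 hcon))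
  omega

/-! ### Reflection at the origin -/

/-- The potential seen in a mirror at the origin. -/
def mirror (S : ℤ → ℝ) (k : ℤ) : ℝ := S (-k)

lemma IsDeepValley.mirror {γ : ℝ} {n : ℕ} {S : ℤ → ℝ} {a m c : ℤ}
    (h : IsDeepValley γ n S a m c) : IsDeepValley γ n (mirror S) (-c) (-m) (-a) where
  isValley :=
    { left_le := by have := h.isValley.le_right; omega
      le_right := by have := h.isValley.left_le; omega
      left_max := fun t ht => by
        simp only [SinaiWalk.mirror, neg_neg]
        exact h.isValley.right_max (-t) ⟨by have := ht.2; omega, by have := ht.1; omega⟩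
      right_max := fun t ht => by
        simp only [SinaiWalk.mirror, neg_neg]
        exact h.isValley.left_max (-t) ⟨by have := ht.2; omega, by have := ht.1; omega⟩
      bottom_min := fun t ht => by
        simp only [SinaiWalk.mirror, neg_neg]
        exact h.isValley.bottom_min (-t) ⟨by have := ht.2; omega, by have := ht.1; omega⟩
      bottom_abs := fun t ht he => by
        simp only [SinaiWalk.mirror, neg_neg] at he
        have := h.isValley.bottom_abs (-t) ⟨by have := ht.2; omega, by have := ht.1; omega⟩ he
        rwa [abs_neg] at this ⊢ }
  zero_mem := ⟨by have := h.zero_mem.2; omega, by have := h.zero_mem.1; omega⟩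
  depth_ge := by
    have := h.depth_ge
    simp only [depth, SinaiWalk.mirror, neg_neg] at this ⊢
    rwa [min_comm]
  margin_right := fun hm t ht => by
    simp only [SinaiWalk.mirror, neg_neg]
    exact h.margin_left (by omega) (-t) ⟨by have := ht.2; omega, by have := ht.1; omega⟩
  margin_left := fun hm t ht => by
    simp only [SinaiWalk.mirror, neg_neg]
    exact h.margin_right (by omega) (-t) ⟨by have := ht.2; omega, by have := ht.1; omega⟩

lemma mirror_mirror (S : ℤ → ℝ) : mirror (mirror S) = S := by
  funext k; simp [mirror]

lemma IsSmallestDeepValley.mirror {γ : ℝ} {n : ℕ} {S : ℤ → ℝ} {a m c : ℤ}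
    (h : IsSmallestDeepValley γ n S a m c) :
    IsSmallestDeepValley γ n (mirror S) (-c) (-m) (-a) where
  isDeepValley := h.isDeepValley.mirror
  minimal := fun a' b' c' h' h1 h2 => by
    have h3 := h'.mirror
    rw [mirror_mirror] at h3
    have := h.minimal _ _ _ h3 (by omega) (by omega)
    omega

lemma neg_mem_leftSet_mirror {γ : ℝ} {n : ℕ} {S : ℤ → ℝ} {m l : ℤ} :
    -l ∈ leftSet γ n (mirror S) (-m) ↔ l ∈ rightSet γ n S m := by
  simp only [leftSet, rightSet, mirror, Set.mem_ofPred_eq, neg_neg, Set.mem_Icc]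
  refine and_congr (by omega) (and_congr (by omega) (and_congr Iff.rfl
    ⟨fun h hm k hk => ?_, fun h hm k hk => ?_⟩))
  · have := h (by omega) (-k) ⟨by omega, by omega⟩
    rwa [neg_neg] at this
  · exact h (by omega) (-k) ⟨by omega, by omega⟩

lemma neg_mem_rightSet_mirror {γ : ℝ} {n : ℕ} {S : ℤ → ℝ} {m l : ℤ} :
    -l ∈ rightSet γ n (mirror S) (-m) ↔ l ∈ leftSet γ n S m := by
  have h := neg_mem_leftSet_mirror (γ := γ) (n := n) (S := mirror S) (m := -m) (l := -l)
  rw [mirror_mirror, neg_neg, neg_neg] at h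
  exact h.symm

lemma isGreatest_leftSet_mirror {γ : ℝ} {n : ℕ} {S : ℤ → ℝ} {m l : ℤ}
    (h : IsLeast (rightSet γ n S m) l) : IsGreatest (leftSet γ n (mirror S) (-m)) (-l) := by
  refine ⟨neg_mem_leftSet_mirror.2 h.1, fun x hx => ?_⟩
  rw [← neg_neg x, neg_mem_leftSet_mirror] at hx
  have := h.2 hx
  omega

lemma isLeast_rightSet_mirror {γ : ℝ} {n : ℕ} {S : ℤ → ℝ} {m l : ℤ}
    (h : IsGreatest (leftSet γ n S m) l) : IsLeast (rightSet γ n (mirror S) (-m)) (-l) := by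
  refine ⟨neg_mem_rightSet_mirror.2 h.1, fun x hx => ?_⟩
  rw [← neg_neg x, neg_mem_rightSet_mirror] at hx
  have := h.2 hx
  omega

/-! ### Elementary inequalities -/

lemma exp_neg_le_inv (t : ℝ) : Real.exp (-t) * (1 + t) ≤ 1 := by
  have h := Real.add_one_le_exp t
  have h2 : Real.exp (-t) * Real.exp t = 1 := by rw [← Real.exp_add]; simp
  have := Real.exp_pos (-t)
  nlinarith

/-- The value `(d - o) + (L + 1)`, discounted by `exp (-d)`, stays below the linear extension. -/
lemma exp_neg_mul_le {L o d : ℝ} (ho : 0 ≤ o) (hoL : o ≤ L) (hd : o ≤ d) :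
    Real.exp (-d) * (d - o + L + 1) ≤ L + 1 - o := by
  have h1 := exp_neg_le_inv o
  have h2 := exp_neg_le_inv (d - o)
  have h3 : Real.exp (-d) = Real.exp (-o) * Real.exp (-(d - o)) := by
    rw [← Real.exp_add]; congr 1; ring
  have hp1 := Real.exp_pos (-o)
  have hp2 := Real.exp_pos (-(d - o))
  have h4 : Real.exp (-(d - o)) * (d - o + L + 1) ≤ L + 1 := by
    nlinarith [mul_nonneg (ho.trans hoL) (sub_nonneg.2 hd),
      mul_nonneg hp2.le (mul_nonneg (ho.trans hoL) (sub_nonneg.2 hd))]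
  have h5 : Real.exp (-o) * (L + 1) ≤ L + 1 - o := by
    have : (1 + o) * (L + 1 - o) = L + 1 + o * (L - o) := by ring
    have h6 : 0 ≤ o * (L - o) := mul_nonneg ho (sub_nonneg.2 hoL)
    have h7 : L + 1 ≤ (1 + o) * (L + 1 - o) := by linarith
    calc Real.exp (-o) * (L + 1) ≤ Real.exp (-o) * ((1 + o) * (L + 1 - o)) := by gcongr
      _ = (Real.exp (-o) * (1 + o)) * (L + 1 - o) := by ring
      _ ≤ 1 * (L + 1 - o) := by
        refine mul_le_mul_of_nonneg_right h1 ?_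
        linarith
      _ = _ := one_mul _
  rw [h3, mul_assoc]
  exact (mul_le_mul_of_nonneg_left h4 hp1.le).trans h5

lemma exp_half_sub_one_le {L o : ℝ} (ho : 0 ≤ o) (hoL : o ≤ L) :
    Real.exp (o / 2) - 1 ≤ o * Real.exp (L / 2) := by
  have h1 := Real.add_one_le_exp (-(o / 2))
  have h2 : Real.exp (-(o / 2)) * Real.exp (o / 2) = 1 := by rw [← Real.exp_add]; simp
  have h3 : Real.exp (o / 2) ≤ Real.exp (L / 2) := Real.exp_le_exp.2 (by linarith)
  have h4 := Real.exp_pos (o / 2)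
  nlinarith

lemma exp_neg_mul_linear_le {L u : ℝ} (hL : 0 ≤ L) (hu : 0 ≤ u) :
    Real.exp (-u) * (u + L + 1) ≤ (L + 2) * Real.exp (-u / 2) := by
  have h1 := exp_neg_le_inv (u / 2)
  have h2 : Real.exp (-u) = Real.exp (-u / 2) * Real.exp (-(u / 2)) := by
    rw [← Real.exp_add]; congr 1; ring
  have h3 := Real.exp_pos (-(u / 2))
  have h4 : u + L + 1 ≤ (L + 2) * (1 + u / 2) := by nlinarith
  have h5 : Real.exp (-(u / 2)) * (u + L + 1) ≤ L + 2 := by nlinarith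
  have h6 := Real.exp_pos (-u / 2)
  rw [h2, mul_assoc, mul_comm (L + 2)]
  exact mul_le_mul_of_nonneg_left h5 h6.le

/-! ### The constants -/

/-- The weight of the exponential in the supermartingale of an idle exploration. -/
noncomputable def idleExpConst (L φ : ℝ) : ℝ := (L + 2) / (φ - 1)

/-- A bound for the mean weight collected in an idle period. -/
noncomputable def idleConst (L φ : ℝ) : ℝ := idleExpConst L φ * Real.exp (L / 2)

/-- The weight of the exponential in the supermartingales of active explorations. -/
noncomputable def expConst (L φ : ℝ) : ℝ :=
  (L + 2 + idleConst L φ * Real.exp (L / 2)) / (φ - 1)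

/-- The weight of the linear function in the supermartingales. -/
noncomputable def linConst (L φ : ℝ) : ℝ := expConst L φ * Real.exp (L / 2)

section Consts

variable {ν : Measure ℝ} {L φ : ℝ} (hν : IsCenteredStep ν L φ)
include hν

lemma IsCenteredStep.idleExpConst_pos : 0 < idleExpConst L φ :=
  div_pos (by linarith [hν.bound_pos]) (by linarith [hν.one_lt])

lemma IsCenteredStep.idleExpConst_mul : idleExpConst L φ * (φ - 1) = L + 2 :=
  div_mul_cancel₀ _ (by linarith [hν.one_lt])

lemma IsCenteredStep.idleConst_pos : 0 < idleConst L φ :=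
  mul_pos hν.idleExpConst_pos (Real.exp_pos _)

lemma IsCenteredStep.expConst_pos : 0 < expConst L φ := by
  have := hν.idleConst_pos
  have := hν.bound_pos
  exact div_pos (by positivity) (by linarith [hν.one_lt])

lemma IsCenteredStep.expConst_mul :
    expConst L φ * (φ - 1) = L + 2 + idleConst L φ * Real.exp (L / 2) :=
  div_mul_cancel₀ _ (by linarith [hν.one_lt])

lemma IsCenteredStep.linConst_pos : 0 < linConst L φ :=
  mul_pos hν.expConst_pos (Real.exp_pos _)

lemma IsCenteredStep.expConst_mul_le {o : ℝ} (ho : 0 ≤ o) (hoL : o ≤ L) :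
    expConst L φ * (Real.exp (o / 2) - 1) ≤ linConst L φ * o := by
  have h := mul_le_mul_of_nonneg_left (exp_half_sub_one_le ho hoL) hν.expConst_pos.le
  unfold linConst
  linarith

end Consts

/-! ### Exploring the side of the bottom -/

/-- A state of the exploration of the side of the bottom: the time, the position, its running
minimum and maximum, the sum of `exp (-position)` over the past, and whether the other side has a
wall that is adequate for the last record minimum. -/
structure NearState where
  time : ℕ
  pos : ℝ
  low : ℝ
  high : ℝ
  weight : ℝ
  active : Prop

/-- One step of the exploration of the side of the bottom; `l` is the path on the other side. -/
noncomputable def nearStep (Γ g : ℝ) (l : ℕ → ℝ) (z : NearState) (e : ℝ) : NearState where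
  time := z.time + 1
  pos := z.pos + e
  low := min z.low (z.pos + e)
  high := max z.high (z.pos + e)
  weight := z.weight + Real.exp (-z.pos)
  active := (z.low ≤ z.pos + e ∧ z.active) ∨
    (z.pos + e < z.low ∧ HasWall Γ g l (z.pos + e) (max z.high (z.pos + e)) (z.time + 1))

/-- The exploration stops when the path has climbed by `Γ` from a record minimum for which there is
an adequate wall. -/
def nearStop (Γ : ℝ) (z : NearState) : Prop := z.active ∧ z.low + Γ ≤ z.pos

/-- The reward `∑ exp (-(S_j - S_m))` over the explored sites, for the bottom `m`. -/
noncomputable def nearPay (z : NearState) : ℝ≥0∞ := ENNReal.ofReal (z.weight * Real.exp z.low)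

/-- The start of the exploration of the side of the bottom. -/
def nearStart (Γ g : ℝ) (l : ℕ → ℝ) : NearState := ⟨0, 0, 0, 0, 0, HasWall Γ g l 0 0 0⟩

/-- The supremum of `exp (s / 2)` over the heights `s` of the bottoms that have an adequate wall,
when the pass has height `h`; it is `0` if there are none. -/
noncomputable def wallThreshold (Γ g : ℝ) (l : ℕ → ℝ) (h : ℝ) : ℝ :=
  sSup {y | ∃ s m, HasWall Γ g l s h m ∧ y = Real.exp (s / 2)}

section Threshold

variable {Γ g : ℝ} {l : ℕ → ℝ}

lemma wallThreshold_bddAbove (h : ℝ) :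
    BddAbove {y | ∃ s m, HasWall Γ g l s h m ∧ y = Real.exp (s / 2)} := by
  refine ⟨Real.exp (l 0 / 2), ?_⟩
  rintro y ⟨s, m, ⟨k, hk, -⟩, rfl⟩
  have := (hk 0 (Nat.zero_le _)).1
  exact Real.exp_le_exp.2 (by linarith)

lemma wallThreshold_nonneg (h : ℝ) : 0 ≤ wallThreshold Γ g l h := by
  refine Real.sSup_nonneg ?_
  rintro y ⟨s, m, -, rfl⟩
  positivity

lemma exp_le_wallThreshold {s h : ℝ} {m : ℕ} (hw : HasWall Γ g l s h m) :
    Real.exp (s / 2) ≤ wallThreshold Γ g l h :=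
  le_csSup (wallThreshold_bddAbove h) ⟨s, m, hw, rfl⟩

lemma wallThreshold_antitone {h h' : ℝ} (hh : h ≤ h') :
    wallThreshold Γ g l h' ≤ wallThreshold Γ g l h := by
  refine Real.sSup_le ?_ (wallThreshold_nonneg h)
  rintro y ⟨s, m, ⟨k, hk1, hk2⟩, rfl⟩
  exact exp_le_wallThreshold (m := m) ⟨k, hk1, le_trans (max_le_max le_rfl (by linarith)) hk2⟩

lemma wallThreshold_le {s h : ℝ} {m : ℕ} (hw : ¬ HasWall Γ g l s h m) :
    wallThreshold Γ g l h ≤ Real.exp (s / 2) := by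
  refine Real.sSup_le ?_ (Real.exp_pos _).le
  rintro y ⟨s', m', ⟨k, hk1, hk2⟩, rfl⟩
  refine Real.exp_le_exp.2 ?_
  by_contra hcon
  refine hw ⟨k, fun i hi => ?_, le_trans (max_le_max (by linarith) le_rfl) hk2⟩
  have := (hk1 i hi).1
  exact ⟨by linarith, fun _ => by linarith⟩

end Threshold

/-- The invariant of the exploration of the side of the bottom. -/
structure NearInv (Γ g L : ℝ) (l : ℕ → ℝ) (z : NearState) : Prop where
  weight_nonneg : 0 ≤ z.weight
  low_le : z.low ≤ z.pos
  le_high : z.pos ≤ z.high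
  le_top : z.active → z.pos - z.low ≤ Γ + L
  threshold_le : ¬ z.active → wallThreshold Γ g l z.high ≤ Real.exp (z.low / 2)

open Classical in
/-- A bound for the future discount: the mean of `exp (S_m)` over the bottoms `m` at which the
exploration can halt. -/
noncomputable def nearDiscount (Γ g L : ℝ) (l : ℕ → ℝ) (z : NearState) : ℝ :=
  if z.active then Real.exp z.low * (z.pos - z.low + L + 1)
  else wallThreshold Γ g l z.high ^ 2 * (L + 1)

open Classical in
/-- A bound for the weight which is still to be collected. -/
noncomputable def nearFuture (Γ g L φ : ℝ) (l : ℕ → ℝ) (z : NearState) : ℝ :=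
  if z.active then linConst L φ * (Γ + L - (z.pos - z.low)) +
    expConst L φ * (1 - Real.exp (-(z.pos - z.low) / 2))
  else linConst L φ * (Γ + L) + idleConst L φ - idleExpConst L φ *
    (wallThreshold Γ g l z.high * (Real.exp (-z.pos / 2) - Real.exp (-z.high / 2)))

/-- The supermartingale of the exploration of the side of the bottom. -/
noncomputable def nearPotential (Γ g L φ : ℝ) (l : ℕ → ℝ) (z : NearState) : ℝ :=
  (z.weight * nearDiscount Γ g L l z + nearFuture Γ g L φ l z) / (Γ + L + 1) + 1

section Near

variable {ν : Measure ℝ} {L φ : ℝ} (hν : IsCenteredStep ν L φ) {Γ g : ℝ} (hΓ : 0 < Γ)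
  {l : ℕ → ℝ}
include hν hΓ

lemma NearInv.step {z : NearState} (hz : NearInv Γ g L l z) (hs : ¬ nearStop Γ z) {e : ℝ}
    (he : |e| ≤ L) : NearInv Γ g L l (nearStep Γ g l z e) where
  weight_nonneg := add_nonneg hz.weight_nonneg (Real.exp_pos _).le
  low_le := min_le_right _ _
  le_high := le_max_right _ _
  le_top := by
    have hL := hν.bound_pos
    have he2 := (abs_le.1 he).2
    rintro (⟨h1, h2⟩ | ⟨h1, h2⟩)
    · simp only [nearStep, min_eq_left h1]
      have : ¬ (z.low + Γ ≤ z.pos) := fun h => hs ⟨h2, h⟩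
      linarith
    · simp only [nearStep, min_eq_right h1.le]
      linarith
  threshold_le := by
    intro h
    simp only [nearStep, not_or, not_and] at h ⊢
    rcases le_or_gt z.low (z.pos + e) with h1 | h1
    · rw [min_eq_left h1]
      exact (wallThreshold_antitone (le_max_left _ _)).trans (hz.threshold_le (h.1 h1))
    · rw [min_eq_right h1.le]
      exact wallThreshold_le (h.2 h1)

omit hν hΓ in
lemma NearInv.threshold_mul_le {z : NearState} (hz : NearInv Γ g L l z) (hs : ¬ z.active) :
    wallThreshold Γ g l z.high * Real.exp (-z.pos / 2) ≤ 1 := by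
  have h1 : wallThreshold Γ g l z.high ≤ Real.exp (z.pos / 2) :=
    (hz.threshold_le hs).trans (Real.exp_le_exp.2 (by linarith [hz.low_le]))
  calc _ ≤ Real.exp (z.pos / 2) * Real.exp (-z.pos / 2) := by gcongr
    _ = 1 := by rw [← Real.exp_add]; ring_nf; simp

lemma NearInv.nearFuture_nonneg {z : NearState} (hz : NearInv Γ g L l z) :
    0 ≤ nearFuture Γ g L φ l z := by
  have hD := hν.linConst_pos
  have hB := hν.expConst_pos
  have hB' := hν.idleExpConst_pos
  unfold nearFuture
  split_ifs with h
  · have h1 := hz.le_top h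
    have h2 : Real.exp (-(z.pos - z.low) / 2) ≤ 1 :=
      Real.exp_le_one_iff.2 (by linarith [hz.low_le])
    have := mul_nonneg hD.le (sub_nonneg.2 h1)
    have := mul_nonneg hB.le (sub_nonneg.2 h2)
    linarith
  · have h1 := hz.threshold_mul_le h
    have hL := hν.bound_pos
    have h2 : idleExpConst L φ ≤ idleConst L φ := by
      unfold idleConst
      exact le_mul_of_one_le_right hB'.le (Real.one_le_exp (by linarith))
    have h3 : idleExpConst L φ * (wallThreshold Γ g l z.high *
        (Real.exp (-z.pos / 2) - Real.exp (-z.high / 2))) ≤ idleExpConst L φ * 1 := by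
      refine mul_le_mul_of_nonneg_left ?_ hB'.le
      have := mul_nonneg (wallThreshold_nonneg (Γ := Γ) (g := g) (l := l) z.high)
        (Real.exp_pos (-z.high / 2)).le
      linarith
    have : 0 ≤ linConst L φ * (Γ + L) := by positivity
    linarith

omit hΓ in
lemma NearInv.nearDiscount_nonneg {z : NearState} (hz : NearInv Γ g L l z) :
    0 ≤ nearDiscount Γ g L l z := by
  have hL := hν.bound_pos
  have h := hz.low_le
  unfold nearDiscount
  split_ifs
  · have : 0 ≤ z.pos - z.low + L + 1 := by linarith
    positivity
  · positivity

lemma NearInv.nearPotential_nonneg {z : NearState} (hz : NearInv Γ g L l z) :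
    0 ≤ nearPotential Γ g L φ l z := by
  have hL := hν.bound_pos
  have h1 := hz.nearFuture_nonneg hν hΓ
  have h2 := mul_nonneg hz.weight_nonneg (hz.nearDiscount_nonneg hν)
  unfold nearPotential
  positivity

lemma NearInv.nearPay_le {z : NearState} (hz : NearInv Γ g L l z) (hs : nearStop Γ z) :
    nearPay z ≤ ENNReal.ofReal (nearPotential Γ g L φ l z) := by
  have hL := hν.bound_pos
  refine ENNReal.ofReal_le_ofReal ?_
  have h1 := hz.nearFuture_nonneg hν hΓ
  have hG : 0 < Γ + L + 1 := by linarith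
  have h3 : Real.exp z.low * (Γ + L + 1) ≤ nearDiscount Γ g L l z := by
    rw [nearDiscount, if_pos hs.1]
    have := hs.2
    gcongr
    linarith
  have h4 := mul_le_mul_of_nonneg_left h3 hz.weight_nonneg
  have h5 : z.weight * Real.exp z.low ≤
      (z.weight * nearDiscount Γ g L l z + nearFuture Γ g L φ l z) / (Γ + L + 1) := by
    rw [le_div_iff₀ hG]; linarith
  unfold nearPotential
  linarith

/-- The supermartingale inequality while the last record minimum has an adequate wall. -/
lemma NearInv.drift_of_active {z : NearState} (hz : NearInv Γ g L l z) (ha : z.active) :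
    ∃ p q b : ℝ, p - b * φ ≤ nearPotential Γ g L φ l z ∧
      ∀ e, |e| ≤ L → nearPotential Γ g L φ l (nearStep Γ g l z e) ≤
        p + q * e - b * Real.exp (-e / 2) := by
  classical
  have hL := hν.bound_pos
  have hD := hν.linConst_pos
  have hB := hν.expConst_pos
  have hB' := hν.idleExpConst_pos
  have hA := hν.idleConst_pos
  have hG : 0 < Γ + L + 1 := by linarith
  have hlow := hz.low_le
  set u := z.pos - z.low with hu
  have hu0 : 0 ≤ u := by linarith
  set W := z.weight + Real.exp (-z.pos) with hW
  have hW0 : 0 ≤ W := add_nonneg hz.weight_nonneg (Real.exp_pos _).le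
  set a : ℝ := if u ≤ L then idleConst L φ else 0 with ha'
  have ha0 : 0 ≤ a := by rw [ha']; split_ifs <;> linarith
  set G := Γ + L + 1 with hGdef
  refine ⟨(W * (Real.exp z.low * (u + L + 1)) + linConst L φ * (Γ + L - u) + expConst L φ + a) / G
      + 1, (W * Real.exp z.low - linConst L φ) / G, expConst L φ * Real.exp (-u / 2) / G, ?_, ?_⟩
  · have h1 := exp_neg_mul_linear_le hL.le hu0
    have h2 : a ≤ idleConst L φ * Real.exp (L / 2) * Real.exp (-u / 2) := by
      rw [ha']
      split_ifs with h
      · rw [mul_assoc, ← Real.exp_add]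
        exact le_mul_of_one_le_right hA.le (Real.one_le_exp (by linarith))
      · positivity
    have h3 : Real.exp (-z.pos) * Real.exp z.low = Real.exp (-u) := by
      rw [← Real.exp_add]; congr 1; rw [hu]; ring
    have h4 := hν.expConst_mul
    have h5 : Real.exp (-u) * (u + L + 1) + a ≤
        expConst L φ * (φ - 1) * Real.exp (-u / 2) := by
      rw [h4]; linarith
    rw [nearPotential, nearDiscount, nearFuture, if_pos ha, if_pos ha, ← hu, ← hGdef]
    have h6 : (W * (Real.exp z.low * (u + L + 1)) + linConst L φ * (Γ + L - u) + expConst L φ + a)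
        - expConst L φ * Real.exp (-u / 2) * φ ≤
        z.weight * (Real.exp z.low * (u + L + 1)) + (linConst L φ * (Γ + L - u) +
          expConst L φ * (1 - Real.exp (-u / 2))) := by
      have : W * (Real.exp z.low * (u + L + 1)) = z.weight * (Real.exp z.low * (u + L + 1)) +
          Real.exp (-u) * (u + L + 1) := by
        rw [hW, ← h3]; ring
      rw [this]
      linarith
    calc _ = ((W * (Real.exp z.low * (u + L + 1)) + linConst L φ * (Γ + L - u) + expConst L φ + a)
        - expConst L φ * Real.exp (-u / 2) * φ) / G + 1 := by ring
      _ ≤ _ := by gcongr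
  · intro e he
    have hexp : Real.exp (-(u + e) / 2) = Real.exp (-u / 2) * Real.exp (-e / 2) := by
      rw [← Real.exp_add]; congr 1; ring
    -- It suffices to bound the two parts of the potential after the step.
    suffices h : nearDiscount Γ g L l (nearStep Γ g l z e) ≤ Real.exp z.low * (u + e + L + 1) ∧
        nearFuture Γ g L φ l (nearStep Γ g l z e) ≤ linConst L φ * (Γ + L - (u + e)) +
          expConst L φ * (1 - Real.exp (-(u + e) / 2)) + a by
      have h7 : nearPotential Γ g L φ l (nearStep Γ g l z e) ≤
          (W * (Real.exp z.low * (u + e + L + 1)) + (linConst L φ * (Γ + L - (u + e)) +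
          expConst L φ * (1 - Real.exp (-(u + e) / 2)) + a)) / G + 1 := by
        rw [nearPotential]
        have hw : (nearStep Γ g l z e).weight = W := rfl
        rw [hw]
        gcongr
        · exact h.1
        · exact h.2
      refine h7.trans (le_of_eq ?_)
      rw [hexp]; ring
    rcases le_or_gt z.low (z.pos + e) with h1 | h1
    · have hact : (nearStep Γ g l z e).active := Or.inl ⟨h1, ha⟩
      rw [nearDiscount, nearFuture, if_pos hact, if_pos hact]
      have hp : (nearStep Γ g l z e).pos - (nearStep Γ g l z e).low = u + e := by
        simp only [nearStep, min_eq_left h1, hu]; ring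
      have hl : (nearStep Γ g l z e).low = z.low := min_eq_left h1
      rw [hp, hl]
      exact ⟨le_rfl, by linarith⟩
    · set o := z.low - (z.pos + e) with ho
      have ho0 : 0 ≤ o := by linarith
      have he1 := (abs_le.1 he).1
      have hoL : o ≤ L := by linarith
      have haL : a = idleConst L φ := by
        rw [ha', if_pos]; linarith
      have hue : u + e = -o := by rw [hu, ho]; ring
      have hl : (nearStep Γ g l z e).low = z.pos + e := min_eq_right h1.le
      have hpos : (nearStep Γ g l z e).pos = z.pos + e := rfl
      have h8 : Real.exp (z.pos + e) * (L + 1) ≤ Real.exp z.low * (u + e + L + 1) := by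
        have h9 := exp_neg_mul_le ho0 hoL le_rfl
        have h10 : Real.exp (z.pos + e) = Real.exp z.low * Real.exp (-o) := by
          rw [← Real.exp_add]; congr 1; rw [ho]; ring
        rw [h10, mul_assoc, hue]
        refine mul_le_mul_of_nonneg_left ?_ (Real.exp_pos _).le
        calc _ = Real.exp (-o) * (o - o + L + 1) := by ring
          _ ≤ _ := h9
          _ = _ := by ring
      have h11 : linConst L φ * (Γ + L) ≤ linConst L φ * (Γ + L - (u + e)) +
          expConst L φ * (1 - Real.exp (-(u + e) / 2)) := by
        have h12 := hν.expConst_mul_le ho0 hoL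
        have h13 : -(u + e) / 2 = o / 2 := by rw [hue]; ring
        rw [h13, hue]
        linarith
      by_cases hact : (nearStep Γ g l z e).active
      · rw [nearDiscount, nearFuture, if_pos hact, if_pos hact, hl, hpos]
        simp only [sub_self, zero_add, sub_zero, neg_zero, zero_div, Real.exp_zero, mul_zero,
          add_zero]
        exact ⟨h8, by linarith⟩
      · rw [nearDiscount, nearFuture, if_neg hact, if_neg hact]
        have hinv : wallThreshold Γ g l (nearStep Γ g l z e).high ≤ Real.exp ((z.pos + e) / 2) := by
          have hw : ¬ HasWall Γ g l (z.pos + e) (max z.high (z.pos + e)) (z.time + 1) :=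
            fun h => hact (Or.inr ⟨h1, h⟩)
          exact wallThreshold_le hw
        have ht0 := wallThreshold_nonneg (Γ := Γ) (g := g) (l := l) (nearStep Γ g l z e).high
        refine ⟨le_trans ?_ h8, ?_⟩
        · refine mul_le_mul_of_nonneg_right ?_ (by linarith)
          calc _ ≤ Real.exp ((z.pos + e) / 2) ^ 2 := by gcongr
            _ = _ := by rw [← Real.exp_nat_mul]; congr 1; push_cast; ring
        · have h14 : Real.exp (-(nearStep Γ g l z e).high / 2) ≤
              Real.exp (-(nearStep Γ g l z e).pos / 2) := by
            refine Real.exp_le_exp.2 ?_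
            have : (nearStep Γ g l z e).pos ≤ (nearStep Γ g l z e).high := le_max_right _ _
            linarith
          have := mul_nonneg hB'.le (mul_nonneg ht0 (sub_nonneg.2 h14))
          linarith

/-- The supermartingale inequality while the last record minimum has no adequate wall. -/
lemma NearInv.drift_of_not_active {z : NearState} (hz : NearInv Γ g L l z) (ha : ¬ z.active) :
    ∃ p q b : ℝ, p - b * φ ≤ nearPotential Γ g L φ l z ∧
      ∀ e, |e| ≤ L → nearPotential Γ g L φ l (nearStep Γ g l z e) ≤
        p + q * e - b * Real.exp (-e / 2) := by
  classical
  have hL := hν.bound_pos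
  have hB' := hν.idleExpConst_pos
  have hA := hν.idleConst_pos
  have hG : 0 < Γ + L + 1 := by linarith
  set W := z.weight + Real.exp (-z.pos) with hW
  have hW0 : 0 ≤ W := add_nonneg hz.weight_nonneg (Real.exp_pos _).le
  set G := Γ + L + 1 with hGdef
  set Y := wallThreshold Γ g l z.high with hY
  have hY0 : 0 ≤ Y := wallThreshold_nonneg _
  have hYs : Y * Real.exp (-z.pos / 2) ≤ 1 := hz.threshold_mul_le ha
  refine ⟨(W * (Y ^ 2 * (L + 1)) + linConst L φ * (Γ + L) + idleConst L φ +
      idleExpConst L φ * (Y * Real.exp (-z.high / 2))) / G + 1, 0,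
      idleExpConst L φ * (Y * Real.exp (-z.pos / 2)) / G, ?_, ?_⟩
  · rw [nearPotential, nearDiscount, nearFuture, if_neg ha, if_neg ha, ← hY, ← hGdef]
    set t := Y * Real.exp (-z.pos / 2) with ht
    have ht0 : 0 ≤ t := by positivity
    have h1 : Real.exp (-z.pos) * Y ^ 2 = t ^ 2 := by
      rw [ht, mul_pow, ← Real.exp_nat_mul, mul_comm]
      congr 2; push_cast; ring
    have h2 : t ^ 2 * (L + 1) ≤ (L + 2) * t := by
      nlinarith [mul_nonneg (mul_nonneg ht0 (sub_nonneg.2 hYs)) (by linarith : 0 ≤ L + 1)]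
    have h3 := hν.idleExpConst_mul
    have h4 : (W * (Y ^ 2 * (L + 1)) + linConst L φ * (Γ + L) + idleConst L φ +
        idleExpConst L φ * (Y * Real.exp (-z.high / 2))) - idleExpConst L φ * t * φ ≤
        z.weight * (Y ^ 2 * (L + 1)) + (linConst L φ * (Γ + L) + idleConst L φ -
          idleExpConst L φ * (Y * (Real.exp (-z.pos / 2) - Real.exp (-z.high / 2)))) := by
      have h5 : W * (Y ^ 2 * (L + 1)) = z.weight * (Y ^ 2 * (L + 1)) + t ^ 2 * (L + 1) := by
        rw [hW, ← h1]; ring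
      have h6 : Y * (Real.exp (-z.pos / 2) - Real.exp (-z.high / 2)) =
          t - Y * Real.exp (-z.high / 2) := by rw [ht]; ring
      have h7 : idleExpConst L φ * t * φ = (L + 2) * t + idleExpConst L φ * t := by
        rw [← h3]; ring
      rw [h5, h6, h7]
      linarith
    calc _ = ((W * (Y ^ 2 * (L + 1)) + linConst L φ * (Γ + L) + idleConst L φ +
        idleExpConst L φ * (Y * Real.exp (-z.high / 2))) - idleExpConst L φ * t * φ) / G + 1 := by
          ring
      _ ≤ _ := by gcongr
  · intro e he
    have hexp : Real.exp (-(z.pos + e) / 2) = Real.exp (-z.pos / 2) * Real.exp (-e / 2) := by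
      rw [← Real.exp_add]; congr 1; ring
    suffices h : nearDiscount Γ g L l (nearStep Γ g l z e) ≤ Y ^ 2 * (L + 1) ∧
        nearFuture Γ g L φ l (nearStep Γ g l z e) ≤ linConst L φ * (Γ + L) + idleConst L φ -
          idleExpConst L φ * (Y * (Real.exp (-(z.pos + e) / 2) - Real.exp (-z.high / 2))) by
      have h7 : nearPotential Γ g L φ l (nearStep Γ g l z e) ≤
          (W * (Y ^ 2 * (L + 1)) + (linConst L φ * (Γ + L) + idleConst L φ -
          idleExpConst L φ * (Y * (Real.exp (-(z.pos + e) / 2) - Real.exp (-z.high / 2))))) / G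
          + 1 := by
        rw [nearPotential]
        have hw : (nearStep Γ g l z e).weight = W := rfl
        rw [hw]
        gcongr
        · exact h.1
        · exact h.2
      refine h7.trans (le_of_eq ?_)
      rw [hexp]; ring
    have hhigh : (nearStep Γ g l z e).high = max z.high (z.pos + e) := rfl
    have hpos : (nearStep Γ g l z e).pos = z.pos + e := rfl
    by_cases hact : (nearStep Γ g l z e).active
    · obtain ⟨-, h2⟩ | ⟨h1, hw⟩ := hact
      · exact absurd h2 ha
      have hh : max z.high (z.pos + e) = z.high :=
        max_eq_left (by linarith [hz.low_le, hz.le_high])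
      have hl : (nearStep Γ g l z e).low = z.pos + e := min_eq_right h1.le
      have hact : (nearStep Γ g l z e).active := Or.inr ⟨h1, hw⟩
      rw [hh] at hw
      have hthr := exp_le_wallThreshold hw
      rw [← hY] at hthr
      rw [nearDiscount, nearFuture, if_pos hact, if_pos hact, hl, hpos]
      simp only [sub_self, zero_add, sub_zero, neg_zero, zero_div, Real.exp_zero, mul_zero,
        add_zero]
      constructor
      · refine mul_le_mul_of_nonneg_right ?_ (by linarith)
        calc Real.exp (z.pos + e) = Real.exp ((z.pos + e) / 2) ^ 2 := by
              rw [← Real.exp_nat_mul]; congr 1; push_cast; ring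
          _ ≤ _ := by gcongr
      · -- The path overshoots the threshold by at most `L`.
        have h3 : Y * Real.exp (-(z.pos + e) / 2) ≤ Real.exp (L / 2) := by
          rw [hexp, ← mul_assoc]
          have h4 : Real.exp (-e / 2) ≤ Real.exp (L / 2) :=
            Real.exp_le_exp.2 (by linarith [(abs_le.1 he).1])
          calc _ ≤ 1 * Real.exp (L / 2) := by gcongr
            _ = _ := one_mul _
        have h5 : Y * (Real.exp (-(z.pos + e) / 2) - Real.exp (-z.high / 2)) ≤
            Real.exp (L / 2) := by
          have := mul_nonneg hY0 (Real.exp_pos (-z.high / 2)).le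
          linarith
        have h6 := mul_le_mul_of_nonneg_left h5 hB'.le
        rw [show idleConst L φ = idleExpConst L φ * Real.exp (L / 2) from rfl]
        linarith
    · rw [nearDiscount, nearFuture, if_neg hact, if_neg hact, hhigh, hpos]
      rcases le_or_gt (z.pos + e) z.high with h1 | h1
      · rw [max_eq_left h1]
        exact ⟨le_rfl, le_rfl⟩
      · rw [max_eq_right h1.le]
        have hanti : wallThreshold Γ g l (z.pos + e) ≤ Y := wallThreshold_antitone h1.le
        have hthr0 := wallThreshold_nonneg (Γ := Γ) (g := g) (l := l) (z.pos + e)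
        refine ⟨by gcongr, ?_⟩
        have h2 : Real.exp (-(z.pos + e) / 2) ≤ Real.exp (-z.high / 2) :=
          Real.exp_le_exp.2 (by linarith)
        have := mul_nonneg hB'.le (mul_nonneg hY0 (sub_nonneg.2 h2))
        rw [sub_self, mul_zero, mul_zero]
        linarith

/-- The mean reward on the side of the bottom is bounded uniformly in `Γ`, `g` and the path `l` on
the other side. -/
theorem lintegral_run_near_le [IsProbabilityMeasure ν] (N : ℕ) :
    ∫⁻ e, run (nearStop Γ) nearPay (nearStep Γ g l) N (nearStart Γ g l) e ∂(iidLaw ν) ≤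
      ENNReal.ofReal (linConst L φ + idleConst L φ + 1) := by
  classical
  have hL := hν.bound_pos
  have hinv : NearInv Γ g L l (nearStart Γ g l) :=
    { weight_nonneg := le_rfl
      low_le := le_rfl
      le_high := le_rfl
      le_top := fun _ => by simp only [nearStart, sub_self]; linarith
      threshold_le := fun h => by
        simp only [nearStart] at h ⊢
        exact wallThreshold_le h }
  refine (lintegral_run_le hν (nearStop Γ) nearPay (nearStep Γ g l) (NearInv Γ g L l)
    (nearPotential Γ g L φ l) (fun z hz => hz.nearPotential_nonneg hν hΓ)
    (fun z hz hs => hz.nearPay_le hν hΓ hs) (fun z hz hs => ⟨fun e he => hz.step hν hΓ hs he, ?_⟩)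
    N _ hinv).trans (ENNReal.ofReal_le_ofReal ?_)
  · by_cases ha : z.active
    · exact hz.drift_of_active hν hΓ ha
    · exact hz.drift_of_not_active hν hΓ ha
  · have hD := hν.linConst_pos
    have hA := hν.idleConst_pos
    have hG : 0 < Γ + L + 1 := by linarith
    have h1 : nearFuture Γ g L φ l (nearStart Γ g l) ≤
        (linConst L φ + idleConst L φ) * (Γ + L + 1) := by
      rw [nearFuture]
      have : 0 ≤ idleConst L φ * (Γ + L) := by positivity
      split_ifs <;> simp [nearStart] <;> nlinarith
    rw [nearPotential]
    have h2 : (nearStart Γ g l).weight = 0 := rfl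
    rw [h2, zero_mul, zero_add]
    gcongr
    rwa [div_le_iff₀ hG]

end Near

/-- The path with increments `e` that starts at `0`. -/
def partialSum (e : ℕ → ℝ) (k : ℕ) : ℝ := ∑ i ∈ Finset.range k, e i

lemma partialSum_succ (e : ℕ → ℝ) (k : ℕ) : partialSum e (k + 1) = partialSum e k + e k :=
  Finset.sum_range_succ _ _

lemma nearState_spec (Γ g : ℝ) (e l : ℕ → ℝ) (k : ℕ) :
    let z := stateAt (nearStep Γ g l) (nearStart Γ g l) e k
    let R := partialSum e
    z.time = k ∧ z.pos = R k ∧ z.high = runMax R k ∧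
      z.weight = ∑ j ∈ Finset.range k, Real.exp (-R j) ∧
      ∃ a ≤ k, z.low = R a ∧ (∀ i < a, R a < R i) ∧ (∀ i, a ≤ i → i ≤ k → R a ≤ R i) ∧
        (z.active ↔ HasWall Γ g l (R a) (runMax R a) a) := by
  intro z R
  induction k with
  | zero =>
    have hR0 : R 0 = 0 := by simp [R, partialSum]
    refine ⟨rfl, hR0.symm, hR0.symm, by simp [z, stateAt, nearStart], 0, le_rfl, hR0.symm,
      by simp, fun i _ hi => ?_, ?_⟩
    · obtain rfl : i = 0 := by omega
      exact le_rfl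
    · simp [z, stateAt, nearStart, runMax, hR0]
  | succ k ih =>
    obtain ⟨ht, hp, hh, hw, a, ha, hlow, hrec, hge, hact⟩ := ih
    set y := stateAt (nearStep Γ g l) (nearStart Γ g l) e k
    have hz : z = nearStep Γ g l y (e k) := rfl
    have hR : y.pos + e k = R (k + 1) := by rw [hp]; exact (partialSum_succ e k).symm
    have hmax : max y.high (y.pos + e k) = runMax R (k + 1) := by rw [hR, hh]; rfl
    refine ⟨?_, ?_, ?_, ?_, ?_⟩
    · rw [hz]; simp [nearStep, ht]
    · rw [hz]; exact hR
    · rw [hz]; exact hmax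
    · rw [hz, Finset.sum_range_succ, ← hw, ← hp]; rfl
    · rcases le_or_gt y.low (y.pos + e k) with h1 | h1
      · refine ⟨a, by omega, ?_, hrec, fun i hi hi' => ?_, ?_⟩
        · rw [hz, ← hlow]; exact min_eq_left h1
        · rcases Nat.lt_or_ge k i with h2 | h2
          · obtain rfl : i = k + 1 := by omega
            rwa [← hR, ← hlow]
          · exact hge i hi h2
        · rw [← hact, hz]
          simp [nearStep, h1]
      · refine ⟨k + 1, le_rfl, ?_, fun i hi => ?_, fun i hi hi' => ?_, ?_⟩
        · rw [hz, ← hR]; exact min_eq_right h1.le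
        · rw [hR, hlow] at h1
          rcases Nat.lt_or_ge i a with h2 | h2
          · exact h1.trans (hrec i h2)
          · exact h1.trans_le (hge i h2 (by omega))
        · obtain rfl : i = k + 1 := by omega
          exact le_rfl
        · rw [hz]
          simp only [nearStep, h1, not_le.2 h1, false_and, true_and, false_or]
          rw [hmax, hR, ht]

/-- On the side of its bottom, the first deep valley is found by the exploration. -/
lemma le_run_near {γ : ℝ} (hγ : 0 < γ) {n : ℕ} (hn : 3 < n) {S : ℤ → ℝ} {e : ℕ → ℝ}
    (hS : rightHalf S = partialSum e) {m M N : ℕ} (hm : IsFirstBottom γ n S m)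
    (hM : IsFirstRise (depthLevel γ n) (rightHalf S) m M) (hN : M < N) :
    ENNReal.ofReal (∑ j ∈ Finset.range M, Real.exp (-(S j - S m))) ≤
      run (nearStop (depthLevel γ n)) nearPay
        (nearStep (depthLevel γ n) (γ * logTwo n) (leftHalf S)) N
        (nearStart (depthLevel γ n) (γ * logTwo n) (leftHalf S)) e := by
  have hΓ : 0 < depthLevel γ n :=
    (mul_pos hγ (logTwo_pos hn)).trans (margin_lt_depthLevel hn γ)
  have hge := hm.1.le_of_isFirstRise hγ hn hM
  have hrecm := hm.1.record
  have hwall := hm.1.hasWall hn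
  have hspec := nearState_spec (depthLevel γ n) (γ * logTwo n) e (leftHalf S)
  rw [← hS] at hspec
  obtain ⟨-, hp, -, hw, a, ha, hlow, hrec, hge', hact⟩ := hspec M
  have ham : a = m := by
    rcases Nat.lt_trichotomy a m with h | h | h
    · exact absurd (hrecm a h) (not_lt.2 (hge' m h.le hM.1.le))
    · exact h
    · exact absurd (hrec m h) (not_lt.2 (hge a h.le ha))
  subst ham
  rw [run_eq_pay _ _ _ N M hN]
  · rw [nearPay, hw, hlow]
    refine ENNReal.ofReal_le_ofReal (le_of_eq ?_)
    rw [Finset.sum_mul]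
    refine Finset.sum_congr rfl fun j _ => ?_
    rw [← Real.exp_add]
    congr 1
    simp only [rightHalf]; ring
  · rintro k hk ⟨hact', hhalt⟩
    obtain ⟨-, hp, -, -, b, hb, hlow, hrec, hge', hact⟩ := hspec k
    rw [hlow, hp] at hhalt
    have hbk : b < k := by
      refine lt_of_le_of_ne hb ?_
      rintro rfl
      linarith
    have hdeep : HasDeepBottom γ n S b :=
      hasDeepBottom_of_hasWall hγ hn ⟨hrec, k, hbk, hhalt, hge'⟩ (hact.1 hact')
    rcases Nat.lt_trichotomy b a with h | h | h
    · exact hm.2 b h hdeep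
    · subst h
      exact absurd hhalt (not_le.2 (hM.2.2 k hbk hk))
    · exact absurd (hrec a h) (not_lt.2 (hge b h.le (by omega)))
  · refine ⟨hact.2 hwall, ?_⟩
    rw [hlow, hp]
    exact hM.2.1

/-! ### Exploring the side opposite to the bottom -/

/-- The height `s` of the explored path at time `k` is compatible with a bottom of the path `R` at
the distance `m` on the other side. -/
def IsAbove (R : ℕ → ℝ) (m k : ℕ) (s : ℝ) : Prop := R m ≤ s ∧ (k < m → R m < s)

/-- A state of the exploration of the side opposite to the bottom: the time, the position, the
sum of `exp (-position)` over the past, the first candidate for the bottom that has not been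
excluded, and whether there is one. -/
structure FarState where
  time : ℕ
  pos : ℝ
  weight : ℝ
  stage : ℕ
  alive : Prop

/-- The candidates for the bottom from `i` on which the position `s` at time `k` does not
exclude. -/
def candidates (Γ : ℝ) (R : ℕ → ℝ) (i k : ℕ) (s : ℝ) : Set ℕ :=
  {j | i ≤ j ∧ IsRise Γ R j ∧ IsAbove R j k s}

/-- One step of the exploration of the side opposite to the bottom; `R` is the path on the side of
the bottom. -/
noncomputable def farStep (Γ : ℝ) (R : ℕ → ℝ) (z : FarState) (e : ℝ) : FarState where
  time := z.time + 1
  pos := z.pos + e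
  weight := z.weight + Real.exp (-z.pos)
  stage := sInf (candidates Γ R z.stage (z.time + 1) (z.pos + e))
  alive := z.alive ∧ (candidates Γ R z.stage (z.time + 1) (z.pos + e)).Nonempty

/-- The exploration stops when the wall is adequate for the current candidate. -/
def farStop (Γ g : ℝ) (R : ℕ → ℝ) (z : FarState) : Prop :=
  z.alive ∧ wallLevel Γ g R z.stage ≤ z.pos

/-- The reward `∑ exp (-(S_j - S_m))` over the explored sites, for the bottom `m`. -/
noncomputable def farPay (R : ℕ → ℝ) (z : FarState) : ℝ≥0∞ :=
  ENNReal.ofReal (z.weight * Real.exp (R z.stage))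

/-- The start of the exploration of the side opposite to the bottom. -/
noncomputable def farStart (Γ : ℝ) (R : ℕ → ℝ) : FarState :=
  ⟨0, 0, 0, sInf (candidates Γ R 0 0 0), (candidates Γ R 0 0 0).Nonempty⟩

/-- The depth of the wall that the candidate `m` needs. -/
noncomputable def wallDepth (Γ g : ℝ) (R : ℕ → ℝ) (m : ℕ) : ℝ := wallLevel Γ g R m - R m

lemma le_wallDepth (Γ g : ℝ) (R : ℕ → ℝ) (m : ℕ) : Γ ≤ wallDepth Γ g R m := by
  have := le_max_left (R m + Γ) (runMax R m + g)
  unfold wallDepth wallLevel; linarith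

/-- Later candidates need deeper walls, hence have a smaller chance of success. -/
lemma wallDepth_mono {Γ : ℝ} (g : ℝ) {R : ℕ → ℝ} {i j : ℕ} (hij : i < j) (hj : IsRise Γ R j) :
    wallDepth Γ g R i ≤ wallDepth Γ g R j := by
  have h1 := hj.1 i hij
  have h2 := runMax_mono R hij.le
  unfold wallDepth wallLevel
  rw [← max_sub_sub_right, ← max_sub_sub_right]
  refine max_le_max ?_ ?_ <;> linarith

/-- The invariant of the exploration of the side opposite to the bottom. -/
structure FarInv (Γ g L : ℝ) (R : ℕ → ℝ) (z : FarState) : Prop where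
  weight_nonneg : 0 ≤ z.weight
  isRise : z.alive → IsRise Γ R z.stage
  le_pos : z.alive → R z.stage ≤ z.pos
  pos_le : z.alive → z.pos ≤ wallLevel Γ g R z.stage + L

open Classical in
/-- The supermartingale of the exploration of the side opposite to the bottom. -/
noncomputable def farPotential (Γ g L φ : ℝ) (R : ℕ → ℝ) (z : FarState) : ℝ :=
  (if z.alive then
    (z.weight * (Real.exp (R z.stage) * (z.pos - R z.stage + L + 1)) +
      (-(linConst L φ * (z.pos - R z.stage)) +
        expConst L φ * (1 - Real.exp (-(z.pos - R z.stage) / 2)))) /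
      (wallDepth Γ g R z.stage + L + 1) + linConst L φ
  else 0) + 1

section Far

variable {ν : Measure ℝ} {L φ : ℝ} (hν : IsCenteredStep ν L φ) {Γ g : ℝ} (hΓ : 0 < Γ)
  (hg : 0 ≤ g) {R : ℕ → ℝ}

include hg in
lemma FarInv.step {z : FarState} (hz : FarInv Γ g L R z) (hs : ¬ farStop Γ g R z) {e : ℝ}
    (he : |e| ≤ L) : FarInv Γ g L R (farStep Γ R z e) where
  weight_nonneg := add_nonneg hz.weight_nonneg (Real.exp_pos _).le
  isRise := fun h => (Nat.sInf_mem h.2).2.1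
  le_pos := fun h => (Nat.sInf_mem h.2).2.2.1
  pos_le := by
    intro h
    have hmem := Nat.sInf_mem h.2
    have hhalt : z.pos < wallLevel Γ g R z.stage := not_le.1 fun h' => hs ⟨h.1, h'⟩
    have he2 := (abs_le.1 he).2
    change z.pos + e ≤ wallLevel Γ g R (sInf (candidates Γ R z.stage (z.time + 1) (z.pos + e))) + L
    set j := sInf (candidates Γ R z.stage (z.time + 1) (z.pos + e)) with hj
    rcases Nat.eq_or_lt_of_le hmem.1 with h1 | h1
    · rw [← h1]; linarith
    · have h2 : ¬ IsAbove R z.stage (z.time + 1) (z.pos + e) := fun h' =>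
        absurd (Nat.sInf_le (show z.stage ∈ candidates Γ R z.stage (z.time + 1) (z.pos + e) from
          ⟨le_rfl, hz.isRise h.1, h'⟩)) (not_le.2 h1)
      have h3 : z.pos + e ≤ R z.stage := by
        by_contra hcon
        exact h2 ⟨(not_le.1 hcon).le, fun _ => not_le.1 hcon⟩
      have h4 := le_runMax R h1.le
      have h5 : runMax R j + g ≤ wallLevel Γ g R j := le_max_right _ _
      have hL : 0 ≤ L := (abs_nonneg e).trans he
      linarith

include hν

lemma farFuture_le {t : ℝ} (ht : 0 ≤ t) :
    -(linConst L φ * t) + expConst L φ * (1 - Real.exp (-t / 2)) ≤ 0 := by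
  have hB := hν.expConst_pos
  have hL := hν.bound_pos
  have h1 := Real.add_one_le_exp (-t / 2)
  have h2 : expConst L φ ≤ linConst L φ :=
    le_mul_of_one_le_right hB.le (Real.one_le_exp (by linarith))
  have h3 : expConst L φ * (1 - Real.exp (-t / 2)) ≤ expConst L φ * t :=
    mul_le_mul_of_nonneg_left (by linarith) hB.le
  nlinarith

include hΓ

lemma FarInv.farPotential_nonneg {z : FarState} (hz : FarInv Γ g L R z) :
    0 ≤ farPotential Γ g L φ R z := by
  have hL := hν.bound_pos
  have hD := hν.linConst_pos
  have hB := hν.expConst_pos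
  unfold farPotential
  split_ifs with h
  · have h1 := hz.le_pos h
    have h2 := hz.pos_le h
    have h3 := le_wallDepth Γ g R z.stage
    have hG : 0 < wallDepth Γ g R z.stage + L + 1 := by linarith
    have h4 : z.pos - R z.stage ≤ wallDepth Γ g R z.stage + L + 1 := by
      unfold wallDepth; linarith
    have h5 : -linConst L φ ≤ (z.weight * (Real.exp (R z.stage) * (z.pos - R z.stage + L + 1)) +
      (-(linConst L φ * (z.pos - R z.stage)) +
        expConst L φ * (1 - Real.exp (-(z.pos - R z.stage) / 2)))) /
      (wallDepth Γ g R z.stage + L + 1) := by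
      rw [le_div_iff₀ hG]
      have h6 : Real.exp (-(z.pos - R z.stage) / 2) ≤ 1 := Real.exp_le_one_iff.2 (by linarith)
      have h7 := mul_nonneg hB.le (sub_nonneg.2 h6)
      have h8 := mul_le_mul_of_nonneg_left h4 hD.le
      have h9 : 0 ≤ z.weight * (Real.exp (R z.stage) * (z.pos - R z.stage + L + 1)) :=
        mul_nonneg hz.weight_nonneg (mul_nonneg (Real.exp_pos _).le (by linarith))
      linarith
    linarith
  · norm_num

lemma FarInv.farPay_le {z : FarState} (hz : FarInv Γ g L R z) (hs : farStop Γ g R z) :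
    farPay R z ≤ ENNReal.ofReal (farPotential Γ g L φ R z) := by
  have hL := hν.bound_pos
  have hD := hν.linConst_pos
  have hB := hν.expConst_pos
  refine ENNReal.ofReal_le_ofReal ?_
  obtain ⟨h, hhalt⟩ := hs
  have h1 := hz.le_pos h
  have h2 := hz.pos_le h
  have h3 := le_wallDepth Γ g R z.stage
  have hG : 0 < wallDepth Γ g R z.stage + L + 1 := by linarith
  have h4 : z.pos - R z.stage ≤ wallDepth Γ g R z.stage + L + 1 := by
    unfold wallDepth; linarith
  rw [farPotential, if_pos h]
  have h5 : z.weight * Real.exp (R z.stage) - linConst L φ ≤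
      (z.weight * (Real.exp (R z.stage) * (z.pos - R z.stage + L + 1)) +
      (-(linConst L φ * (z.pos - R z.stage)) +
        expConst L φ * (1 - Real.exp (-(z.pos - R z.stage) / 2)))) /
      (wallDepth Γ g R z.stage + L + 1) := by
    rw [le_div_iff₀ hG]
    have h6 : Real.exp (-(z.pos - R z.stage) / 2) ≤ 1 := Real.exp_le_one_iff.2 (by linarith)
    have h7 := mul_nonneg hB.le (sub_nonneg.2 h6)
    have h8 := mul_le_mul_of_nonneg_left h4 hD.le
    have h9 : z.weight * Real.exp (R z.stage) * (wallDepth Γ g R z.stage + L + 1) ≤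
        z.weight * (Real.exp (R z.stage) * (z.pos - R z.stage + L + 1)) := by
      rw [← mul_assoc]
      refine mul_le_mul_of_nonneg_left ?_ (mul_nonneg hz.weight_nonneg (Real.exp_pos _).le)
      unfold wallDepth; linarith
    linarith
  linarith

/-- The supermartingale inequality while some candidate is left. -/
lemma FarInv.drift {z : FarState} (hz : FarInv Γ g L R z) (hs : ¬ farStop Γ g R z)
    (ha : z.alive) :
    ∃ p q b : ℝ, p - b * φ ≤ farPotential Γ g L φ R z ∧
      ∀ e, |e| ≤ L → farPotential Γ g L φ R (farStep Γ R z e) ≤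
        p + q * e - b * Real.exp (-e / 2) := by
  classical
  have hL := hν.bound_pos
  have hD := hν.linConst_pos
  have hB := hν.expConst_pos
  have hA := hν.idleConst_pos
  have hdepth := le_wallDepth Γ g R z.stage
  have hhalt : z.pos < wallLevel Γ g R z.stage := not_le.1 fun h' => hs ⟨ha, h'⟩
  have hr0 := sub_nonneg.2 (hz.le_pos ha)
  have hrK : z.pos - R z.stage ≤ wallDepth Γ g R z.stage := by unfold wallDepth; linarith
  set i := z.stage with hi
  set r := z.pos - R i with hr
  set G := wallDepth Γ g R i + L + 1 with hG'
  have hG : 0 < G := by linarith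
  set W := z.weight + Real.exp (-z.pos) with hW
  have hW0 : 0 ≤ W := add_nonneg hz.weight_nonneg (Real.exp_pos _).le
  refine ⟨(W * (Real.exp (R i) * (r + L + 1)) - linConst L φ * r + expConst L φ) / G +
    linConst L φ + 1, (W * Real.exp (R i) - linConst L φ) / G,
    expConst L φ * Real.exp (-r / 2) / G, ?_, ?_⟩
  · have h1 := exp_neg_mul_linear_le hL.le hr0
    have h3 : Real.exp (-z.pos) * Real.exp (R i) = Real.exp (-r) := by
      rw [← Real.exp_add]; congr 1; rw [hr]; ring
    have h4 : L + 2 ≤ expConst L φ * (φ - 1) := by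
      rw [hν.expConst_mul]
      have := mul_pos hA (Real.exp_pos (L / 2))
      linarith
    have h5 := mul_le_mul_of_nonneg_right h4 (Real.exp_pos (-r / 2)).le
    rw [farPotential, if_pos ha, ← hi, ← hr, ← hG']
    have h6 : (W * (Real.exp (R i) * (r + L + 1)) - linConst L φ * r + expConst L φ) -
        expConst L φ * Real.exp (-r / 2) * φ ≤ z.weight * (Real.exp (R i) * (r + L + 1)) +
        (-(linConst L φ * r) + expConst L φ * (1 - Real.exp (-r / 2))) := by
      have : W * (Real.exp (R i) * (r + L + 1)) = z.weight * (Real.exp (R i) * (r + L + 1)) +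
          Real.exp (-r) * (r + L + 1) := by
        rw [hW, ← h3]; ring
      rw [this]
      linarith
    calc _ = ((W * (Real.exp (R i) * (r + L + 1)) - linConst L φ * r + expConst L φ) -
        expConst L φ * Real.exp (-r / 2) * φ) / G + linConst L φ + 1 := by ring
      _ ≤ _ := by gcongr
  · intro e he
    obtain ⟨he1, he2⟩ := abs_le.1 he
    have hexp : Real.exp (-(r + e) / 2) = Real.exp (-r / 2) * Real.exp (-e / 2) := by
      rw [← Real.exp_add]; congr 1; ring
    -- The value of the potential after the step, if the candidate is kept.
    suffices h : farPotential Γ g L φ R (farStep Γ R z e) ≤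
        (W * (Real.exp (R i) * (r + e + L + 1)) + (-(linConst L φ * (r + e)) +
          expConst L φ * (1 - Real.exp (-(r + e) / 2)))) / G + linConst L φ + 1 by
      refine h.trans (le_of_eq ?_)
      rw [hexp]; ring
    have hlinear : 0 ≤ W * (Real.exp (R i) * (r + e + L + 1)) :=
      mul_nonneg hW0 (mul_nonneg (Real.exp_pos _).le (by linarith))
    -- After an undershoot the future part is nonnegative, as `linConst` dominates `expConst`.
    have hunder : r + e ≤ 0 → 0 ≤ -(linConst L φ * (r + e)) +
        expConst L φ * (1 - Real.exp (-(r + e) / 2)) := by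
      intro hre
      have := hν.expConst_mul_le (o := -(r + e)) (by linarith) (by linarith)
      linarith
    by_cases hact : (farStep Γ R z e).alive
    · have hmem := Nat.sInf_mem hact.2
      rw [farPotential, if_pos hact]
      have hp : (farStep Γ R z e).pos = z.pos + e := rfl
      have hw : (farStep Γ R z e).weight = W := rfl
      have hst : (farStep Γ R z e).stage =
        sInf (candidates Γ R i (z.time + 1) (z.pos + e)) := rfl
      rw [hp, hw]
      rw [← hst] at hmem
      set j := (farStep Γ R z e).stage with hj
      rcases Nat.eq_or_lt_of_le hmem.1 with h1 | h1
      · rw [← h1, ← hG']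
        have : z.pos + e - R i = r + e := by rw [hr]; ring
        rw [this]
      · have h2 : ¬ IsAbove R i (z.time + 1) (z.pos + e) := fun h' => by
          have : i ∈ candidates Γ R i (z.time + 1) (z.pos + e) :=
            ⟨le_rfl, hz.isRise ha, h'⟩
          exact absurd (Nat.sInf_le this) (not_le.2 (by rwa [← hst]))
        have h3 : z.pos + e ≤ R i := by
          by_contra hcon
          exact h2 ⟨(not_le.1 hcon).le, fun _ => not_le.1 hcon⟩
        have h4 := hmem.2.1.1 i h1
        have h5 := hmem.2.2.1
        have h6 := wallDepth_mono g h1 hmem.2.1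
        have hre : r + e ≤ 0 := by linarith
        have hr' : 0 ≤ z.pos + e - R j := by linarith
        have h7 := farFuture_le hν hr'
        have h8 := hunder hre
        have h9 : Real.exp (R j) * (z.pos + e - R j + L + 1) ≤
            Real.exp (R i) * (r + e + L + 1) := by
          have h10 := exp_neg_mul_le (L := L) (o := -(r + e)) (d := R i - R j) (by linarith)
            (by linarith) (by linarith)
          have h11 : Real.exp (R j) = Real.exp (R i) * Real.exp (-(R i - R j)) := by
            rw [← Real.exp_add]; congr 1; ring
          rw [h11, mul_assoc]
          refine mul_le_mul_of_nonneg_left ?_ (Real.exp_pos _).le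
          have h12 : z.pos + e - R j + L + 1 = R i - R j - -(r + e) + L + 1 := by
            rw [hr]; ring
          rw [h12]
          linarith
        have hGj : G ≤ wallDepth Γ g R j + L + 1 := by linarith
        gcongr ?_ + _ + 1
        rw [div_le_div_iff₀ (by linarith) hG]
        have h13 : W * (Real.exp (R j) * (z.pos + e - R j + L + 1)) ≤
            W * (Real.exp (R i) * (r + e + L + 1)) := mul_le_mul_of_nonneg_left h9 hW0
        have h14 : 0 ≤ W * (Real.exp (R i) * (r + e + L + 1)) +
            (-(linConst L φ * (r + e)) + expConst L φ * (1 - Real.exp (-(r + e) / 2))) := by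
          linarith
        calc _ ≤ (W * (Real.exp (R i) * (r + e + L + 1)) +
            (-(linConst L φ * (r + e)) + expConst L φ * (1 - Real.exp (-(r + e) / 2)))) * G :=
              mul_le_mul_of_nonneg_right (by linarith) hG.le
          _ ≤ _ := mul_le_mul_of_nonneg_left hGj h14
    · rw [farPotential, if_neg hact, zero_add]
      suffices h : -linConst L φ ≤ (W * (Real.exp (R i) * (r + e + L + 1)) +
          (-(linConst L φ * (r + e)) + expConst L φ * (1 - Real.exp (-(r + e) / 2)))) / G by
        linarith
      rw [le_div_iff₀ hG]
      rcases le_or_gt (r + e) 0 with hre | hre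
      · have := hunder hre
        have := mul_pos hD hG
        linarith
      · have h6 : Real.exp (-(r + e) / 2) ≤ 1 := Real.exp_le_one_iff.2 (by linarith)
        have h7 := mul_nonneg hB.le (sub_nonneg.2 h6)
        have h8 : linConst L φ * (r + e) ≤ linConst L φ * G :=
          mul_le_mul_of_nonneg_left (by linarith) hD.le
        linarith

include hg

/-- The mean reward on the side opposite to the bottom is bounded uniformly in `Γ`, `g` and the path
`R` on the side of the bottom. -/
theorem lintegral_run_far_le [IsProbabilityMeasure ν] (hR0 : R 0 = 0) (N : ℕ) :
    ∫⁻ e, run (farStop Γ g R) (farPay R) (farStep Γ R) N (farStart Γ R) e ∂(iidLaw ν) ≤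
      ENNReal.ofReal (linConst L φ + 1) := by
  classical
  have hL := hν.bound_pos
  have hD := hν.linConst_pos
  have hinv : FarInv Γ g L R (farStart Γ R) :=
    { weight_nonneg := le_rfl
      isRise := fun h => (Nat.sInf_mem h).2.1
      le_pos := fun h => (Nat.sInf_mem h).2.2.1
      pos_le := fun h => by
        have h1 := le_runMax R (Nat.zero_le (farStart Γ R).stage)
        have h2 : runMax R (farStart Γ R).stage + g ≤ wallLevel Γ g R (farStart Γ R).stage :=
          le_max_right _ _
        have h3 : (farStart Γ R).pos = 0 := rfl
        linarith }
  refine (lintegral_run_le hν (farStop Γ g R) (farPay R) (farStep Γ R) (FarInv Γ g L R)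
    (farPotential Γ g L φ R) (fun z hz => hz.farPotential_nonneg hν hΓ)
    (fun z hz hs => hz.farPay_le hν hΓ hs) (fun z hz hs => ⟨fun e he => hz.step hg hs he, ?_⟩)
    N _ hinv).trans (ENNReal.ofReal_le_ofReal ?_)
  · by_cases ha : z.alive
    · exact hz.drift hν hΓ hs ha
    · refine ⟨1, 0, 0, ?_, fun e _ => ?_⟩
      · rw [farPotential, if_neg ha]; simp
      · have : ¬ (farStep Γ R z e).alive := fun h => ha h.1
        rw [farPotential, if_neg this]; simp
  · rw [farPotential]
    split_ifs with h
    · have h1 := farFuture_le hν (sub_nonneg.2 (hinv.le_pos h))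
      have hw : (farStart Γ R).weight = 0 := rfl
      have h3 := le_wallDepth Γ g R (farStart Γ R).stage
      rw [hw, zero_mul, zero_add]
      have := div_nonpos_of_nonpos_of_nonneg h1
        (show 0 ≤ wallDepth Γ g R (farStart Γ R).stage + L + 1 by linarith)
      linarith
    · linarith

end Far

lemma HasDeepBottom.isRise {γ : ℝ} (hγ : 0 < γ) {n : ℕ} (hn : 3 < n) {S : ℤ → ℝ} {m : ℕ}
    (h : HasDeepBottom γ n S m) : IsRise (depthLevel γ n) (rightHalf S) m := by
  refine ⟨h.record, ?_⟩
  obtain ⟨a, c, h⟩ := h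
  have ham := (h.lt_and_lt hγ hn).1
  have hmc := (h.lt_and_lt hγ hn).2
  have hd := h.depth_ge
  rw [depth, le_min_iff] at hd
  have hc : rightHalf S c.toNat = S c := by unfold rightHalf; congr 1; omega
  refine ⟨c.toNat, by omega, ?_, fun i hi hi' => ?_⟩
  · rw [hc, rightHalf]; linarith [hd.2]
  · exact h.isValley.bottom_min i ⟨by omega, by omega⟩

lemma wallLevel_mono {Γ g : ℝ} (hg : 0 ≤ g) {R : ℕ → ℝ} {i m : ℕ} (hi : IsRise Γ R i)
    (him : i < m) (hm : R m < R i) : wallLevel Γ g R i ≤ wallLevel Γ g R m := by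
  obtain ⟨c, hc1, hc2, hc3⟩ := hi.2
  have hcm : c < m := by
    by_contra hcon
    exact absurd (hc3 m him.le (not_lt.1 hcon)) (not_le.2 hm)
  have h1 := le_runMax R hcm.le
  have h2 := runMax_mono R him.le
  exact (max_le (by linarith) (by linarith)).trans (le_max_right _ _)

/-- On the side opposite to its bottom, the first deep valley is found by the exploration. -/
lemma le_run_far {γ : ℝ} (hγ : 0 < γ) {n : ℕ} (hn : 3 < n) {S : ℤ → ℝ} {e : ℕ → ℝ}
    (hS : leftHalf S = partialSum e) {m M N : ℕ} (hm : IsFirstBottom γ n S m)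
    (hM : IsFirstPassage (wallLevel (depthLevel γ n) (γ * logTwo n) (rightHalf S) m)
      (leftHalf S) M) (hN : M < N) :
    ENNReal.ofReal (∑ j ∈ Finset.range M, Real.exp (-(S (-j) - S m))) ≤
      run (farStop (depthLevel γ n) (γ * logTwo n) (rightHalf S)) (farPay (rightHalf S))
        (farStep (depthLevel γ n) (rightHalf S)) N
        (farStart (depthLevel γ n) (rightHalf S)) e := by
  have hg := mul_pos hγ (logTwo_pos hn)
  have hrise := hm.1.isRise hγ hn
  set R := rightHalf S with hR
  set Γ := depthLevel γ n
  set g := γ * logTwo n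
  have habove : ∀ i ≤ M, IsAbove R m i (leftHalf S i) := by
    obtain ⟨k, hk1, hk2⟩ := hm.1.hasWall hn
    intro i hi
    refine hk1 i (hi.trans ?_)
    by_contra hcon
    exact absurd hk2 (not_le.2 (hM.2 k (not_le.1 hcon)))
  have hspec : ∀ k, let z := stateAt (farStep Γ R) (farStart Γ R) e k
      z.time = k ∧ z.pos = leftHalf S k ∧
        z.weight = ∑ j ∈ Finset.range k, Real.exp (-leftHalf S j) := by
    intro k
    rw [hS]
    induction k with
    | zero => exact ⟨rfl, by simp [partialSum, stateAt, farStart], by simp [stateAt, farStart]⟩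
    | succ k ih =>
      obtain ⟨h1, h2, h3⟩ := ih
      refine ⟨?_, ?_, ?_⟩
      · simp [stateAt, farStep, h1]
      · simp [stateAt, farStep, h2, partialSum_succ]
      · simp [stateAt, farStep, h2, h3, Finset.sum_range_succ]
  have hstage : ∀ k ≤ M, let z := stateAt (farStep Γ R) (farStart Γ R) e k
      z.alive ∧ z.stage ≤ m ∧ IsRise Γ R z.stage ∧
        ∀ i ≤ k, IsAbove R z.stage i (leftHalf S i) := by
    intro k hk
    induction k with
    | zero =>
      have h0 : leftHalf S 0 = 0 := by rw [hS]; simp [partialSum]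
      have hmem : m ∈ candidates Γ R 0 0 0 :=
        ⟨Nat.zero_le _, hrise, by have := habove 0 hk; rwa [h0] at this⟩
      have h1 := Nat.sInf_mem ⟨m, hmem⟩
      refine ⟨⟨m, hmem⟩, Nat.sInf_le hmem, h1.2.1, fun i hi => ?_⟩
      obtain rfl : i = 0 := by omega
      rw [h0]
      exact h1.2.2
    | succ k ih =>
      obtain ⟨h1, h2, h3, h4⟩ := ih (by omega)
      obtain ⟨ht, hp, -⟩ := hspec k
      obtain ⟨-, hp', -⟩ := hspec (k + 1)
      set y := stateAt (farStep Γ R) (farStart Γ R) e k with hy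
      have hpe : y.pos + e k = leftHalf S (k + 1) := hp'
      have hmem : m ∈ candidates Γ R y.stage (y.time + 1) (y.pos + e k) :=
        ⟨h2, hrise, by rw [ht, hpe]; exact habove (k + 1) hk⟩
      have h5 := Nat.sInf_mem ⟨m, hmem⟩
      refine ⟨⟨h1, m, hmem⟩, Nat.sInf_le hmem, h5.2.1, fun i hi => ?_⟩
      change IsAbove R (sInf (candidates Γ R y.stage (y.time + 1) (y.pos + e k))) i (leftHalf S i)
      set j := sInf (candidates Γ R y.stage (y.time + 1) (y.pos + e k))
      rcases Nat.eq_or_lt_of_le hi with rfl | hi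
      · have := h5.2.2
        rwa [ht, hpe] at this
      · rcases Nat.eq_or_lt_of_le h5.1 with h6 | h6
        · rw [← h6]; exact h4 i (by omega)
        · have h7 := h5.2.1.1 _ h6
          have h8 := (h4 i (by omega)).1
          exact ⟨by linarith, fun _ => by linarith⟩
  have hdeep : ∀ k ≤ M, wallLevel Γ g R (stateAt (farStep Γ R) (farStart Γ R) e k).stage ≤
      leftHalf S k → HasDeepBottom γ n S (stateAt (farStep Γ R) (farStart Γ R) e k).stage := by
    intro k hk hle
    obtain ⟨-, -, h3, h4⟩ := hstage k hk
    exact hasDeepBottom_of_hasWall hγ hn h3 ⟨k, h4, hle⟩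
  obtain ⟨ha, hle, h3, -⟩ := hstage M le_rfl
  obtain ⟨-, hp, hw⟩ := hspec M
  have hst : (stateAt (farStep Γ R) (farStart Γ R) e M).stage = m := by
    rcases Nat.eq_or_lt_of_le hle with h | h
    · exact h
    · refine absurd (hdeep M le_rfl ?_) (hm.2 _ h)
      exact (wallLevel_mono hg.le h3 h (hrise.1 _ h)).trans hM.1
  rw [run_eq_pay _ _ _ N M hN]
  · rw [farPay, hw, hst]
    refine ENNReal.ofReal_le_ofReal (le_of_eq ?_)
    rw [Finset.sum_mul]
    refine Finset.sum_congr rfl fun j _ => ?_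
    rw [← Real.exp_add]
    congr 1
    simp only [hR, rightHalf, leftHalf]; ring
  · rintro k hk ⟨-, hhalt⟩
    rw [(hspec k).2.1] at hhalt
    rcases Nat.eq_or_lt_of_le (hstage k hk.le).2.1 with h | h
    · rw [h] at hhalt
      exact absurd hhalt (not_le.2 (hM.2 k hk))
    · exact hm.2 _ h (hdeep k hk.le hhalt)
  · refine ⟨ha, ?_⟩
    rw [hp, hst]
    exact hM.1

/-! ### Almost sure existence of deep valleys -/

lemma measurable_partialSum (k : ℕ) : Measurable fun e : ℕ → ℝ => partialSum e k :=
  Finset.measurable_sum _ fun i _ => measurable_pi_apply i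

lemma partialSum_zero (e : ℕ → ℝ) : partialSum e 0 = 0 := by simp [partialSum]

/-- To bound the measure of `A` it is enough that an exploration pays `1` on `A`. -/
lemma measure_le_of_one_le_run {σ : Type*} {ν : Measure ℝ} [IsProbabilityMeasure ν]
    {halt : σ → Prop} {pay : σ → ℝ≥0∞} {step : σ → ℝ → σ} {N : ℕ} {z : σ} {c : ℝ≥0∞}
    {A : Set (ℕ → ℝ)} (hA : MeasurableSet A)
    (h1 : ∀ e ∈ A, 1 ≤ run halt pay step N z e)
    (h2 : ∫⁻ e, run halt pay step N z e ∂(iidLaw ν) ≤ c) : iidLaw ν A ≤ c := by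
  rw [← lintegral_indicator_one hA]
  refine (lintegral_mono fun e => ?_).trans h2
  by_cases he : e ∈ A
  · simpa [he] using h1 e he
  · simp [he]

/-- A step of the walk with its clock. -/
def clockStep (z : ℕ × ℝ) (e : ℝ) : ℕ × ℝ := (z.1 + 1, z.2 + e)

lemma clockState_eq (e : ℕ → ℝ) (k : ℕ) :
    stateAt clockStep (0, 0) e k = (k, partialSum e k) := by
  induction k with
  | zero => simp [stateAt, partialSum]
  | succ k ih => simp [stateAt, ih, clockStep, partialSum_succ]

/-- The walk leaves every bounded interval in bounded mean time, and by the martingale property it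
leaves `[-b, h)` at the top with a probability that tends to `1` as `b → ∞`. -/
lemma measure_forall_lt_le {ν : Measure ℝ} [IsProbabilityMeasure ν] {L φ : ℝ}
    (hν : IsCenteredStep ν L φ) {h : ℝ} (hh : 0 < h) {b : ℝ} (hb : 0 < b) {N : ℕ} (hN : 0 < N) :
    iidLaw ν {e | ∀ k, partialSum e k < h} ≤ ENNReal.ofReal ((h + L) / (h + L + b) +
      Real.exp (h / 2) / (φ - 1) * Real.exp ((b + L) / 2) / N) := by
  classical
  have hL := hν.bound_pos
  have hφ : 0 < φ - 1 := by linarith [hν.one_lt]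
  set B := Real.exp (h / 2) / (φ - 1) with hB
  have hB0 : 0 < B := by positivity
  set A := B * Real.exp ((b + L) / 2) with hA
  have hN' : (0 : ℝ) < N := by exact_mod_cast hN
  set halt : ℕ × ℝ → Prop := fun z => h ≤ z.2 ∨ z.2 < -b ∨ z.1 = N with hhalt
  set pay : ℕ × ℝ → ℝ≥0∞ := fun z => if h ≤ z.2 then 0 else 1 with hpay
  set Φ : ℕ × ℝ → ℝ := fun z => (h + L - z.2) / (h + L + b) +
    (A - B * Real.exp (-z.2 / 2) + z.1) / N with hΦ
  have hmeas : MeasurableSet {e : ℕ → ℝ | ∀ k, partialSum e k < h} := by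
    have : {e : ℕ → ℝ | ∀ k, partialSum e k < h} = ⋂ k, {e | partialSum e k < h} := by
      ext; simp
    rw [this]
    exact MeasurableSet.iInter fun k => measurableSet_lt (measurable_partialSum k) measurable_const
  have hfut : ∀ z : ℕ × ℝ, -b - L ≤ z.2 → 0 ≤ A - B * Real.exp (-z.2 / 2) := by
    intro z hz
    have : Real.exp (-z.2 / 2) ≤ Real.exp ((b + L) / 2) := Real.exp_le_exp.2 (by linarith)
    have := mul_le_mul_of_nonneg_left this hB0.le
    linarith
  have hG : 0 < h + L + b := by linarith
  refine measure_le_of_one_le_run (halt := halt) (pay := pay) (step := clockStep) (N := N + 1)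
    (z := (0, 0)) hmeas ?_ ?_
  · intro e he
    have hex : ∃ k, halt (stateAt clockStep (0, 0) e k) :=
      ⟨N, by rw [clockState_eq]; exact Or.inr (Or.inr rfl)⟩
    have hle : Nat.find hex ≤ N := Nat.find_min' hex (by
      rw [clockState_eq]; exact Or.inr (Or.inr rfl))
    rw [run_eq_pay halt pay clockStep (N + 1) (Nat.find hex) (by omega) _ _
      (fun k hk => Nat.find_min hex hk) (Nat.find_spec hex), clockState_eq]
    simp [hpay, not_le.2 (he (Nat.find hex))]
  · refine (lintegral_run_le hν halt pay clockStep (fun z => -b - L ≤ z.2 ∧ z.2 ≤ h + L) Φ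
      ?_ ?_ ?_ (N + 1) (0, 0) ⟨by simp only; linarith, by simp only; linarith⟩).trans
      (ENNReal.ofReal_le_ofReal ?_)
    · rintro z ⟨h1, h2⟩
      have := hfut z h1
      have h3 : 0 ≤ h + L - z.2 := by linarith
      simp only [hΦ]
      positivity
    · rintro z ⟨h1, h2⟩ hs
      have h3 := hfut z h1
      have h4 : 0 ≤ (h + L - z.2) / (h + L + b) := div_nonneg (by linarith) hG.le
      have h5 : 0 ≤ (A - B * Real.exp (-z.2 / 2) + z.1) / N := by positivity
      simp only [hpay]
      split_ifs with h6
      · exact zero_le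
      · rw [ENNReal.one_le_ofReal]
        rcases hs with hs | hs | hs
        · exact absurd hs h6
        · have : 1 ≤ (h + L - z.2) / (h + L + b) := by
            rw [one_le_div hG]; linarith
          simp only [hΦ]; linarith
        · have : 1 ≤ (A - B * Real.exp (-z.2 / 2) + z.1) / N := by
            rw [one_le_div hN', hs]; linarith
          simp only [hΦ]; linarith
    · rintro z ⟨h1, h2⟩ hs
      simp only [hhalt, not_or, not_le, not_lt] at hs
      refine ⟨fun e he => ?_, (h + L - z.2) / (h + L + b) + (A + z.1 + 1) / N,
        -1 / (h + L + b), B * Real.exp (-z.2 / 2) / N, ?_, fun e he => le_of_eq ?_⟩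
      · have := abs_le.1 he
        simp only [clockStep]
        constructor <;> linarith
      · have h3 : 1 ≤ B * Real.exp (-z.2 / 2) * (φ - 1) := by
          have : B * Real.exp (-z.2 / 2) * (φ - 1) = Real.exp (h / 2 + -z.2 / 2) := by
            rw [hB, Real.exp_add]; field_simp
          rw [this]
          exact Real.one_le_exp (by linarith)
        have h4 : (A + z.1 + 1) / N - B * Real.exp (-z.2 / 2) / N * φ ≤
            (A - B * Real.exp (-z.2 / 2) + z.1) / N := by
          rw [div_mul_eq_mul_div, ← sub_div]
          gcongr
          linarith
        simp only [hΦ]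
        linarith
      · have hexp : Real.exp (-(z.2 + e) / 2) = Real.exp (-z.2 / 2) * Real.exp (-e / 2) := by
          rw [← Real.exp_add]; congr 1; ring
        simp only [hΦ, clockStep, hexp]
        push_cast
        ring
    · simp only [hΦ, Nat.cast_zero, add_zero, sub_zero]
      gcongr
      linarith [mul_pos hB0 (Real.exp_pos (-0 / 2))]

/-- The walk is almost surely unbounded above. -/
lemma ae_exists_le_partialSum {ν : Measure ℝ} [IsProbabilityMeasure ν] {L φ : ℝ}
    (hν : IsCenteredStep ν L φ) {h : ℝ} (hh : 0 < h) :
    ∀ᵐ e ∂(iidLaw ν), ∃ k, h ≤ partialSum e k := by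
  have hL := hν.bound_pos
  have h1 : ∀ b : ℕ, (iidLaw ν {e | ∀ k, partialSum e k < h}).toReal ≤
      (h + L) / (h + L + ((b : ℝ) + 1)) := by
    intro b
    have hlim : Filter.Tendsto (fun N : ℕ => (h + L) / (h + L + ((b : ℝ) + 1)) +
        Real.exp (h / 2) / (φ - 1) * Real.exp (((b : ℝ) + 1 + L) / 2) / (N : ℝ)) Filter.atTop
        (nhds ((h + L) / (h + L + ((b : ℝ) + 1)) + 0)) :=
      tendsto_const_nhds.add (tendsto_const_div_atTop_nhds_zero_nat _)
    rw [add_zero] at hlim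
    refine ge_of_tendsto hlim (Filter.eventually_atTop.2 ⟨1, fun N hN => ?_⟩)
    have h2 := measure_forall_lt_le hν hh (b := (b : ℝ) + 1) (by positivity) (N := N) (by omega)
    have hφ : 0 < φ - 1 := by linarith [hν.one_lt]
    exact ENNReal.toReal_le_of_le_ofReal (by positivity) h2
  have h2 : Filter.Tendsto (fun b : ℕ => (h + L) / (h + L + ((b : ℝ) + 1))) Filter.atTop
      (nhds 0) := by
    refine Filter.Tendsto.div_atTop tendsto_const_nhds ?_
    exact Filter.tendsto_atTop_add_const_left _ _
      (Filter.tendsto_atTop_add_const_right _ _ tendsto_natCast_atTop_atTop)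
  have h3 := ge_of_tendsto' h2 h1
  have h4 : iidLaw ν {e | ∀ k, partialSum e k < h} = 0 := by
    have := le_antisymm h3 ENNReal.toReal_nonneg
    rcases (ENNReal.toReal_eq_zero_iff _).1 this with h | h
    · exact h
    · exact absurd h (measure_ne_top _ _)
  rw [ae_iff]
  convert h4 using 3
  simp

/-- At time `k` the path `R` makes a new strict minimum, after it has reached `h` and before it
reaches `h + g`. -/
def HasRelapse (h g : ℝ) (R : ℕ → ℝ) (k : ℕ) : Prop :=
  (∃ j < k, h ≤ R j) ∧ (∀ j < k, R j < h + g) ∧ ∀ j < k, R k < R j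

/-- A state of the search for a relapse: the position, its running minimum, whether the level `h`
has been reached, and whether a new minimum was made after that. -/
structure RelapseState where
  pos : ℝ
  low : ℝ
  reached : Prop
  relapse : Prop

/-- One step of the search for a relapse. -/
noncomputable def relapseStep (h : ℝ) (z : RelapseState) (e : ℝ) : RelapseState where
  pos := z.pos + e
  low := min z.low (z.pos + e)
  reached := z.reached ∨ h ≤ z.pos + e
  relapse := z.reached ∧ z.pos + e < z.low

lemma relapseState_spec {h : ℝ} (hh : 0 < h) (e : ℕ → ℝ) (k : ℕ) :
    let z := stateAt (relapseStep h) ⟨0, 0, False, False⟩ e k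
    let R := partialSum e
    z.pos = R k ∧ (∀ j ≤ k, z.low ≤ R j) ∧ (∃ j ≤ k, z.low = R j) ∧
      (z.reached ↔ ∃ j ≤ k, h ≤ R j) ∧
      (z.relapse ↔ (∃ j < k, h ≤ R j) ∧ ∀ j < k, R k < R j) := by
  intro z R
  have hR0 : R 0 = 0 := partialSum_zero e
  induction k with
  | zero =>
    simp [z, stateAt, hR0, hh]
  | succ k ih =>
    obtain ⟨h1, h2, ⟨a, ha, h3⟩, h4, h5⟩ := ih
    set y := stateAt (relapseStep h) ⟨0, 0, False, False⟩ e k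
    have hR : y.pos + e k = R (k + 1) := by rw [h1]; exact (partialSum_succ e k).symm
    have hz : z = ⟨R (k + 1), min y.low (R (k + 1)), y.reached ∨ h ≤ R (k + 1),
        y.reached ∧ R (k + 1) < y.low⟩ := by
      rw [← hR]; rfl
    rw [hz]
    refine ⟨rfl, fun j hj => ?_, ?_, ?_, ?_⟩
    · rcases Nat.eq_or_lt_of_le hj with rfl | hj
      · exact min_le_right _ _
      · exact (min_le_left _ _).trans (h2 j (by omega))
    · rcases min_choice y.low (R (k + 1)) with h6 | h6
      · exact ⟨a, by omega, h6.trans h3⟩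
      · exact ⟨k + 1, le_rfl, h6⟩
    · simp only [h4]
      constructor
      · rintro (⟨j, hj, h6⟩ | h6)
        · exact ⟨j, by omega, h6⟩
        · exact ⟨k + 1, le_rfl, h6⟩
      · rintro ⟨j, hj, h6⟩
        rcases Nat.eq_or_lt_of_le hj with rfl | hj
        · exact Or.inr h6
        · exact Or.inl ⟨j, by omega, h6⟩
    · simp only [h4, Nat.lt_succ_iff]
      refine and_congr Iff.rfl ⟨fun h6 j hj => h6.trans_le (h2 j hj), fun h6 => ?_⟩
      rw [h3]; exact h6 a ha

lemma measurable_hasRelapse (h g : ℝ) (k : ℕ) :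
    MeasurableSet {e : ℕ → ℝ | HasRelapse h g (partialSum e) k} := by
  have : {e : ℕ → ℝ | HasRelapse h g (partialSum e) k} =
      (⋃ j, ⋃ (_ : j < k), {e | h ≤ partialSum e j}) ∩
      ((⋂ j, ⋂ (_ : j < k), {e | partialSum e j < h + g}) ∩
        ⋂ j, ⋂ (_ : j < k), {e | partialSum e k < partialSum e j}) := by
    ext e
    simp [HasRelapse]
  rw [this]
  refine MeasurableSet.inter ?_ (MeasurableSet.inter ?_ ?_)
  · exact MeasurableSet.iUnion fun j => MeasurableSet.iUnion fun _ =>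
      measurableSet_le measurable_const (measurable_partialSum j)
  · exact MeasurableSet.iInter fun j => MeasurableSet.iInter fun _ =>
      measurableSet_lt (measurable_partialSum j) measurable_const
  · exact MeasurableSet.iInter fun j => MeasurableSet.iInter fun _ =>
      measurableSet_lt (measurable_partialSum k) (measurable_partialSum j)

/-- A relapse has to cross an interval longer than `h` before the height `g` is gained. -/
lemma measure_exists_hasRelapse_le {ν : Measure ℝ} [IsProbabilityMeasure ν] {L φ : ℝ}
    (hν : IsCenteredStep ν L φ) {h g : ℝ} (hh : 0 < h) (hg : 0 < g) :
    iidLaw ν {e | ∃ k, HasRelapse h g (partialSum e) k} ≤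
      ENNReal.ofReal ((g + L) / (h + g + L)) := by
  classical
  have hL := hν.bound_pos
  have hG : 0 < h + g + L := by linarith
  set halt : RelapseState → Prop := fun z => z.relapse ∨ h + g ≤ z.pos with hhalt
  set pay : RelapseState → ℝ≥0∞ := fun z => if z.relapse then 1 else 0 with hpay
  set Φ : RelapseState → ℝ := fun z => if z.relapse then 1 else
    if z.reached then (h + g + L - z.pos) / (h + g + L - z.low) else (g + L) / (h + g + L) with hΦ
  have hfin : ∀ N : ℕ, iidLaw ν {e | ∃ k < N, HasRelapse h g (partialSum e) k} ≤
      ENNReal.ofReal ((g + L) / (h + g + L)) := by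
    intro N
    have hmeas : MeasurableSet {e : ℕ → ℝ | ∃ k < N, HasRelapse h g (partialSum e) k} := by
      have : {e : ℕ → ℝ | ∃ k < N, HasRelapse h g (partialSum e) k} =
          ⋃ k, ⋃ (_ : k < N), {e | HasRelapse h g (partialSum e) k} := by
        ext; simp
      rw [this]
      exact MeasurableSet.iUnion fun k => MeasurableSet.iUnion fun _ => measurable_hasRelapse h g k
    refine measure_le_of_one_le_run (halt := halt) (pay := pay) (step := relapseStep h) (N := N)
      (z := ⟨0, 0, False, False⟩) hmeas ?_ ?_
    · rintro e ⟨k₀, hk₀, hrel₀⟩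
      have hex : ∃ k, HasRelapse h g (partialSum e) k := ⟨k₀, hrel₀⟩
      have hlt : Nat.find hex < N := (Nat.find_min' hex hrel₀).trans_lt hk₀
      have hspec := Nat.find_spec hex
      have hr : (stateAt (relapseStep h) ⟨0, 0, False, False⟩ e (Nat.find hex)).relapse :=
        (relapseState_spec hh e _).2.2.2.2.2 ⟨hspec.1, hspec.2.2⟩
      rw [run_eq_pay halt pay (relapseStep h) N (Nat.find hex) hlt]
      · simp [hpay, hr]
      · rintro k hk (hs | hs)
        · obtain ⟨h1, h2⟩ := (relapseState_spec hh e k).2.2.2.2.1 hs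
          exact Nat.find_min hex hk ⟨h1, fun j hj => hspec.2.1 j (hj.trans hk), h2⟩
        · rw [(relapseState_spec hh e k).1] at hs
          exact absurd hs (not_le.2 (hspec.2.1 k hk))
      · exact Or.inl hr
    · refine (lintegral_run_le hν halt pay (relapseStep h)
        (fun z => z.low ≤ 0 ∧ z.low ≤ h + g ∧ z.pos ≤ h + g + L ∧ (¬ z.reached → z.pos < h)) Φ
        ?_ ?_ ?_ N ⟨0, 0, False, False⟩ ⟨le_rfl, by simp only; linarith, by simp only; linarith,
          fun _ => hh⟩).trans (ENNReal.ofReal_le_ofReal ?_)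
      · rintro z ⟨h1, -, h2, -⟩
        simp only [hΦ]
        split_ifs
        · exact zero_le_one
        · exact div_nonneg (by linarith) (by linarith)
        · positivity
      · rintro z - -
        simp only [hpay, hΦ]
        split_ifs <;> simp
      · rintro z ⟨h1, h2, h3, h4⟩ hs
        simp only [hhalt, not_or, not_le] at hs
        refine ⟨fun e he => ?_, ?_⟩
        · have := abs_le.1 he
          refine ⟨(min_le_left _ _).trans h1, (min_le_left _ _).trans h2, ?_, ?_⟩
          · simp only [relapseStep]; linarith
          · simp only [relapseStep, not_or, not_le]; exact fun h => h.2
        · by_cases hr : z.reached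
          · have hG' : 0 < h + g + L - z.low := by linarith
            refine ⟨(h + g + L - z.pos) / (h + g + L - z.low), -1 / (h + g + L - z.low), 0, ?_,
              fun e he => ?_⟩
            · simp [hΦ, hs.1, hr]
            · have hlin : (h + g + L - z.pos) / (h + g + L - z.low) +
                  -1 / (h + g + L - z.low) * e - 0 * Real.exp (-e / 2) =
                  (h + g + L - (z.pos + e)) / (h + g + L - z.low) := by
                ring
              rw [hlin]
              rcases lt_or_ge (z.pos + e) z.low with h5 | h5
              · simp only [hΦ, relapseStep, hr, h5, and_self, if_true]
                rw [one_le_div hG']; linarith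
              · simp [hΦ, relapseStep, hr, not_lt.2 h5, min_eq_left h5]
          · refine ⟨(g + L) / (h + g + L), 0, 0, by simp [hΦ, hs.1, hr], fun e he => ?_⟩
            simp only [hΦ, relapseStep, hr, false_and, if_false, false_or, zero_mul, add_zero,
              sub_zero]
            split_ifs with h5
            · rw [min_eq_left (by linarith)]
              have : 0 < h + g + L - z.low := by linarith
              rw [div_le_div_iff₀ this hG]
              nlinarith
            · exact le_rfl
      · simp [hΦ]
  have hU : {e : ℕ → ℝ | ∃ k, HasRelapse h g (partialSum e) k} =
      ⋃ N : ℕ, {e | ∃ k < N, HasRelapse h g (partialSum e) k} := by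
    ext e
    simp only [Set.mem_ofPred_eq, Set.mem_iUnion]
    exact ⟨fun ⟨k, hk⟩ => ⟨k + 1, k, by omega, hk⟩, fun ⟨_, k, _, hk⟩ => ⟨k, hk⟩⟩
  have hmono : Monotone fun N : ℕ => {e : ℕ → ℝ | ∃ k < N, HasRelapse h g (partialSum e) k} := by
    rintro N N' hNN e ⟨k, hk, hk'⟩
    exact ⟨k, by omega, hk'⟩
  rw [hU, hmono.measure_iUnion]
  exact iSup_le hfin

/-- Two walls of height `h + g`, reached without relapse, enclose a deep valley. -/
lemma hasDeepBottom_of_min {γ : ℝ} (hγ : 0 < γ) {n : ℕ} (hn : 3 < n) {S : ℤ → ℝ} (hS0 : S 0 = 0)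
    {h : ℝ} (hh : depthLevel γ n ≤ h) {c k m : ℕ}
    (hc : IsFirstPassage (h + γ * logTwo n) (rightHalf S) c)
    (hk : IsFirstPassage (h + γ * logTwo n) (leftHalf S) k)
    (hrel : ∀ i, ¬ HasRelapse h (γ * logTwo n) (rightHalf S) i) (hmc : m ≤ c)
    (hmin : ∀ t ∈ Set.Icc (-(k : ℤ)) c, S m ≤ S t)
    (habs : ∀ t ∈ Set.Icc (-(k : ℤ)) c, S t = S m → (m : ℤ) ≤ |t|) :
    HasDeepBottom γ n S m := by
  have hg := mul_pos hγ (logTwo_pos hn)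
  have hΓ := margin_lt_depthLevel hn γ
  have hm0 : S m ≤ 0 := by rw [← hS0]; exact hmin 0 ⟨by omega, by omega⟩
  have hmc' : m < c := by
    refine lt_of_le_of_ne hmc ?_
    rintro rfl
    have := hc.1
    simp only [rightHalf] at this
    linarith
  have hrec : ∀ i < m, rightHalf S m < rightHalf S i := by
    intro i hi
    have hmem : (i : ℤ) ∈ Set.Icc (-(k : ℤ)) c := ⟨by omega, by omega⟩
    refine lt_of_le_of_ne (hmin i hmem) fun he => ?_
    have := habs i hmem he.symm
    simp only [Nat.abs_cast, Nat.cast_le] at this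
    omega
  refine hasDeepBottom_of_hasWall hγ hn ⟨hrec, c, hmc', ?_, fun i hi hi' =>
    hmin i ⟨by omega, by omega⟩⟩ ⟨k, fun i hi => ?_, ?_⟩
  · have := hc.1
    simp only [rightHalf] at this ⊢
    linarith
  · have hmem : -(i : ℤ) ∈ Set.Icc (-(k : ℤ)) c := ⟨by omega, by omega⟩
    refine ⟨hmin _ hmem, fun him => lt_of_le_of_ne (hmin _ hmem) fun he => ?_⟩
    have := habs _ hmem he.symm
    simp only [Nat.abs_cast, abs_neg, Nat.cast_le] at this
    omega
  · have h1 := hk.1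
    obtain ⟨i, hi, hmax⟩ := exists_eq_runMax (rightHalf S) m
    refine max_le (by linarith) ?_
    rw [← hmax]
    by_contra hcon
    have h2 : h ≤ rightHalf S i := by linarith
    have him : i < m := by
      refine lt_of_le_of_ne hi ?_
      rintro rfl
      simp only [rightHalf] at h2
      linarith
    exact hrel m ⟨⟨i, him, h2⟩, fun j hj => hc.2 j (by omega), hrec⟩

lemma exists_isDeepValley {γ : ℝ} (hγ : 0 < γ) {n : ℕ} (hn : 3 < n) {S : ℤ → ℝ} (hS0 : S 0 = 0)
    {h : ℝ} (hh : depthLevel γ n ≤ h)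
    (hR : ∃ c, h + γ * logTwo n ≤ rightHalf S c) (hL : ∃ c, h + γ * logTwo n ≤ leftHalf S c)
    (hrelR : ∀ i, ¬ HasRelapse h (γ * logTwo n) (rightHalf S) i)
    (hrelL : ∀ i, ¬ HasRelapse h (γ * logTwo n) (leftHalf S) i) :
    ∃ a m c, IsDeepValley γ n S a m c := by
  classical
  have hc : IsFirstPassage (h + γ * logTwo n) (rightHalf S) (Nat.find hR) :=
    ⟨Nat.find_spec hR, fun i hi => not_le.1 (Nat.find_min hR hi)⟩
  have hk : IsFirstPassage (h + γ * logTwo n) (leftHalf S) (Nat.find hL) :=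
    ⟨Nat.find_spec hL, fun i hi => not_le.1 (Nat.find_min hL hi)⟩
  generalize Nat.find hR = c at hc
  generalize Nat.find hL = k at hk
  obtain ⟨m₀, hm₀, hmin₀⟩ := (Finset.Icc (-(k : ℤ)) c).exists_min_image S ⟨0, by simp⟩
  obtain ⟨m, hm, habs⟩ := ((Finset.Icc (-(k : ℤ)) c).filter fun t => S t = S m₀).exists_min_image
    (fun t => |t|) ⟨m₀, Finset.mem_filter.2 ⟨hm₀, rfl⟩⟩
  simp only [Finset.mem_filter, Finset.mem_Icc] at hm habs hmin₀
  have hmin : ∀ t ∈ Set.Icc (-(k : ℤ)) c, S m ≤ S t := fun t ht => by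
    rw [hm.2]; exact hmin₀ t ht
  have habs' : ∀ t ∈ Set.Icc (-(k : ℤ)) c, S t = S m → |m| ≤ |t| := fun t ht he =>
    habs t ⟨ht, he.trans hm.2⟩
  rcases le_or_gt 0 m with h0 | h0
  · lift m to ℕ using h0
    rw [Nat.abs_cast] at habs'
    obtain ⟨a, c', hv⟩ := hasDeepBottom_of_min hγ hn hS0 hh hc hk hrelR (by omega) hmin habs'
    exact ⟨a, m, c', hv⟩
  · obtain ⟨q, rfl⟩ : ∃ q : ℕ, m = -(q : ℤ) := ⟨(-m).toNat, by omega⟩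
    have hmirL : leftHalf (mirror S) = rightHalf S := by
      funext i; simp [leftHalf, rightHalf, mirror]
    have hneg : ∀ t ∈ Set.Icc (-(c : ℤ)) k, -t ∈ Set.Icc (-(k : ℤ)) c := fun t ht =>
      ⟨by have := ht.2; omega, by have := ht.1; omega⟩
    obtain ⟨a, c', hv⟩ := hasDeepBottom_of_min (S := mirror S) (m := q) hγ hn
      (by simpa [mirror] using hS0) hh hk (by rwa [hmirL]) hrelL (by omega)
      (fun t ht => hmin _ (hneg t ht)) (fun t ht he => by
        have := habs' _ (hneg t ht) he
        simpa using this)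
    have := hv.mirror
    rw [mirror_mirror] at this
    exact ⟨_, _, _, this⟩

lemma exists_isSmallestDeepValley {γ : ℝ} {n : ℕ} {S : ℤ → ℝ}
    (h : ∃ a m c, IsDeepValley γ n S a m c) :
    ∃ a m c, IsSmallestDeepValley γ n S a m c := by
  classical
  have hex : ∃ N : ℕ, ∃ a m c, IsDeepValley γ n S a m c ∧ (c - a).toNat = N := by
    obtain ⟨a, m, c, h⟩ := h
    exact ⟨_, a, m, c, h, rfl⟩
  obtain ⟨a, m, c, h, hN⟩ := Nat.find_spec hex
  refine ⟨a, m, c, h, fun a' m' c' h' h1 h2 => ?_⟩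
  have h3 := Nat.find_min' hex ⟨a', m', c', h', rfl⟩
  have h4 := h'.zero_mem.1
  have h5 := h'.zero_mem.2
  omega

/-! ### Measurability of valleys in the potential -/

section Measurability

lemma measurable_le_prop {X : Type*} [MeasurableSpace X] {f g : X → ℝ} (hf : Measurable f)
    (hg : Measurable g) : Measurable fun x => f x ≤ g x :=
  measurableSet_setOfPred.1 (measurableSet_le hf hg)

lemma measurable_lt_prop {X : Type*} [MeasurableSpace X] {f g : X → ℝ} (hf : Measurable f)
    (hg : Measurable g) : Measurable fun x => f x < g x :=
  measurableSet_setOfPred.1 (measurableSet_lt hf hg)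

lemma measurable_eval (k : ℤ) : Measurable fun S : ℤ → ℝ => S k := measurable_pi_apply k

lemma measurable_isDeepValley (γ : ℝ) (n : ℕ) (a m c : ℤ) :
    Measurable fun S : ℤ → ℝ => IsDeepValley γ n S a m c := by
  have h : (fun S : ℤ → ℝ => IsDeepValley γ n S a m c) = fun S =>
      (a ≤ m ∧ m ≤ c ∧ (∀ t : ℤ, t ∈ Set.Icc a m → S t ≤ S a) ∧
        (∀ t : ℤ, t ∈ Set.Icc m c → S t ≤ S c) ∧ (∀ t : ℤ, t ∈ Set.Icc a c → S m ≤ S t) ∧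
        (∀ t : ℤ, t ∈ Set.Icc a c → S t = S m → |m| ≤ |t|)) ∧
      (0 : ℤ) ∈ Set.Icc a c ∧ depthLevel γ n ≤ min (S a - S m) (S c - S m) ∧
      (m < 0 → ∀ t : ℤ, t ∈ Set.Icc m 0 → γ * logTwo n ≤ S c - S t) ∧
      (0 < m → ∀ t : ℤ, t ∈ Set.Icc 0 m → γ * logTwo n ≤ S a - S t) := by
    funext S
    refine propext ⟨fun h => ?_, fun h => ?_⟩
    · exact ⟨⟨h.1.1, h.1.2, h.1.3, h.1.4, h.1.5, h.1.6⟩, h.2, h.3, h.4, h.5⟩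
    · obtain ⟨⟨h1, h2, h3, h4, h5, h6⟩, h7, h8, h9, h10⟩ := h
      exact ⟨⟨h1, h2, h3, h4, h5, h6⟩, h7, h8, h9, h10⟩
  rw [h]
  have he := measurable_eval
  have heq : ∀ t : ℤ, Measurable fun S : ℤ → ℝ => S t = S m := fun t =>
    measurableSet_setOfPred.1 (measurableSet_eq_fun (he t) (he m))
  refine .and (.and measurable_const (.and measurable_const (.and
      (.forall fun t => .imp measurable_const (measurable_le_prop (he t) (he a)))
      (.and (.forall fun t => .imp measurable_const (measurable_le_prop (he t) (he c)))
      (.and (.forall fun t => .imp measurable_const (measurable_le_prop (he m) (he t)))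
      (.forall fun t => .imp measurable_const (.imp (heq t) measurable_const)))))))
    (.and measurable_const (.and
      (measurable_le_prop measurable_const (((he a).sub (he m)).min ((he c).sub (he m))))
      (.and
      (.imp measurable_const (.forall fun t => .imp measurable_const
        (measurable_le_prop measurable_const ((he c).sub (he t)))))
      (.imp measurable_const (.forall fun t => .imp measurable_const
        (measurable_le_prop measurable_const ((he a).sub (he t))))))))

lemma measurable_hasDeepBottom (γ : ℝ) (n : ℕ) (m : ℤ) :
    Measurable fun S : ℤ → ℝ => HasDeepBottom γ n S m :=
  .exists fun a => .exists fun c => measurable_isDeepValley γ n a m c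

lemma measurable_isFirstBottom (γ : ℝ) (n : ℕ) (m : ℕ) :
    Measurable fun S : ℤ → ℝ => IsFirstBottom γ n S m :=
  .and (measurable_hasDeepBottom γ n m) (.forall fun i => .imp measurable_const
    (measurable_hasDeepBottom γ n i).not)

lemma measurable_isFirstRise (Γ : ℝ) (m c : ℕ) :
    Measurable fun S : ℤ → ℝ => IsFirstRise Γ (rightHalf S) m c := by
  have he : ∀ k : ℕ, Measurable fun S : ℤ → ℝ => rightHalf S k := fun k => measurable_eval k
  exact .and measurable_const (.and (measurable_le_prop ((he m).add_const Γ) (he c))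
    (.forall fun i => .imp measurable_const (.imp measurable_const
      (measurable_lt_prop (he i) ((he m).add_const Γ)))))

lemma measurable_wallLevel (Γ g : ℝ) (m : ℕ) :
    Measurable fun S : ℤ → ℝ => wallLevel Γ g (rightHalf S) m := by
  have he : ∀ k : ℕ, Measurable fun S : ℤ → ℝ => rightHalf S k := fun k => measurable_eval k
  have hmax : Measurable fun S : ℤ → ℝ => runMax (rightHalf S) m := by
    induction m with
    | zero => exact he 0
    | succ m ih => exact ih.max (he (m + 1))
  exact ((he m).add_const Γ).max (hmax.add_const g)

lemma measurable_isFirstPassage (Γ g : ℝ) (m k : ℕ) :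
    Measurable fun S : ℤ → ℝ =>
      IsFirstPassage (wallLevel Γ g (rightHalf S) m) (leftHalf S) k := by
  have he : ∀ k : ℕ, Measurable fun S : ℤ → ℝ => leftHalf S k := fun k => measurable_eval _
  have hw := measurable_wallLevel Γ g m
  exact .and (measurable_le_prop hw (he k)) (.forall fun i => .imp measurable_const
    (measurable_lt_prop (he i) hw))

lemma measurable_isSmallestDeepValley (γ : ℝ) (n : ℕ) (a m c : ℤ) :
    Measurable fun S : ℤ → ℝ => IsSmallestDeepValley γ n S a m c := by
  have h : (fun S : ℤ → ℝ => IsSmallestDeepValley γ n S a m c) = fun S =>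
      IsDeepValley γ n S a m c ∧ ∀ a' b c' : ℤ, IsDeepValley γ n S a' b c' → a ≤ a' → c' ≤ c →
        a' = a ∧ c' = c := by
    funext S
    exact propext ⟨fun h => ⟨h.1, h.2⟩, fun h => ⟨h.1, h.2⟩⟩
  rw [h]
  exact .and (measurable_isDeepValley γ n a m c) (.forall fun a' => .forall fun b =>
    .forall fun c' => .imp (measurable_isDeepValley γ n a' b c') measurable_const)

/-- The bottoms of the smallest deep valleys. -/
def bottomSet (γ : ℝ) (n : ℕ) (S : ℤ → ℝ) : Set ℤ :=
  {m : ℤ | ∃ M' M'' : ℤ, IsSmallestDeepValley γ n S M' m M''}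

lemma measurable_mem_bottomSet (γ : ℝ) (n : ℕ) (m : ℤ) :
    Measurable fun S : ℤ → ℝ => m ∈ bottomSet γ n S :=
  Measurable.exists fun a => .exists fun c => measurable_isSmallestDeepValley γ n a m c

lemma measurable_mem_leftSet (γ : ℝ) (n : ℕ) (m l : ℤ) :
    Measurable fun S : ℤ → ℝ => l ∈ leftSet γ n S m := by
  have he := measurable_eval
  exact Measurable.and measurable_const (.and measurable_const (.and
    (measurable_le_prop measurable_const ((he l).sub (he m)))
    (.imp measurable_const (.forall fun k => .imp measurable_const
      (measurable_le_prop measurable_const ((he l).sub (he k)))))))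

lemma measurable_mem_rightSet (γ : ℝ) (n : ℕ) (m l : ℤ) :
    Measurable fun S : ℤ → ℝ => l ∈ rightSet γ n S m := by
  have he := measurable_eval
  exact Measurable.and measurable_const (.and measurable_const (.and
    (measurable_le_prop measurable_const ((he l).sub (he m)))
    (.imp measurable_const (.forall fun k => .imp measurable_const
      (measurable_le_prop measurable_const ((he l).sub (he k)))))))

/-- `m` is the selected bottom, and `a` and `b` are the ends of its basic valley. -/
def IsBasicValley (γ : ℝ) (n : ℕ) (S : ℤ → ℝ) (a m b : ℤ) : Prop :=
  IsGreatest (bottomSet γ n S) m ∧ IsGreatest (leftSet γ n S m) a ∧ IsLeast (rightSet γ n S m) b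

lemma measurable_isBasicValley (γ : ℝ) (n : ℕ) (a m b : ℤ) :
    Measurable fun S : ℤ → ℝ => IsBasicValley γ n S a m b :=
  .and (.and (measurable_mem_bottomSet γ n m)
      (.forall fun x => .imp (measurable_mem_bottomSet γ n x) measurable_const))
    (.and (.and (measurable_mem_leftSet γ n m a)
      (.forall fun x => .imp (measurable_mem_leftSet γ n m x) measurable_const))
      (.and (measurable_mem_rightSet γ n m b)
      (.forall fun x => .imp (measurable_mem_rightSet γ n m x) measurable_const)))

end Measurability

lemma IsBasicValley.eq {γ : ℝ} {n : ℕ} {S : ℤ → ℝ} {a m b : ℤ} (h : IsBasicValley γ n S a m b) :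
    bottom γ n S = m ∧ leftEnd γ n S m = a ∧ rightEnd γ n S m = b :=
  ⟨h.1.csSup_eq, h.2.1.csSup_eq, h.2.2.csInf_eq⟩

/-- At most one number is a nonnegative bottom of smallest deep valleys. -/
lemma bddAbove_bottomSet (γ : ℝ) (n : ℕ) (S : ℤ → ℝ) : BddAbove (bottomSet γ n S) := by
  by_cases h : ∃ m : ℕ, (m : ℤ) ∈ bottomSet γ n S
  · obtain ⟨m, a, c, hm⟩ := h
    refine ⟨m, fun x hx => ?_⟩
    by_contra hcon
    obtain ⟨a', c', hx⟩ := hx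
    lift x to ℕ using (by omega)
    exact hx.isFirstBottom.2 m (by omega) ⟨a, c, hm.isDeepValley⟩
  · refine ⟨0, fun x hx => ?_⟩
    by_contra hcon
    lift x to ℕ using (by omega)
    exact h ⟨x, hx⟩

lemma exists_isBasicValley {γ : ℝ} (hγ : 0 < γ) {n : ℕ} (hn : 3 < n) {S : ℤ → ℝ}
    (h : ∃ a m c, IsSmallestDeepValley γ n S a m c) : ∃ a m b, IsBasicValley γ n S a m b := by
  obtain ⟨a₀, m₀, c₀, h₀⟩ := h
  have hm := Int.csSup_mem (s := bottomSet γ n S) ⟨m₀, a₀, c₀, h₀⟩ (bddAbove_bottomSet γ n S)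
  set m := sSup (bottomSet γ n S)
  obtain ⟨a, c, hs⟩ := hm
  have hl := hs.isDeepValley.left_mem hγ hn
  have hr := hs.isDeepValley.right_mem hγ hn
  have hlb : BddAbove (leftSet γ n S m) := ⟨0, fun x hx => hx.1⟩
  have hrb : BddBelow (rightSet γ n S m) := ⟨0, fun x hx => hx.1⟩
  exact ⟨sSup (leftSet γ n S m), m, sInf (rightSet γ n S m),
    ⟨⟨a, c, hs⟩, fun x hx => le_csSup (bddAbove_bottomSet γ n S) hx⟩,
    ⟨Int.csSup_mem ⟨a, hl⟩ hlb, fun x hx => le_csSup hlb hx⟩,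
    ⟨Int.csInf_mem ⟨c, hr⟩ hrb, fun x hx => csInf_le hrb hx⟩⟩

/-! ### The sum over the basic valley -/

open Classical in
/-- The sum of `exp (-(S_j - S_m))` from the origin up to the right wall, where `m` is the first
nonnegative deep bottom; it is `0` unless the wall is found before time `N`. -/
noncomputable def nearSum (γ : ℝ) (n N : ℕ) (S : ℤ → ℝ) : ℝ≥0∞ :=
  ⨆ (m : ℕ) (M : ℕ),
    if (IsFirstBottom γ n S m ∧ IsFirstRise (depthLevel γ n) (rightHalf S) m M) ∧ M < N then
      ENNReal.ofReal (∑ j ∈ Finset.range M, Real.exp (-(S j - S m))) else 0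

open Classical in
/-- The sum of `exp (-(S_j - S_m))` from the origin down to the left wall, where `m` is the first
nonnegative deep bottom; it is `0` unless the wall is found before time `N`. -/
noncomputable def farSum (γ : ℝ) (n N : ℕ) (S : ℤ → ℝ) : ℝ≥0∞ :=
  ⨆ (m : ℕ) (M : ℕ),
    if (IsFirstBottom γ n S m ∧ IsFirstPassage (wallLevel (depthLevel γ n) (γ * logTwo n)
        (rightHalf S) m) (leftHalf S) M) ∧ M < N then
      ENNReal.ofReal (∑ j ∈ Finset.range M, Real.exp (-(S (-j) - S m))) else 0

lemma measurable_nearSum (γ : ℝ) (n N : ℕ) : Measurable (nearSum γ n N) := by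
  classical
  refine Measurable.iSup fun m => Measurable.iSup fun M => Measurable.ite ?_ ?_ measurable_const
  · exact measurableSet_setOfPred.2 (.and (.and (measurable_isFirstBottom γ n m)
      (measurable_isFirstRise _ m M)) measurable_const)
  · have he : ∀ j : ℕ, Measurable fun S : ℤ → ℝ => Real.exp (-(S j - S m)) := fun j =>
      Real.measurable_exp.comp ((measurable_eval j).sub (measurable_eval m)).neg
    exact (Finset.measurable_fun_sum _ fun j _ => he j).ennreal_ofReal

lemma measurable_farSum (γ : ℝ) (n N : ℕ) : Measurable (farSum γ n N) := by
  classical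
  refine Measurable.iSup fun m => Measurable.iSup fun M => Measurable.ite ?_ ?_ measurable_const
  · exact measurableSet_setOfPred.2 (.and (.and (measurable_isFirstBottom γ n m)
      (measurable_isFirstPassage _ _ m M)) measurable_const)
  · have he : ∀ j : ℕ, Measurable fun S : ℤ → ℝ => Real.exp (-(S (-j) - S m)) := fun j =>
      Real.measurable_exp.comp ((measurable_eval _).sub (measurable_eval m)).neg
    exact (Finset.measurable_fun_sum _ fun j _ => he j).ennreal_ofReal

lemma monotone_nearSum (γ : ℝ) (n : ℕ) : Monotone (nearSum γ n) := by
  intro N N' h S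
  refine iSup_mono fun m => iSup_mono fun M => ?_
  split_ifs with h1 h2
  · exact le_rfl
  · exact absurd ⟨h1.1, h1.2.trans_le h⟩ h2
  · exact zero_le
  · exact le_rfl

lemma monotone_farSum (γ : ℝ) (n : ℕ) : Monotone (farSum γ n) := by
  intro N N' h S
  refine iSup_mono fun m => iSup_mono fun M => ?_
  split_ifs with h1 h2
  · exact le_rfl
  · exact absurd ⟨h1.1, h1.2.trans_le h⟩ h2
  · exact zero_le
  · exact le_rfl

/-- A bound for the sum of `exp (-(S_j - S_m))` over the basic valley, if the bottom `m` is
nonnegative. -/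
noncomputable def sideSum (γ : ℝ) (n : ℕ) (S : ℤ → ℝ) : ℝ≥0∞ :=
  (⨆ N, nearSum γ n N S) + ⨆ N, farSum γ n N S

lemma measurable_sideSum (γ : ℝ) (n : ℕ) : Measurable (sideSum γ n) :=
  (Measurable.iSup fun N => measurable_nearSum γ n N).add
    (Measurable.iSup fun N => measurable_farSum γ n N)

lemma sum_le_sideSum {γ : ℝ} (hγ : 0 < γ) {n : ℕ} (hn : 3 < n) {S : ℤ → ℝ} {a b : ℤ} {m : ℕ}
    (hm : IsFirstBottom γ n S m) (ha : IsGreatest (leftSet γ n S m) a)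
    (hb : IsLeast (rightSet γ n S m) b) :
    ∑ j ∈ Finset.Icc a b, ENNReal.ofReal (Real.exp (-(S j - S m))) ≤ sideSum γ n S + 2 := by
  classical
  have hrise := isFirstRise_of_isLeast hb
  have hpass := isFirstPassage_of_isGreatest hγ hn ha
  have hΓ : 0 < depthLevel γ n :=
    (mul_pos hγ (logTwo_pos hn)).trans (margin_lt_depthLevel hn γ)
  have hend : ∀ x : ℤ, depthLevel γ n ≤ S x - S m →
      ENNReal.ofReal (Real.exp (-(S x - S m))) ≤ 1 := fun x hx => by
    rw [ENNReal.ofReal_le_one, Real.exp_le_one_iff]; linarith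
  have hea := hend a ha.1.2.2.1
  have heb := hend b hb.1.2.2.1
  have ha0 := ha.1.1
  have hb0 := hb.1.1
  obtain ⟨k, rfl⟩ : ∃ k : ℕ, a = -(k : ℤ) := ⟨(-a).toNat, by omega⟩
  lift b to ℕ using hb0
  simp only [neg_neg, Int.toNat_natCast] at hrise hpass
  have hsub : Finset.Icc (-(k : ℤ)) b ⊆ (Finset.range (b + 1)).image (fun j : ℕ => (j : ℤ)) ∪
      (Finset.range (k + 1)).image (fun j : ℕ => -(j : ℤ)) := by
    intro x hx
    rw [Finset.mem_Icc] at hx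
    simp only [Finset.mem_union, Finset.mem_image, Finset.mem_range]
    rcases le_or_gt 0 x with h | h
    · exact Or.inl ⟨x.toNat, by omega, by omega⟩
    · exact Or.inr ⟨(-x).toNat, by omega, by omega⟩
  set f : ℤ → ℝ≥0∞ := fun j => ENNReal.ofReal (Real.exp (-(S j - S m))) with hf
  have hnear : ∑ j ∈ Finset.range b, f j ≤ ⨆ N, nearSum γ n N S := by
    refine le_trans ?_ (le_iSup _ (b + 1))
    refine le_trans ?_ (le_iSup₂ m b)
    rw [if_pos ⟨⟨hm, hrise⟩, Nat.lt_succ_self b⟩,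
      ENNReal.ofReal_sum_of_nonneg fun i _ => (Real.exp_pos _).le]
  have hfar : ∑ j ∈ Finset.range k, f (-(j : ℤ)) ≤ ⨆ N, farSum γ n N S := by
    refine le_trans ?_ (le_iSup _ (k + 1))
    refine le_trans ?_ (le_iSup₂ m k)
    rw [if_pos ⟨⟨hm, hpass⟩, Nat.lt_succ_self k⟩,
      ENNReal.ofReal_sum_of_nonneg fun i _ => (Real.exp_pos _).le]
  calc ∑ j ∈ Finset.Icc (-(k : ℤ)) b, f j
      ≤ ∑ j ∈ (Finset.range (b + 1)).image (fun j : ℕ => (j : ℤ)) ∪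
          (Finset.range (k + 1)).image (fun j : ℕ => -(j : ℤ)), f j :=
        Finset.sum_le_sum_of_subset hsub
    _ ≤ ∑ j ∈ (Finset.range (b + 1)).image (fun j : ℕ => (j : ℤ)), f j +
          ∑ j ∈ (Finset.range (k + 1)).image (fun j : ℕ => -(j : ℤ)), f j := by
        rw [← Finset.sum_union_inter]
        exact le_self_add
    _ = ∑ j ∈ Finset.range (b + 1), f j + ∑ j ∈ Finset.range (k + 1), f (-(j : ℤ)) := by
        rw [Finset.sum_image (by simp), Finset.sum_image (by simp)]
    _ = (∑ j ∈ Finset.range b, f j + ∑ j ∈ Finset.range k, f (-(j : ℤ))) +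
          (f b + f (-(k : ℤ))) := by
        rw [Finset.sum_range_succ, Finset.sum_range_succ]; ring
    _ ≤ sideSum γ n S + (1 + 1) := by
        unfold sideSum
        gcongr
    _ = _ := by norm_num

lemma sum_basicValley_le {γ : ℝ} (hγ : 0 < γ) {n : ℕ} (hn : 3 < n) {S : ℤ → ℝ} {a m b : ℤ}
    (h : IsBasicValley γ n S a m b) :
    ∑ j ∈ Finset.Icc a b, ENNReal.ofReal (Real.exp (-(S j - S m))) ≤
      sideSum γ n S + sideSum γ n (mirror S) + 2 := by
  obtain ⟨⟨⟨a', c', hs⟩, -⟩, ha, hb⟩ := h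
  rcases le_or_gt 0 m with h0 | h0
  · lift m to ℕ using h0
    refine (sum_le_sideSum hγ hn hs.isFirstBottom ha hb).trans ?_
    gcongr
    exact le_self_add
  · obtain ⟨q, rfl⟩ : ∃ q : ℕ, m = -(q : ℤ) := ⟨(-m).toNat, by omega⟩
    have hs' := hs.mirror
    have ha' := isGreatest_leftSet_mirror hb
    have hb' := isLeast_rightSet_mirror ha
    rw [neg_neg] at hs' ha' hb'
    have h1 := sum_le_sideSum hγ hn hs'.isFirstBottom ha' hb'
    have h2 : ∑ j ∈ Finset.Icc (-b) (-a), ENNReal.ofReal (Real.exp (-(mirror S j - mirror S q))) =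
        ∑ j ∈ Finset.Icc a b, ENNReal.ofReal (Real.exp (-(S j - S (-(q : ℤ))))) := by
      refine Finset.sum_bij' (fun j _ => -j) (fun j _ => -j) ?_ ?_ ?_ ?_ ?_
      · intro j hj; rw [Finset.mem_Icc] at hj ⊢; omega
      · intro j hj; rw [Finset.mem_Icc] at hj ⊢; omega
      · intro j _; simp
      · intro j _; simp
      · intro j _; rfl
    rw [h2] at h1
    refine h1.trans ?_
    gcongr
    exact le_add_self

/-! ### The two-sided walk -/

/-- The potential with increments `e` to the right of the origin, and `l` to its left, read from
the origin. -/
def twoSided (p : (ℕ → ℝ) × (ℕ → ℝ)) (k : ℤ) : ℝ :=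
  if 0 ≤ k then partialSum p.1 k.toNat else partialSum p.2 (-k).toNat

lemma rightHalf_twoSided (p : (ℕ → ℝ) × (ℕ → ℝ)) : rightHalf (twoSided p) = partialSum p.1 := by
  funext k
  simp [rightHalf, twoSided]

lemma leftHalf_twoSided (p : (ℕ → ℝ) × (ℕ → ℝ)) : leftHalf (twoSided p) = partialSum p.2 := by
  funext k
  rcases Nat.eq_zero_or_pos k with rfl | hk
  · simp [leftHalf, twoSided, partialSum]
  · have : ¬ (0 : ℤ) ≤ -(k : ℤ) := by omega
    simp only [leftHalf, twoSided, this, if_false, neg_neg, Int.toNat_natCast]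

lemma mirror_twoSided (p : (ℕ → ℝ) × (ℕ → ℝ)) : mirror (twoSided p) = twoSided p.swap := by
  funext k
  rcases lt_trichotomy k 0 with hk | rfl | hk
  · have h1 : 0 ≤ -k := by omega
    have h2 : ¬ 0 ≤ k := by omega
    simp only [mirror, twoSided, h1, h2, if_true, if_false, Prod.fst_swap, Prod.snd_swap]
  · simp [mirror, twoSided, partialSum]
  · have h1 : ¬ 0 ≤ -k := by omega
    simp only [mirror, twoSided, hk.le, h1, if_true, if_false, Prod.fst_swap, neg_neg]

lemma twoSided_zero (p : (ℕ → ℝ) × (ℕ → ℝ)) : twoSided p 0 = 0 := by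
  simp [twoSided, partialSum]

lemma measurable_twoSided : Measurable twoSided := by
  refine measurable_pi_lambda _ fun k => ?_
  unfold twoSided
  split_ifs
  · exact (measurable_partialSum _).comp measurable_fst
  · exact (measurable_partialSum _).comp measurable_snd

/-- A bound for the mean of `sideSum`, uniform in the depth of the valley. -/
noncomputable def sideConst (L φ φ' : ℝ) : ℝ :=
  (linConst L φ + idleConst L φ + 1) + (linConst L φ' + 1)

section Mean

variable {ν ν' : Measure ℝ} [IsProbabilityMeasure ν] [IsProbabilityMeasure ν'] {L φ φ' : ℝ}
  (hν : IsCenteredStep ν L φ) (hν' : IsCenteredStep ν' L φ') {γ : ℝ} (hγ : 0 < γ) {n : ℕ}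
  (hn : 3 < n)
include hγ hn

include hν in
lemma lintegral_nearSum_le (N : ℕ) :
    ∫⁻ p, nearSum γ n N (twoSided p) ∂((iidLaw ν).prod (iidLaw ν')) ≤
      ENNReal.ofReal (linConst L φ + idleConst L φ + 1) := by
  have hΓ : 0 < depthLevel γ n :=
    (mul_pos hγ (logTwo_pos hn)).trans (margin_lt_depthLevel hn γ)
  have hmeas : Measurable fun p => nearSum γ n N (twoSided p) :=
    (measurable_nearSum γ n N).comp measurable_twoSided
  rw [lintegral_prod_symm' _ hmeas]
  calc _ ≤ ∫⁻ _ : ℕ → ℝ, ENNReal.ofReal (linConst L φ + idleConst L φ + 1) ∂(iidLaw ν') := by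
        refine lintegral_mono fun l => le_trans (lintegral_mono fun e => ?_)
          (lintegral_run_near_le (g := γ * logTwo n) (l := partialSum l) hν hΓ N)
        refine iSup₂_le fun m M => ?_
        split_ifs with h
        · have := le_run_near hγ hn (rightHalf_twoSided (e, l)) h.1.1 h.1.2 h.2
          rwa [leftHalf_twoSided] at this
        · exact zero_le
    _ = _ := by simp

include hν' in
lemma lintegral_farSum_le (N : ℕ) :
    ∫⁻ p, farSum γ n N (twoSided p) ∂((iidLaw ν).prod (iidLaw ν')) ≤
      ENNReal.ofReal (linConst L φ' + 1) := by
  have hg := mul_pos hγ (logTwo_pos hn)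
  have hΓ : 0 < depthLevel γ n := hg.trans (margin_lt_depthLevel hn γ)
  have hmeas : Measurable fun p => farSum γ n N (twoSided p) :=
    (measurable_farSum γ n N).comp measurable_twoSided
  rw [lintegral_prod _ hmeas.aemeasurable]
  calc _ ≤ ∫⁻ _ : ℕ → ℝ, ENNReal.ofReal (linConst L φ' + 1) ∂(iidLaw ν) := by
        refine lintegral_mono fun e => le_trans (lintegral_mono fun l => ?_)
          (lintegral_run_far_le hν' hΓ hg.le (partialSum_zero e) N)
        refine iSup₂_le fun m M => ?_
        split_ifs with h
        · have := le_run_far hγ hn (leftHalf_twoSided (e, l)) h.1.1 h.1.2 h.2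
          rwa [rightHalf_twoSided] at this
        · exact zero_le
    _ = _ := by simp

include hν hν' in
lemma lintegral_sideSum_le :
    ∫⁻ p, sideSum γ n (twoSided p) ∂((iidLaw ν).prod (iidLaw ν')) ≤
      ENNReal.ofReal (sideConst L φ φ') := by
  have h1 := hν.linConst_pos
  have h2 := hν.idleConst_pos
  have h3 := hν'.linConst_pos
  have hnear : ∀ N, Measurable fun p => nearSum γ n N (twoSided p) := fun N =>
    (measurable_nearSum γ n N).comp measurable_twoSided
  have hfar : ∀ N, Measurable fun p => farSum γ n N (twoSided p) := fun N =>
    (measurable_farSum γ n N).comp measurable_twoSided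
  unfold sideSum sideConst
  rw [lintegral_add_left (Measurable.iSup hnear),
    lintegral_iSup hnear (fun N N' h p => monotone_nearSum γ n h _),
    lintegral_iSup hfar (fun N N' h p => monotone_farSum γ n h _),
    ENNReal.ofReal_add (by positivity) (by positivity)]
  exact add_le_add (iSup_le fun N => lintegral_nearSum_le hν hγ hn N)
    (iSup_le fun N => lintegral_farSum_le hν' hγ hn N)

include hν hν' in
/-- Almost surely there is a deep valley. -/
lemma ae_exists_isDeepValley :
    ∀ᵐ p ∂((iidLaw ν).prod (iidLaw ν')), ∃ a m c, IsDeepValley γ n (twoSided p) a m c := by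
  have hg := mul_pos hγ (logTwo_pos hn)
  have hΓ : 0 < depthLevel γ n := hg.trans (margin_lt_depthLevel hn γ)
  have hL := hν.bound_pos
  set g := γ * logTwo n with hgdef
  set μ := (iidLaw ν).prod (iidLaw ν') with hμ
  have hreach : ∀ᵐ p ∂μ, ∀ i : ℕ, (∃ c, depthLevel γ n + i + g ≤ partialSum p.1 c) ∧
      ∃ c, depthLevel γ n + i + g ≤ partialSum p.2 c := by
    rw [ae_all_iff]
    intro i
    have hpos : 0 < depthLevel γ n + i + g := by positivity
    exact (Measure.quasiMeasurePreserving_fst.ae (ae_exists_le_partialSum hν hpos)).and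
      (Measure.quasiMeasurePreserving_snd.ae (ae_exists_le_partialSum hν' hpos))
  set B : Set ((ℕ → ℝ) × (ℕ → ℝ)) := {p | ∀ i : ℕ,
    (∃ k, HasRelapse (depthLevel γ n + i) g (partialSum p.1) k) ∨
      ∃ k, HasRelapse (depthLevel γ n + i) g (partialSum p.2) k} with hB
  have hB0 : μ B = 0 := by
    have hle : ∀ i : ℕ, (μ B).toReal ≤
        2 * ((g + L) / (depthLevel γ n + i + g + L)) := by
      intro i
      have hh : 0 < depthLevel γ n + i := by positivity
      have hc : 0 ≤ (g + L) / (depthLevel γ n + i + g + L) := by positivity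
      refine ENNReal.toReal_le_of_le_ofReal (by positivity) ?_
      have hsub : B ⊆ ({e | ∃ k, HasRelapse (depthLevel γ n + i) g (partialSum e) k} ×ˢ
          Set.univ) ∪ (Set.univ ×ˢ
            {e | ∃ k, HasRelapse (depthLevel γ n + i) g (partialSum e) k}) := by
        rintro p hp
        rcases hp i with h | h
        · exact Or.inl ⟨h, trivial⟩
        · exact Or.inr ⟨trivial, h⟩
      refine (measure_mono hsub).trans ((measure_union_le _ _).trans ?_)
      rw [hμ, Measure.prod_prod, Measure.prod_prod, measure_univ, measure_univ, mul_one, one_mul,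
        two_mul, ENNReal.ofReal_add hc hc]
      exact add_le_add (measure_exists_hasRelapse_le hν hh hg)
        (measure_exists_hasRelapse_le hν' hh hg)
    have hlim : Filter.Tendsto (fun i : ℕ => 2 * ((g + L) / (depthLevel γ n + i + g + L)))
        Filter.atTop (nhds (2 * 0)) := by
      refine Filter.Tendsto.const_mul _ (Filter.Tendsto.div_atTop tendsto_const_nhds ?_)
      exact Filter.tendsto_atTop_add_const_right _ _ (Filter.tendsto_atTop_add_const_right _ _
        (Filter.tendsto_atTop_add_const_left _ _ tendsto_natCast_atTop_atTop))
    rw [mul_zero] at hlim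
    have := le_antisymm (ge_of_tendsto' hlim hle) ENNReal.toReal_nonneg
    rcases (ENNReal.toReal_eq_zero_iff _).1 this with h | h
    · exact h
    · exact absurd h (measure_ne_top _ _)
  filter_upwards [hreach, measure_eq_zero_iff_ae_notMem.1 hB0] with p hp hpB
  simp only [hB, Set.mem_ofPred_eq, not_forall, not_or, not_exists] at hpB
  obtain ⟨i, h1, h2⟩ := hpB
  have hi : depthLevel γ n ≤ depthLevel γ n + i := by
    have : (0 : ℝ) ≤ i := by positivity
    linarith
  refine exists_isDeepValley hγ hn (twoSided_zero p) hi ?_ ?_ ?_ ?_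
  · rw [rightHalf_twoSided]; exact (hp i).1
  · rw [leftHalf_twoSided]; exact (hp i).2
  · rw [rightHalf_twoSided]; exact h1
  · rw [leftHalf_twoSided]; exact h2

end Mean

/-! ### The law of the random potential -/

lemma isCenteredStep {ν : Measure ℝ} [IsProbabilityMeasure ν] {L : ℝ} (hL : 0 < L)
    (hb : ∀ᵐ e ∂ν, |e| ≤ L) (hm : ∫ e, e ∂ν = 0) (h0 : ¬ ∀ᵐ e ∂ν, e = 0) :
    IsCenteredStep ν L (∫ e, Real.exp (-e / 2) ∂ν) := by
  refine ⟨hL, hb, hm, rfl, ?_⟩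
  have hi : Integrable (fun e : ℝ => e) ν :=
    Integrable.of_bound measurable_id.aestronglyMeasurable L hb
  have hi' : Integrable (fun e : ℝ => Real.exp (-e / 2)) ν := by
    refine Integrable.of_bound (C := Real.exp (L / 2)) ?_ ?_
    · exact (Real.measurable_exp.comp (measurable_id.neg.div_const 2)).aestronglyMeasurable
    · filter_upwards [hb] with e he
      rw [Real.norm_eq_abs, Real.abs_exp, Real.exp_le_exp]
      linarith [(abs_le.1 he).1]
  -- The convexity gap `exp (-e / 2) - 1 + e / 2` is nonnegative and vanishes at `e = 0` only.
  have hgap : ∀ e : ℝ, 0 ≤ Real.exp (-e / 2) - 1 + e / 2 := fun e => by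
    linarith [Real.add_one_le_exp (-e / 2)]
  have hsub : Integrable (fun e : ℝ => Real.exp (-e / 2) - 1) ν := hi'.sub (integrable_const 1)
  have hgi : Integrable (fun e : ℝ => Real.exp (-e / 2) - 1 + e / 2) ν :=
    hsub.add (hi.div_const 2)
  have hval : ∫ e, (Real.exp (-e / 2) - 1 + e / 2) ∂ν = ∫ e, Real.exp (-e / 2) ∂ν - 1 := by
    rw [integral_add hsub (hi.div_const 2),
      integral_sub hi' (integrable_const 1), integral_div, hm]
    simp
  have hnn : 0 ≤ ∫ e, (Real.exp (-e / 2) - 1 + e / 2) ∂ν := integral_nonneg hgap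
  refine lt_of_le_of_ne (by linarith) fun heq => h0 ?_
  rw [← heq, sub_self, integral_eq_zero_iff_of_nonneg_ae (ae_of_all _ hgap) hgi] at hval
  filter_upwards [hval] with e he
  by_contra hne
  have := Real.add_one_lt_exp (x := -e / 2) (by simpa using hne)
  simp only [Pi.zero_apply] at he
  linarith

/-- The two halves of an i.i.d. two-sided sequence are independent i.i.d. sequences; the signs are
those of the increments of the potential, read from the origin. -/
lemma map_halves_eq_prod {Ω : Type*} [MeasurableSpace Ω] {Q : Measure Ω} [IsProbabilityMeasure Q]
    {ξ : ℤ → Ω → ℝ} (hm : ∀ i, Measurable (ξ i)) (hind : iIndepFun ξ Q) {ν ν' : Measure ℝ}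
    [IsProbabilityMeasure ν] [IsProbabilityMeasure ν'] (hν : ∀ i, Q.map (ξ i) = ν)
    (hν' : ∀ i, Q.map (fun ω => -ξ i ω) = ν') :
    Q.map (fun ω => ((fun i : ℕ => ξ (i + 1) ω), fun i : ℕ => -ξ (-i) ω)) =
      (iidLaw ν).prod (iidLaw ν') := by
  have hme : Measurable fun ω => (fun i : ℕ => ξ (i + 1) ω) :=
    measurable_pi_lambda _ fun i => hm _
  have hml : Measurable fun ω => (fun i : ℕ => -ξ (-i) ω) :=
    measurable_pi_lambda _ fun i => (hm _).neg
  have h1 : Q.map (fun ω => (fun i : ℕ => ξ (i + 1) ω)) = iidLaw ν := by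
    have hinj : Function.Injective fun i : ℕ => (i : ℤ) + 1 := fun i j h => by simpa using h
    have := (hind.precomp hinj).map_fun_eq_infinitePi_map fun i => hm _
    simp_rw [hν] at this
    exact this
  have h2 : Q.map (fun ω => (fun i : ℕ => -ξ (-i) ω)) = iidLaw ν' := by
    have hinj : Function.Injective fun i : ℕ => -(i : ℤ) := fun i j h => by simpa using h
    have hneg := (hind.precomp hinj).comp (fun _ x => -x) fun _ => measurable_neg
    have := hneg.map_fun_eq_infinitePi_map fun i => measurable_neg.comp (hm _)
    have h3 : ∀ i : ℕ, Q.map ((fun x => -x) ∘ ξ (-i)) = ν' := fun i => hν' _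
    simp_rw [h3] at this
    exact this
  have hI : IndepFun (fun ω => (fun i : ℕ => ξ (i + 1) ω)) (fun ω => (fun i : ℕ => -ξ (-i) ω))
      Q := by
    have hdis : Disjoint {i : ℤ | 0 < i} {i : ℤ | i ≤ 0} :=
      Set.disjoint_left.2 fun i h h' => by simp only [Set.mem_ofPred_eq] at h h'; omega
    have := indep_iSup_of_disjoint (fun i => (hm i).comap_le) hind.iIndep hdis
    rw [IndepFun_iff_Indep]
    refine indep_of_indep_of_le_left (indep_of_indep_of_le_right this ?_) ?_
    · rw [← measurable_iff_comap_le]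
      refine @measurable_pi_lambda _ _ _ (_) _ _ fun i => ?_
      refine Measurable.neg ?_
      rw [measurable_iff_comap_le]
      exact le_iSup₂_of_le (-(i : ℤ)) (by simp) le_rfl
    · rw [← measurable_iff_comap_le]
      refine @measurable_pi_lambda _ _ _ (_) _ _ fun i => ?_
      rw [measurable_iff_comap_le]
      exact le_iSup₂_of_le ((i : ℤ) + 1) (by simp only [Set.mem_ofPred_eq]; omega) le_rfl
  rw [(indepFun_iff_map_prod_eq_prod_map_map hme.aemeasurable hml.aemeasurable).1 hI, h1, h2]

lemma potential_eq_twoSided (α : Environment) :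
    potential α = twoSided ((fun i : ℕ => logRatio α (i + 1)), fun i : ℕ => -logRatio α (-i)) := by
  have hr : ∀ k : ℕ, potential α k = partialSum (fun i : ℕ => logRatio α (i + 1)) k := by
    intro k
    induction k with
    | zero => simp [potential_zero, partialSum]
    | succ k ih =>
      have := potential_sub_one α ((k + 1 : ℕ) : ℤ)
      rw [partialSum_succ, ← ih]
      push_cast at this ⊢
      rw [add_sub_cancel_right] at this
      linarith
  have hl : ∀ k : ℕ, potential α (-k) = partialSum (fun i : ℕ => -logRatio α (-i)) k := by
    intro k
    induction k with
    | zero => simp [potential_zero, partialSum]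
    | succ k ih =>
      have := potential_sub_one α (-(k : ℤ))
      rw [partialSum_succ, ← ih]
      push_cast
      rw [show -(k : ℤ) - 1 = -1 + -(k : ℤ) by ring] at this
      rw [show -((k : ℤ) + 1) = -1 + -(k : ℤ) by ring]
      linarith
  funext k
  unfold twoSided
  split_ifs with h
  · rw [← hr, Int.toNat_of_nonneg h]
  · rw [← hl, Int.toNat_of_nonneg (by omega), neg_neg]

/-! ### The excursion from the bottom of the basic valley -/

lemma meanExcursionTime_eq {γ : ℝ} {n : ℕ} {α : Environment} {a m b : ℤ}
    (h : IsBasicValley γ n (potential α) a m b) :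
    meanExcursionTime γ n α = excursionGreen α m (Finset.Icc a b) := by
  obtain ⟨h1, h2, h3⟩ := h.eq
  unfold meanExcursionTime basicValley
  rw [h1, h2, h3, lintegral_localTimeOn]

lemma one_le_meanExcursionTime {γ : ℝ} {n : ℕ} {α : Environment} {a m b : ℤ}
    (h : IsBasicValley γ n (potential α) a m b) : 1 ≤ meanExcursionTime γ n α := by
  have ha : a < m := h.2.1.1.2.1
  have hb : m < b := h.2.2.1.2.1
  rw [meanExcursionTime_eq h]
  refine one_le_excursionGreen α m _ ?_ ?_ <;> rw [Finset.mem_Icc] <;> omega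

lemma meanExcursionTime_le {γ : ℝ} (hγ : 0 < γ) {n : ℕ} (hn : 3 < n) {α : Environment} {L : ℝ}
    (hL : ∀ k, |logRatio α k| ≤ L) {a m b : ℤ} (h : IsBasicValley γ n (potential α) a m b) :
    meanExcursionTime γ n α ≤ ENNReal.ofReal (1 + Real.exp L) *
      (sideSum γ n (potential α) + sideSum γ n (mirror (potential α)) + 2) := by
  rw [meanExcursionTime_eq h]
  exact (excursionGreen_le α m _ L hL).trans (by gcongr; exact sum_basicValley_le hγ hn h)

lemma measurable_logRatio (k : ℤ) : Measurable fun α : Environment => logRatio α k := by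
  have h : Measurable fun α : Environment => (α k : ℝ) :=
    measurable_subtype_coe.comp (measurable_pi_apply k)
  exact Real.measurable_log.comp ((h.const_sub 1).div h)

lemma measurable_potential : Measurable potential :=
  measurable_pi_lambda _ fun _ => (Finset.measurable_fun_sum _ fun i _ => measurable_logRatio i).sub
    (Finset.measurable_fun_sum _ fun i _ => measurable_logRatio i)

lemma aemeasurable_meanExcursionTime {Ω : Type*} [MeasurableSpace Ω] {Q : Measure Ω}
    {α : Ω → Environment} (hα : Measurable α) {γ : ℝ} {n : ℕ}
    (h : ∀ᵐ ω ∂Q, ∃ a m b, IsBasicValley γ n (potential (α ω)) a m b) :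
    AEMeasurable (fun ω => meanExcursionTime γ n (α ω)) Q := by
  classical
  let F : Environment → ℝ≥0∞ := fun α => ⨆ (a : ℤ) (m : ℤ) (b : ℤ),
    if IsBasicValley γ n (potential α) a m b then excursionGreen α m (Finset.Icc a b) else 0
  have hF : Measurable F := by
    refine Measurable.iSup fun a => Measurable.iSup fun m => Measurable.iSup fun b =>
      Measurable.ite ?_ (measurable_excursionGreen m _) measurable_const
    exact measurableSet_setOfPred.2 ((measurable_isBasicValley γ n a m b).comp measurable_potential)
  refine ⟨fun ω => F (α ω), hF.comp hα, ?_⟩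
  filter_upwards [h] with ω hω
  obtain ⟨a, m, b, hv⟩ := hω
  refine le_antisymm ?_ (iSup_le fun a' => iSup₂_le fun m' b' => ?_)
  · rw [meanExcursionTime_eq hv]
    refine le_trans ?_ (le_iSup _ a)
    refine le_trans ?_ (le_iSup₂ m b)
    rw [if_pos hv]
  · split_ifs with hv'
    · rw [meanExcursionTime_eq hv']
    · exact zero_le

/-! ### Conclusion -/

lemma abs_logRatio_le {α : Environment} {k : ℤ} {δ : ℝ} (hδ : 0 < δ) (h1 : δ ≤ α k)
    (h2 : (α k : ℝ) ≤ 1 - δ) : |logRatio α k| ≤ Real.log ((1 - δ) / δ) := by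
  have hα := (α k).2.1
  have hδ1 : 0 < 1 - δ := hα.trans_le h2
  have hα1 : 0 < 1 - (α k : ℝ) := by linarith
  have hinv : -Real.log ((1 - δ) / δ) = Real.log (δ / (1 - δ)) := by
    rw [← Real.log_inv, inv_div]
  rw [logRatio, abs_le, hinv]
  constructor
  · exact Real.log_le_log (by positivity)
      (div_le_div₀ hα1.le (by linarith) hα h2)
  · exact Real.log_le_log (by positivity)
      (div_le_div₀ hδ1.le (by linarith) hδ h1)

end SinaiWalk

open SinaiWalk in
theorem mainTheorem5 {Ω : Type*} [MeasurableSpace Ω] (Q : Measure Ω) [IsProbabilityMeasure Q]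
    (α : Ω → SinaiWalk.Environment)
    (hmeas : ∀ i : ℤ, Measurable fun ω => α ω i)
    (hindep : iIndepFun (fun (i : ℤ) ω => α ω i) Q)
    (hident : ∀ i : ℤ, IdentDistrib (fun ω => α ω i) (fun ω => α ω 0) Q Q)
    (hmean : ∫ ω, SinaiWalk.logRatio (α ω) 0 ∂Q = 0)
    (hvar : 0 < variance (fun ω => SinaiWalk.logRatio (α ω) 0) Q)
    (η₀ : ℝ) (hη₀ : 0 < η₀) (hη₀' : η₀ < 1 / 2)
    (hsup : sSup {x : ℝ | Q {ω | x ≤ (α ω 0 : ℝ)} = 1} =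
      sSup {x : ℝ | Q {ω | (α ω 0 : ℝ) ≤ 1 - x} = 1})
    (hreg : η₀ ≤ sSup {x : ℝ | Q {ω | x ≤ (α ω 0 : ℝ)} = 1}) :
    ∃ c₁ : ℝ, 0 < c₁ ∧ ∀ γ : ℝ, 0 < γ → ∀ n : ℕ, 3 < n →
      (∀ᵐ ω ∂Q, ∃ M' m M'' : ℤ,
        SinaiWalk.IsSmallestDeepValley γ n (SinaiWalk.potential (α ω)) M' m M'') ∧
      AEMeasurable (fun ω => SinaiWalk.meanExcursionTime γ n (α ω)) Q ∧
      1 ≤ ∫⁻ ω, SinaiWalk.meanExcursionTime γ n (α ω) ∂Q ∧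
      ∫⁻ ω, SinaiWalk.meanExcursionTime γ n (α ω) ∂Q ≤ ENNReal.ofReal c₁ ∧
      ∀ θ : ℕ → ℝ, (∀ k, 0 < θ k) → Monotone θ →
        Q {ω | ENNReal.ofReal (θ n) < SinaiWalk.meanExcursionTime γ n (α ω)} ≤
          ENNReal.ofReal (c₁ / θ n) := by
  have hα : Measurable α := measurable_pi_lambda _ hmeas
  set ξ : ℤ → Ω → ℝ := fun i ω => logRatio (α ω) i with hξ
  have hξm : ∀ i, Measurable (ξ i) := fun i => (measurable_logRatio i).comp hα
  set f : Set.Ioo (0 : ℝ) 1 → ℝ := fun x => Real.log ((1 - (x : ℝ)) / x) with hf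
  have hfm : Measurable f := by
    have h : Measurable fun x : Set.Ioo (0 : ℝ) 1 => (x : ℝ) := measurable_subtype_coe
    exact Real.measurable_log.comp ((h.const_sub 1).div h)
  have hξi : iIndepFun ξ Q := hindep.comp (fun _ => f) fun _ => hfm
  have hξd : ∀ i, IdentDistrib (ξ i) (ξ 0) Q Q := fun i => (hident i).comp hfm
  -- Uniform ellipticity, with `η₀ / 2` in place of the supremum, which might not be attained.
  set δ := η₀ / 2 with hδdef
  have hδ : 0 < δ := by positivity
  have hδη : δ < η₀ := by rw [hδdef]; linarith
  have hlow : ∀ᵐ ω ∂Q, δ ≤ (α ω 0 : ℝ) := by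
    have hne : {x : ℝ | Q {ω | x ≤ (α ω 0 : ℝ)} = 1}.Nonempty := by
      by_contra hcon
      rw [Set.not_nonempty_iff_eq_empty.1 hcon, Real.sSup_empty] at hreg
      linarith
    obtain ⟨x, hx, hxδ⟩ := exists_lt_of_lt_csSup hne (hδη.trans_le hreg)
    have hx' : ∀ᵐ ω ∂Q, x ≤ (α ω 0 : ℝ) := (mem_ae_iff_prob_eq_one
      (measurableSet_le measurable_const (measurable_subtype_coe.comp (hmeas 0)))).2 hx
    exact hx'.mono fun ω h => hxδ.le.trans h
  have hupp : ∀ᵐ ω ∂Q, (α ω 0 : ℝ) ≤ 1 - δ := by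
    rw [hsup] at hreg
    have hne : {x : ℝ | Q {ω | (α ω 0 : ℝ) ≤ 1 - x} = 1}.Nonempty := by
      by_contra hcon
      rw [Set.not_nonempty_iff_eq_empty.1 hcon, Real.sSup_empty] at hreg
      linarith
    obtain ⟨x, hx, hxδ⟩ := exists_lt_of_lt_csSup hne (hδη.trans_le hreg)
    have hx' : ∀ᵐ ω ∂Q, (α ω 0 : ℝ) ≤ 1 - x := (mem_ae_iff_prob_eq_one
      (measurableSet_le (measurable_subtype_coe.comp (hmeas 0)) measurable_const)).2 hx
    exact hx'.mono fun ω h => by linarith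
  set L := Real.log ((1 - δ) / δ) with hLdef
  have hL : 0 < L := Real.log_pos (by rw [lt_div_iff₀ hδ]; linarith)
  have hb0 : ∀ᵐ ω ∂Q, |ξ 0 ω| ≤ L := by
    filter_upwards [hlow, hupp] with ω h1 h2 using abs_logRatio_le hδ h1 h2
  have hball : ∀ᵐ ω ∂Q, ∀ k, |logRatio (α ω) k| ≤ L := by
    rw [ae_all_iff]
    exact fun k => (hξd k).symm.ae_snd (p := fun x => |x| ≤ L)
      (measurableSet_le measurable_id.abs measurable_const) hb0
  -- The steps of the potential to the right of the origin have law `ν`, those to its left `ν'`.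
  have hneg : Measurable fun ω => -ξ 0 ω := (hξm 0).neg
  set ν := Q.map (ξ 0) with hν
  set ν' := Q.map (fun ω => -ξ 0 ω) with hν'
  have : IsProbabilityMeasure ν := Measure.isProbabilityMeasure_map (hξm 0).aemeasurable
  have : IsProbabilityMeasure ν' := Measure.isProbabilityMeasure_map hneg.aemeasurable
  have hne0 : ¬ ∀ᵐ ω ∂Q, ξ 0 ω = 0 := fun h => by
    have h' : variance (ξ 0) Q = 0 := by
      rw [variance_congr (show ξ 0 =ᵐ[Q] 0 from h), variance_zero]
    exact hvar.ne' h'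
  have hstep : IsCenteredStep ν L (∫ e, Real.exp (-e / 2) ∂ν) := by
    refine isCenteredStep hL ?_ ?_ fun h => hne0 (ae_of_ae_map (hξm 0).aemeasurable h)
    · exact (ae_map_iff (hξm 0).aemeasurable
        (measurableSet_le measurable_id.abs measurable_const)).2 hb0
    · rw [hν, integral_map (hξm 0).aemeasurable (f := fun e => e) measurable_id.aestronglyMeasurable]
      exact hmean
  have hstep' : IsCenteredStep ν' L (∫ e, Real.exp (-e / 2) ∂ν') := by
    refine isCenteredStep hL ?_ ?_ fun h => hne0 ?_
    · refine (ae_map_iff hneg.aemeasurable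
        (measurableSet_le measurable_id.abs measurable_const)).2 ?_
      simpa only [id, abs_neg] using hb0
    · rw [hν', integral_map hneg.aemeasurable (f := fun e => e) measurable_id.aestronglyMeasurable,
        integral_neg, neg_eq_zero]
      exact hmean
    · exact (ae_of_ae_map hneg.aemeasurable h).mono fun ω => neg_eq_zero.1
  set φ := ∫ e, Real.exp (-e / 2) ∂ν
  set φ' := ∫ e, Real.exp (-e / 2) ∂ν'
  set p : Ω → (ℕ → ℝ) × (ℕ → ℝ) :=
    fun ω => ((fun i : ℕ => ξ (i + 1) ω), fun i : ℕ => -ξ (-i) ω) with hp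
  have hpm : Measurable p := (measurable_pi_lambda _ fun i => hξm _).prodMk
    (measurable_pi_lambda _ fun i => (hξm _).neg)
  have hplaw : Q.map p = (iidLaw ν).prod (iidLaw ν') :=
    map_halves_eq_prod hξm hξi (fun i => (hξd i).map_eq)
      fun i => ((hξd i).comp measurable_neg).map_eq
  have hpot : ∀ ω, potential (α ω) = twoSided (p ω) := fun ω => potential_eq_twoSided (α ω)
  have hside : ∀ {ν₁ ν₂ : Measure ℝ} [IsProbabilityMeasure ν₁] [IsProbabilityMeasure ν₂]
      {φ₁ φ₂ : ℝ}, IsCenteredStep ν₁ L φ₁ → IsCenteredStep ν₂ L φ₂ → 0 < sideConst L φ₁ φ₂ := by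
    intro ν₁ ν₂ _ _ φ₁ φ₂ h1 h2
    have := h1.linConst_pos
    have := h1.idleConst_pos
    have := h2.linConst_pos
    unfold sideConst
    positivity
  have hK := hside hstep hstep'
  have hK' := hside hstep' hstep
  refine ⟨(1 + Real.exp L) * (sideConst L φ φ' + sideConst L φ' φ + 2), by positivity,
    fun γ hγ n hn => ?_⟩
  have hsmall : ∀ᵐ ω ∂Q, ∃ M' m M'' : ℤ,
      IsSmallestDeepValley γ n (potential (α ω)) M' m M'' := by
    have h := ae_exists_isDeepValley hstep hstep' hγ hn
    rw [← hplaw] at h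
    filter_upwards [ae_of_ae_map hpm.aemeasurable h] with ω hω
    rw [hpot]
    exact exists_isSmallestDeepValley hω
  have hbasic : ∀ᵐ ω ∂Q, ∃ a m b, IsBasicValley γ n (potential (α ω)) a m b :=
    hsmall.mono fun ω h => exists_isBasicValley hγ hn h
  have haem := aemeasurable_meanExcursionTime hα hbasic
  have hupper : ∫⁻ ω, meanExcursionTime γ n (α ω) ∂Q ≤
      ENNReal.ofReal ((1 + Real.exp L) * (sideConst L φ φ' + sideConst L φ' φ + 2)) := by
    have hs : Measurable fun q => sideSum γ n (twoSided q) :=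
      (measurable_sideSum γ n).comp measurable_twoSided
    have hs1 : Measurable fun ω => sideSum γ n (twoSided (p ω)) := hs.comp hpm
    have hpm' : Measurable fun ω => (p ω).swap := measurable_swap.comp hpm
    have hs12 : Measurable fun ω => sideSum γ n (twoSided (p ω)) +
        sideSum γ n (twoSided (p ω).swap) := hs1.add (hs.comp hpm')
    have hswap : Q.map (fun ω => (p ω).swap) = (iidLaw ν').prod (iidLaw ν) := by
      rw [← Measure.prod_swap, ← hplaw, Measure.map_map measurable_swap hpm]
      rfl
    have hi1 : ∫⁻ ω, sideSum γ n (twoSided (p ω)) ∂Q ≤ ENNReal.ofReal (sideConst L φ φ') := by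
      rw [← lintegral_map hs hpm, hplaw]
      exact lintegral_sideSum_le hstep hstep' hγ hn
    have hi2 : ∫⁻ ω, sideSum γ n (twoSided (p ω).swap) ∂Q ≤
        ENNReal.ofReal (sideConst L φ' φ) := by
      rw [← lintegral_map hs hpm', hswap]
      exact lintegral_sideSum_le hstep' hstep hγ hn
    calc ∫⁻ ω, meanExcursionTime γ n (α ω) ∂Q
        ≤ ∫⁻ ω, ENNReal.ofReal (1 + Real.exp L) * (sideSum γ n (twoSided (p ω)) +
            sideSum γ n (twoSided (p ω).swap) + 2) ∂Q := by
          refine lintegral_mono_ae ?_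
          filter_upwards [hball, hbasic] with ω hω hv
          obtain ⟨a, m, b, hv⟩ := hv
          have := meanExcursionTime_le hγ hn hω hv
          rwa [hpot, mirror_twoSided] at this
      _ = ENNReal.ofReal (1 + Real.exp L) * (∫⁻ ω, sideSum γ n (twoSided (p ω)) ∂Q +
            ∫⁻ ω, sideSum γ n (twoSided (p ω).swap) ∂Q + 2) := by
          rw [lintegral_const_mul _ (hs12.add_const 2), lintegral_add_left hs12,
            lintegral_add_left hs1]
          simp
      _ ≤ ENNReal.ofReal (1 + Real.exp L) * (ENNReal.ofReal (sideConst L φ φ') +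
            ENNReal.ofReal (sideConst L φ' φ) + ENNReal.ofReal 2) := by
          gcongr
          simp
      _ = _ := by
          rw [← ENNReal.ofReal_add hK.le hK'.le, ← ENNReal.ofReal_add (by positivity) (by norm_num),
            ← ENNReal.ofReal_mul (by positivity)]
  refine ⟨hsmall, haem, ?_, hupper, fun θ hθ _ => ?_⟩
  · calc (1 : ℝ≥0∞) = ∫⁻ _, 1 ∂Q := by simp
      _ ≤ _ := lintegral_mono_ae <| hbasic.mono fun ω ⟨a, m, b, hv⟩ => one_le_meanExcursionTime hv
  · have hθ0 : ENNReal.ofReal (θ n) ≠ 0 := by simpa using hθ n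
    calc Q {ω | ENNReal.ofReal (θ n) < meanExcursionTime γ n (α ω)}
        ≤ Q {ω | ENNReal.ofReal (θ n) ≤ meanExcursionTime γ n (α ω)} :=
          measure_mono fun ω h => by rw [Set.mem_ofPred_eq] at h ⊢; exact h.le
      _ ≤ (∫⁻ ω, meanExcursionTime γ n (α ω) ∂Q) / ENNReal.ofReal (θ n) :=
          meas_ge_le_lintegral_div haem hθ0 ENNReal.ofReal_ne_top
      _ ≤ _ := by
          rw [ENNReal.ofReal_div_of_pos (hθ n)]
          gcongr
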